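/- Let $q$ be a prime power, $m\ge 1$, and let $\mathrm{RM}_q(2,m)=\{(f(\mathbf v))_{\mathbf v\in\mathbb F_q^m} : f\in\mathbb F_q[x_1,\dots,x_m],\ \deg f\le 2\}$ be the second order $q$-ary Reed–Muller code of length $q^m$. Let $A_w$ be the number of its codewords of Hamming weight $w$. For a quadratic form $Q$ on $\mathbb F_q^m$ with polar form $B_Q$, its rank is $m-\dim(Q^{-1}(0)\cap\operatorname{Rad}B_Q)$. Two quadratic forms are equivalent if an invertible linear change of variables takes one to the other. A form of rank $0$ has type $1$. A form of even rank $r\ge2$ has type $1$ (resp. $-1$) if it is equivalent to the following. For $q$ even: $\sum_{i=1}^{r/2}x_{2i-1}x_{2i}$ (resp. $\sum_{i=1}^{r/2-1}x_{2i-1}x_{2i}+x_{r-1}^2+x_{r-1}x_r+\lambda x_r^2$ for some $\lambda\neq 0$ of absolute trace $1$). For $q$ odd: $\sum_{i=1}^{r/2-1}x_{2i-1}x_{2i}+x_{r-1}^2-x_r^2$ (resp. $\sum_{i=1}^{r/2-1}x_{2i-1}x_{2i}+x_{r-1}^2-\lambda x_r^2$ for some nonsquare $\lambda$). Let $v_{2j,\tau}$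 be the number of quadratic forms on $\mathbb F_q^m$ of rank $2j$ and type $\tau\in\{1,-1\}$, and $v_{2j+1}$ the number of those of rank $2j+1$. Then $v_{0,1}=1$ and $$v_{2j,\tau}=\frac{q^{j^2}(q^j+\tau)}{2}\,\frac{\prod_{i=m-2j+1}^m(q^i-1)}{\prod_{i=1}^j(q^{2i}-1)}\quad(2\le 2j\le m),\qquad v_{2j+1}=q^{j^2+j}\,\frac{\prod_{i=m-2j}^m(q^i-1)}{\prod_{i=1}^j(q^{2i}-1)}\quad(1\le 2j+1\le m),$$ and $v_{2j+1}=0$ if $2j+1>m$. (1) If $q=2$ and $m\ge2$, then $A_0=A_{2^m}=1$, $$A_{2^{m-1}}=2\Bigl(2^m-1+\sum_{j=1}^{\lfloor (m-1)/2\rfloor}2^{j^2+j}\,\frac{\prod_{i=m-2j}^m(2^i-1)}{\prod_{i=1}^j(2^{2i}-1)}\Bigr),$$ $$A_{2^{m-1}+2^{m-j-1}}=A_{2^{m-1}-2^{m-j-1}}=2^{j^2+j}\,\frac{\prod_{i=m-2j+1}^m(2^i-1)}{\prod_{i=1}^j(2^{2i}-1)}\quad(1\le j\le\lfloor m/2\rfloor),$$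 and $A_w=0$ for every other $w$. (2) If $q>2$ and $m\ge1$, then $A_0=1$; for $1\le j\le\lfloor m/2\rfloor$ and $\tau\in\{1,-1\}$, $$A_{q^m-q^{m-1}-\tau q^{m-j-1}(q-1)}=\frac{q^{j^2+2j}(q^j+\tau)}{2}\,\frac{\prod_{i=m-2j+1}^m(q^i-1)}{\prod_{i=1}^j(q^{2i}-1)},$$ $$A_{q^m-q^{m-1}+\tau q^{m-j-1}}=(q-1)q^{2j}v_{2j,\tau}+\frac{q-1}{2}q^{2j+1}v_{2j+1};$$ moreover $$A_{q^m-2q^{m-1}}=\frac{q(q-1)(q^m-1)}{2},\qquad A_{q^m}=\frac{q(q-1)(q^m-1)}{2}+q-1,$$ $$A_{q^m-q^{m-1}}=q^{\frac{m^2+3m+2}{2}}-\sum_{j=1}^{\lfloor m/2\rfloor}q^{2j+1}(v_{2j,1}+v_{2j,-1})-\sum_{j=0}^{\lfloor m/2\rfloor}(q-1)q^{2j+1}v_{2j+1}-q,$$ and $A_w=0$ for every other $w$. -/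

import Mathlib

open scoped BigOperators

noncomputable section

namespace ReedMuller

/-- The `r`-th order Reed–Muller code over `F` in `m` variables: all value tables
`(f(v))_{v ∈ F^m}` of polynomials `f` in `m` variables of total degree at most `r`. -/
def RM (F : Type*) [Field F] (r m : ℕ) : Submodule F ((Fin m → F) → F) :=
  (MvPolynomial.restrictTotalDegree (Fin m) F r).map (MvPolynomial.evalₗ F (Fin m))

/-- `weightFreq C w` is the number `A_w` of codewords of Hamming weight `w` in the code `C`
(the index is an integer, so that subtractions in expressions for weights are genuine). -/
def weightFreq {F : Type*} [Field F] [DecidableEq F] {ι : Type*} [Fintype ι]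
    (C : Submodule F (ι → F)) (w : ℤ) : ℕ :=
  Set.ncard {c : ι → F | c ∈ C ∧ (hammingNorm c : ℤ) = w}

/-- The rank of a quadratic form on `F^m`: `m` minus the dimension of its radical
`Q⁻¹(0) ∩ Rad B_Q`, where `B_Q` is the polar bilinear form. -/
def quadRank {F : Type*} [Field F] {m : ℕ} (Q : QuadraticForm F (Fin m → F)) : ℕ :=
  m - Module.finrank F Q.radical

/-- The coordinate function `x ↦ x i` on `F^m`, coordinates being numbered from `0`.
It is only used for `i < m`. -/
def coord (F : Type*) [Field F] (m i : ℕ) : (Fin m → F) →ₗ[F] F :=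
  if h : i < m then LinearMap.proj ⟨i, h⟩ else 0

/-- The quadratic form `x ↦ x i * x j` on `F^m`. -/
def monom (F : Type*) [Field F] (m i j : ℕ) : QuadraticForm F (Fin m → F) :=
  QuadraticMap.linMulLin (coord F m i) (coord F m j)

/-- The quadratic form `x 0 * x 1 + x 2 * x 3 + ⋯ + x (2k-2) * x (2k-1)` on `F^m`. -/
def hyperbolic (F : Type*) [Field F] (m k : ℕ) : QuadraticForm F (Fin m → F) :=
  ∑ i ∈ Finset.range k, monom F m (2 * i) (2 * i + 1)

/-- The absolute trace of a finite field, that is, the trace down to its prime field. -/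
def absTrace {F : Type*} [Field F] (x : F) : (⊥ : Subfield F) :=
  Algebra.trace (⊥ : Subfield F) F x

/-- `IsCanonical F m r τ Q` says that `Q` is a canonical quadratic form on `F^m` of rank `r`
and type `τ` (for `r ≤ m`). If `|F|` is even, there is no type for odd rank. -/
inductive IsCanonical (F : Type*) [Field F] (m : ℕ) :
    ℕ → ℤˣ → QuadraticForm F (Fin m → F) → Prop
  | zero : IsCanonical F m 0 1 0
  | even_plus (hF : Even (Nat.card F)) (k : ℕ) :
      IsCanonical F m (2 * k + 2) 1 (hyperbolic F m (k + 1))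
  | even_minus (hF : Even (Nat.card F)) (k : ℕ) (l : F) (hl0 : l ≠ 0) (hl : absTrace l = 1) :
      IsCanonical F m (2 * k + 2) (-1)
        (hyperbolic F m k + monom F m (2 * k) (2 * k) + monom F m (2 * k) (2 * k + 1)
          + l • monom F m (2 * k + 1) (2 * k + 1))
  | odd_odd_plus (hF : Odd (Nat.card F)) (k : ℕ) :
      IsCanonical F m (2 * k + 1) 1 (hyperbolic F m k + monom F m (2 * k) (2 * k))
  | odd_odd_minus (hF : Odd (Nat.card F)) (k : ℕ) (l : F) (hl : ¬ IsSquare l) :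
      IsCanonical F m (2 * k + 1) (-1) (hyperbolic F m k + l • monom F m (2 * k) (2 * k))
  | odd_even_plus (hF : Odd (Nat.card F)) (k : ℕ) :
      IsCanonical F m (2 * k + 2) 1
        (hyperbolic F m k + monom F m (2 * k) (2 * k) - monom F m (2 * k + 1) (2 * k + 1))
  | odd_even_minus (hF : Odd (Nat.card F)) (k : ℕ) (l : F) (hl : ¬ IsSquare l) :
      IsCanonical F m (2 * k + 2) (-1)
        (hyperbolic F m k + monom F m (2 * k) (2 * k) - l • monom F m (2 * k + 1) (2 * k + 1))

/-- `Q` is of type `τ`: it is equivalent, under an invertible linear change of variables, to a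
canonical form of type `τ` and of the same rank. -/
def HasType {F : Type*} [Field F] {m : ℕ} (Q : QuadraticForm F (Fin m → F)) (τ : ℤˣ) : Prop :=
  ∃ Q₀ : QuadraticForm F (Fin m → F), IsCanonical F m (quadRank Q) τ Q₀ ∧ Q.Equivalent Q₀

/-- The number of quadratic forms on `F^m` of rank `r`; for `r = 2j+1` this is `v_{2j+1}`. -/
def vRank (F : Type*) [Field F] (m r : ℕ) : ℕ :=
  Set.ncard {Q : QuadraticForm F (Fin m → F) | quadRank Q = r}

/-- The number of quadratic forms on `F^m` of rank `r` and type `τ`; for `r = 2j` this is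
`v_{2j,τ}`. -/
def vRankType (F : Type*) [Field F] (m r : ℕ) (τ : ℤˣ) : ℕ :=
  Set.ncard {Q : QuadraticForm F (Fin m → F) | quadRank Q = r ∧ HasType Q τ}

end ReedMuller

end

set_option linter.unusedSectionVars false

/-! For a function f on a finite vector space V over a field F of q elements, let the deviation of f
(`dev`) be its number of zeros minus |V|/q. On F^m, m ≥ 1, a word f has weight q^m - q^(m-1) - `dev
f`, so the weights are governed by the deviations of the functions Q + L + c with Q quadratic, L
linear and c constant.

Put X_k = q^m / q^(k+1) (`scale`). A quadratic form is a sum of hyperbolic planes and an anisotropic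
remainder in at most two variables (`exists_shape`). By a translation, each hyperbolic plane absorbs
the part of L that lives on it, and it divides the deviation by q (`dev_hyp_add`). What remains is
an affine function plus the remainder, and elementary counting gives the possible deviations of Q +
L + c: 0, τ(q-1)X_k, -τX_k in rank 2k and type τ, and 0, ±X_k in rank 2k+1
(`Shape.evenDev_or_oddDev`). The number of pairs (L, c), the sum of the deviations and the sum of
their squares do not depend on Q. These three linear equations determine how often each of the three
values occurs (`EvenDev.cnt_eq`, `OddDev.cnt_eq`). For L = 0 and c = 0 the deviation is τ(q-1)X_k in
even rank and 0 in odd rank, so it detects even rank together with the type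
(`quadRank_hasType_iff`).

The same multiplicities count the quadratic forms. A form on F^(m+1) is uniquely Q(x) + tL(x) + at²,
with deviation `dev Q` + (q-1) `dev (Q + L + a)` (`dev_extend`). The number of extensions of Q with
prescribed even rank and type is therefore one of the multiplicities already known. For odd rank the
deviation yields only the parity, and the position of L relative to the radical of Q settles the
rest. The resulting recursions in m have the stated products as solutions (`vRank_closed_form`).

The weight distribution follows by summing multiplicities over all Q and dividing by the number of
triples (Q, L, c) that give the same word (`weightFreq_mul_card_ker`). For q > 2 this number is 1,
and (q-1)X_k never equals X_i, so large and small deviations stay apart. For q = 2 it is 2^m,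
because L² = L as functions, and large and small deviations coincide; the merged counts collapse
through q^(2k)(v_(2k) + v_(2k+1)) = q^m v_(2k) (`pow_mul_vRank_add`). -/

namespace ReedMuller

/-! ### Deviations of functions, and anisotropic binary forms. -/

section Deviation

variable {F : Type*} [Field F] [Fintype F] [DecidableEq F]

/-- The indicator function of `0`, normalised to have sum zero. -/
def delta (c : F) : ℚ := (if c = 0 then 1 else 0) - 1 / Fintype.card F

/-- The deviation of the number of zeros of `f` from its average `|V| / |F|`. -/
def dev {V : Type*} [Fintype V] (f : V → F) : ℚ := ∑ x, delta (f x)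

lemma card_ne_zero' : (Fintype.card F : ℚ) ≠ 0 := by
  exact_mod_cast Fintype.card_ne_zero

lemma one_lt_card' : (1 : ℚ) < Fintype.card F := by
  exact_mod_cast Fintype.one_lt_card

lemma delta_neg (c : F) : delta (-c) = delta c := by simp [delta]

lemma sum_delta : ∑ c : F, delta c = 0 := by
  have := card_ne_zero' (F := F)
  simp [delta, Finset.sum_sub_distrib]

lemma sum_delta_add (a : F) : ∑ c : F, delta (a + c) = 0 := by
  rw [← sum_delta (F := F)]
  exact Fintype.sum_equiv (Equiv.addLeft a) _ _ fun c => rfl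

/-- Convolution with `delta` is the projection onto functions of sum zero, hence idempotent. This
plays the role of character orthogonality in all second moments below. -/
lemma sum_delta_mul_delta (a b : F) : ∑ c : F, delta (a + c) * delta (b + c) = delta (a - b) := by
  have := card_ne_zero' (F := F)
  have h1 : ∀ c : F, delta (a + c) * delta (b + c) =
      (if c = -a then delta (b + c) else 0) - 1 / Fintype.card F * delta (b + c) := by
    intro c
    rw [delta]
    have : a + c = 0 ↔ c = -a := by
      constructor
      · intro h; linear_combination h
      · rintro rfl; ring
    simp only [this]
    split_ifs <;> ring
  simp only [h1]
  rw [Finset.sum_sub_distrib, ← Finset.mul_sum, sum_delta_add]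
  simp only [Finset.sum_ite_eq', Finset.mem_univ, if_true]
  rw [← delta_neg]
  ring_nf

lemma sum_delta_add_mul (a s : F) :
    ∑ t : F, delta (a + s * t) = if s = 0 then (Fintype.card F : ℚ) * delta a else 0 := by
  split_ifs with h
  · simp [h]
  · rw [← sum_delta_add a]
    exact Fintype.sum_equiv (Equiv.mulLeft₀ s h) _ _ fun c => rfl

variable {V : Type*} [AddCommGroup V] [Module F V] [Fintype V]

lemma sum_translate {M : Type*} [AddCommMonoid M] (f : V → M) (v : V) :
    ∑ x, f (x + v) = ∑ x, f x :=
  Fintype.sum_equiv (Equiv.addRight v) _ _ fun _ => rfl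

lemma dev_translate (f : V → F) (v : V) : dev (fun x => f (x + v)) = dev f :=
  sum_translate (fun x => delta (f x)) v

/-- On each line in direction r the function takes every value exactly once. -/
lemma dev_eq_zero_of_shift (f : V → F) (r : V) (h : ∀ x (s : F), f (x + s • r) = f x + s) :
    dev f = 0 := by
  have h1 : (Fintype.card F : ℚ) * dev f = 0 := by
    calc (Fintype.card F : ℚ) * dev f = ∑ s : F, dev (fun x => f (x + s • r)) := by
          simp [dev_translate]
      _ = ∑ s : F, ∑ x, delta (f x + s) := by simp only [dev, h]
      _ = 0 := by
          rw [Finset.sum_comm]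
          simp [sum_delta_add]
  exact (mul_eq_zero.1 h1).resolve_left card_ne_zero'

lemma dev_linear {L : V →ₗ[F] F} (hL : L ≠ 0) (c : F) : dev (fun x => L x + c) = 0 := by
  obtain ⟨z, hz⟩ : ∃ z, L z ≠ 0 := by
    by_contra! h
    exact hL (LinearMap.ext h)
  refine dev_eq_zero_of_shift _ ((L z)⁻¹ • z) fun x s => ?_
  simp only [map_add, map_smul, smul_eq_mul]
  field_simp
  ring

lemma dev_const (c : F) : dev (fun _ : V => c) = Fintype.card V * delta c := by
  simp [dev]

/-- Splitting off a hyperbolic plane. -/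
lemma dev_hyperbolic (f g α β : V → F) (v w : V) (hf : ∀ x, f x = g x + α x * β x)
    (hg : ∀ x (s t : F), g (x + (s • v + t • w)) = g x)
    (hα : ∀ x (s t : F), α (x + (s • v + t • w)) = α x + s)
    (hβ : ∀ x (s t : F), β (x + (s • v + t • w)) = β x + t) :
    (Fintype.card F : ℚ) * dev f = dev g := by
  have hq := card_ne_zero' (F := F)
  have h1 : (Fintype.card F : ℚ) * ((Fintype.card F : ℚ) * dev f) =
      (Fintype.card F : ℚ) * dev g := by
    calc (Fintype.card F : ℚ) * ((Fintype.card F : ℚ) * dev f)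
        = ∑ s : F, ∑ t : F, dev (fun x => f (x + (s • v + t • w))) := by
          simp [dev_translate]
      _ = ∑ s : F, ∑ t : F, ∑ x, delta (g x + (α x + s) * (β x + t)) := by
          simp only [dev, hf, hg, hα, hβ]
      _ = ∑ x, ∑ s : F, ∑ t : F, delta (g x + (α x + s) * (β x + t)) := by
          rw [Finset.sum_comm]
          rw [Finset.sum_congr rfl fun t _ => Finset.sum_comm, Finset.sum_comm]
          exact Finset.sum_congr rfl fun x _ => Finset.sum_comm
      -- For fixed x the pair (α x + s, β x + t) runs through all of F². Summing over t afterwards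
      -- leaves only s = 0.
      _ = ∑ x, ∑ s : F, ∑ t : F, delta (g x + s * t) := by
          refine Finset.sum_congr rfl fun x _ => ?_
          exact Fintype.sum_equiv (Equiv.addLeft (α x)) _ _ fun s =>
            Fintype.sum_equiv (Equiv.addLeft (β x)) _ _ fun t => rfl
      _ = (Fintype.card F : ℚ) * dev g := by
          simp [sum_delta_add_mul, dev, Finset.mul_sum]
  exact mul_left_cancel₀ hq h1

/-- Averaging over translates along e replaces the counting of fibres of φ. -/
lemma sum_comp_one {φ : V →ₗ[F] F} {e : V} (he : φ e = 1) (h : F → ℚ) :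
    ∑ x, h (φ x) = (Fintype.card V : ℚ) / Fintype.card F * ∑ t, h t := by
  have hq := card_ne_zero' (F := F)
  have h1 : (Fintype.card F : ℚ) * ∑ x, h (φ x) = Fintype.card V * ∑ t, h t := by
    calc (Fintype.card F : ℚ) * ∑ x, h (φ x) = ∑ s : F, ∑ x, h (φ (x + s • e)) := by
          simp only [sum_translate (fun x => h (φ x))]
          simp
      _ = ∑ x, ∑ s : F, h (φ x + s) := by
          rw [Finset.sum_comm]
          simp [he]
      _ = ∑ x : V, ∑ s : F, h s := by
          refine Finset.sum_congr rfl fun x _ => ?_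
          exact Fintype.sum_equiv (Equiv.addLeft (φ x)) _ _ fun s => rfl
      _ = _ := by simp
  field_simp
  linarith

lemma sum_comp_two {φ ψ : V →ₗ[F] F} {e d : V} (he : φ e = 1) (he' : ψ e = 0) (hd : φ d = 0)
    (hd' : ψ d = 1) (h : F → F → ℚ) :
    ∑ x, h (φ x) (ψ x) =
      (Fintype.card V : ℚ) / (Fintype.card F : ℚ) ^ 2 * ∑ p : F × F, h p.1 p.2 := by
  have hq := card_ne_zero' (F := F)
  have h1 : (Fintype.card F : ℚ) ^ 2 * ∑ x, h (φ x) (ψ x) =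
      Fintype.card V * ∑ p : F × F, h p.1 p.2 := by
    calc (Fintype.card F : ℚ) ^ 2 * ∑ x, h (φ x) (ψ x)
        = ∑ p : F × F, ∑ x, h (φ (x + (p.1 • e + p.2 • d))) (ψ (x + (p.1 • e + p.2 • d))) := by
          simp only [sum_translate (fun x => h (φ x) (ψ x))]
          simp [sq]
      _ = ∑ x, ∑ p : F × F, h (φ x + p.1) (ψ x + p.2) := by
          rw [Finset.sum_comm]
          simp [he, he', hd, hd']
      _ = ∑ x : V, ∑ p : F × F, h p.1 p.2 := by
          refine Finset.sum_congr rfl fun x _ => ?_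
          exact Fintype.sum_equiv (Equiv.prodCongr (Equiv.addLeft (φ x)) (Equiv.addLeft (ψ x)))
            _ _ fun s => rfl
      _ = _ := by simp
  field_simp
  linarith

/-- A univariate quadratic polynomial with at most two roots. -/
lemma sum_delta_univariate {a : F} (ha : a ≠ 0) (u c : F) :
    ∑ t : F, delta (a * t ^ 2 + u * t + c) = 0 ∨ ∑ t : F, delta (a * t ^ 2 + u * t + c) = 1 ∨
      ∑ t : F, delta (a * t ^ 2 + u * t + c) = -1 := by
  have hq := card_ne_zero' (F := F)
  have h1 : ∑ t : F, delta (a * t ^ 2 + u * t + c) =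
      ((Finset.univ.filter fun t : F => a * t ^ 2 + u * t + c = 0).card : ℚ) - 1 := by
    simp [delta, Finset.sum_sub_distrib, hq]
  rw [h1]
  by_cases h : ∃ t₀, a * t₀ ^ 2 + u * t₀ + c = 0
  · obtain ⟨t₀, h₀⟩ := h
    -- By Vieta the second root is -(u/a) - t₀; it may equal t₀, and then the count is 1.
    have h2 : (Finset.univ.filter fun t : F => a * t ^ 2 + u * t + c = 0) =
        {t₀, -(u / a) - t₀} := by
      ext t
      simp only [Finset.mem_filter, Finset.mem_univ, true_and, Finset.mem_insert,
        Finset.mem_singleton]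
      have : a * t ^ 2 + u * t + c = a * ((t - t₀) * (t - (-(u / a) - t₀))) := by
        have : u = a * (u / a) := by field_simp
        generalize u / a = z at *
        subst this
        linear_combination h₀
      rw [this, mul_eq_zero, mul_eq_zero, sub_eq_zero, sub_eq_zero]
      simp [ha]
    rw [h2]
    by_cases h3 : t₀ = -(u / a) - t₀
    · left; rw [← h3]; simp
    · right; left; rw [Finset.card_pair h3]; norm_num
  · push Not at h
    right; right
    rw [Finset.filter_false_of_mem fun t _ => h t]
    simp

/-- The form `a s² + b s t + c t²` has no nontrivial zero. -/
def Aniso (a b c : F) : Prop :=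
  ∀ s t : F, a * s ^ 2 + b * s * t + c * t ^ 2 = 0 → s = 0 ∧ t = 0

lemma exists_sq_of_two_eq_zero (h2 : (2 : F) = 0) (a : F) : ∃ s, s ^ 2 = a := by
  have h : ringChar F = 2 := by
    have h3 : ringChar F ∣ 2 := ringChar.dvd (by exact_mod_cast h2)
    rcases (Nat.dvd_prime Nat.prime_two).1 h3 with h | h
    · exact absurd h (CharP.ringChar_ne_one)
    · exact h
  obtain ⟨s, hs⟩ := FiniteField.isSquare_of_char_two h a
  exact ⟨s, by rw [hs]; ring⟩

/-- A vector in the kernel of the polar form has twice its value equal to 0, which suffices in odd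
characteristic. In characteristic two the polar form is b times a determinant, and b ≠ 0: otherwise
a s² + c t² would have a nontrivial zero, since every element is a square. -/
lemma Aniso.nondeg {a b c : F} (h : Aniso a b c) {s t : F} (h1 : 2 * a * s + b * t = 0)
    (h2 : b * s + 2 * c * t = 0) : s = 0 ∧ t = 0 := by
  have h3 : 2 * (a * s ^ 2 + b * s * t + c * t ^ 2) = 0 := by
    linear_combination s * h1 + t * h2
  rcases mul_eq_zero.1 h3 with h2' | h'
  · have hb : b * t = 0 := by linear_combination h1 - a * s * h2'
    have hb' : b * s = 0 := by linear_combination h2 - c * t * h2'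
    by_cases hb0 : b = 0
    · have ha : a ≠ 0 := by
        rintro rfl
        have := (h 1 0 (by ring)).1
        exact one_ne_zero this
      obtain ⟨z, hz⟩ := exists_sq_of_two_eq_zero h2' (-c / a)
      have := (h z 1 (by rw [hz, hb0]; field_simp; ring)).2
      exact absurd this one_ne_zero
    · exact ⟨(mul_eq_zero.1 hb').resolve_left hb0, (mul_eq_zero.1 hb).resolve_left hb0⟩
  · exact h s t h'

/-- If the Gram determinant vanished, (-b, 2a) and (2c, -b) would be in the kernel of the polar
form, so 2a = b = 0, and then (1, 0) would be in the kernel too. -/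
lemma Aniso.disc {a b c : F} (h : Aniso a b c) : 4 * a * c - b ^ 2 ≠ 0 := by
  intro h0
  have h1 := h.nondeg (s := -b) (t := 2 * a) (by ring) (by linear_combination h0)
  have h2 := h.nondeg (s := 2 * c) (t := -b) (by linear_combination h0) (by ring)
  have h3 := h.nondeg (s := 1) (t := 0) (by linear_combination h1.2) (by linear_combination -h2.2)
  exact one_ne_zero h3.1

/-- After expanding the square only the differences A(z + y) - A(y) matter. They are affine in y,
with nonzero linear part for z ≠ 0 by nondegeneracy, so only z = 0 contributes. -/
lemma Aniso.dev_sq_sum {a b c : F} (h : Aniso a b c) :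
    ∑ d : F, dev (fun p : F × F => a * p.1 ^ 2 + b * p.1 * p.2 + c * p.2 ^ 2 + d) ^ 2 =
      (Fintype.card F : ℚ) ^ 2 - Fintype.card F := by
  have hq := card_ne_zero' (F := F)
  set A : F × F → F := fun p => a * p.1 ^ 2 + b * p.1 * p.2 + c * p.2 ^ 2 with hA
  calc ∑ d : F, dev (fun p : F × F => A p + d) ^ 2
      = ∑ d : F, ∑ x, ∑ y, delta (A x + d) * delta (A y + d) := by
        simp only [dev, sq, Finset.sum_mul_sum]
    _ = ∑ x, ∑ y, delta (A x - A y) := by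
        rw [Finset.sum_comm]
        refine Finset.sum_congr rfl fun x _ => ?_
        rw [Finset.sum_comm]
        simp [sum_delta_mul_delta]
    _ = ∑ y, ∑ z, delta (A (z + y) - A y) := by
        rw [Finset.sum_comm]
        refine Finset.sum_congr rfl fun y _ => ?_
        exact (sum_translate (fun x => delta (A x - A y)) y).symm
    _ = ∑ z, ∑ y : F × F, delta ((A z + (b * z.1 + 2 * c * z.2) * y.2) +
          (2 * a * z.1 + b * z.2) * y.1) := by
        rw [Finset.sum_comm]
        refine Finset.sum_congr rfl fun z _ => Finset.sum_congr rfl fun y _ => ?_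
        congr 1
        simp only [hA, Prod.fst_add, Prod.snd_add]
        ring
    _ = ∑ z : F × F, if z = 0 then (Fintype.card F : ℚ) ^ 2 - Fintype.card F else 0 := by
        refine Finset.sum_congr rfl fun z _ => ?_
        split_ifs with hz
        · subst hz
          simp [hA, delta]
          field_simp
        · rw [Fintype.sum_prod_type]
          by_cases h1 : 2 * a * z.1 + b * z.2 = 0
          · have h2 : b * z.1 + 2 * c * z.2 ≠ 0 := by
              intro h2
              have := h.nondeg h1 h2
              exact hz (Prod.ext this.1 this.2)
            simp [h1, sum_delta_add_mul, h2]
          · rw [Finset.sum_comm]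
            simp [h1, sum_delta_add_mul]
    _ = _ := by simp

lemma Aniso.dev_zero {a b c : F} (h : Aniso a b c) :
    dev (fun p : F × F => a * p.1 ^ 2 + b * p.1 * p.2 + c * p.2 ^ 2) = 1 - Fintype.card F := by
  have hq := card_ne_zero' (F := F)
  have h1 : ∀ p : F × F, (a * p.1 ^ 2 + b * p.1 * p.2 + c * p.2 ^ 2 = 0) ↔ p = 0 := by
    intro p
    constructor
    · intro hp
      have := h _ _ hp
      exact Prod.ext this.1 this.2
    · rintro rfl; simp
  simp only [dev, delta, h1, Finset.sum_sub_distrib]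
  simp [hq]

/-- A variance argument: the deviations D d have sum 0 and sum of squares q² - q, so the sum of (D d
- 1)² is q². The term d = 0 alone equals q², which forces D d = 1 at every other d. -/
lemma Aniso.dev_ne {a b c : F} (h : Aniso a b c) {d : F} (hd : d ≠ 0) :
    dev (fun p : F × F => a * p.1 ^ 2 + b * p.1 * p.2 + c * p.2 ^ 2 + d) = 1 := by
  have hq := card_ne_zero' (F := F)
  set D : F → ℚ := fun d =>
    dev (fun p : F × F => a * p.1 ^ 2 + b * p.1 * p.2 + c * p.2 ^ 2 + d) with hD
  have h0 : D 0 = 1 - Fintype.card F := by simp only [hD, add_zero]; exact h.dev_zero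
  have hs1 : ∑ d, D d = 0 := by
    simp only [hD, dev]
    rw [Finset.sum_comm]
    simp [sum_delta_add]
  have hs2 : ∑ d, D d ^ 2 = (Fintype.card F : ℚ) ^ 2 - Fintype.card F := h.dev_sq_sum
  have hs3 : ∑ d, (D d - 1) ^ 2 = (Fintype.card F : ℚ) ^ 2 := by
    have : ∀ d, (D d - 1) ^ 2 = D d ^ 2 - 2 * D d + 1 := fun d => by ring
    simp only [this, Finset.sum_add_distrib, Finset.sum_sub_distrib, ← Finset.mul_sum, hs1, hs2]
    simp
  rw [← Finset.add_sum_erase _ _ (Finset.mem_univ (0 : F)), h0] at hs3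
  have hs4 : ∑ d ∈ Finset.univ.erase (0 : F), (D d - 1) ^ 2 = 0 := by
    linear_combination hs3
  rw [Finset.sum_eq_zero_iff_of_nonneg fun _ _ => sq_nonneg _] at hs4
  have := hs4 d (by simp [hd])
  have h5 : D d - 1 = 0 := by simpa using this
  show D d = 1
  linarith

/-- An anisotropic binary form represents everything. -/
lemma Aniso.exists_eq {a b c : F} (h : Aniso a b c) (d : F) :
    ∃ s t : F, a * s ^ 2 + b * s * t + c * t ^ 2 = d := by
  by_cases hd : d = 0
  · exact ⟨0, 0, by simp [hd]⟩
  by_contra! hne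
  have hq := one_lt_card' (F := F)
  have hq0 := card_ne_zero' (F := F)
  -- If d were not represented, the form minus d would have no zero and hence deviation -q, not 1.
  have h1 := h.dev_ne (d := -d) (by simpa using hd)
  have h2 : ∀ p : F × F, a * p.1 ^ 2 + b * p.1 * p.2 + c * p.2 ^ 2 + -d ≠ 0 := fun p hp =>
    hne p.1 p.2 (by linear_combination hp)
  simp only [dev, delta, h2, if_false] at h1
  simp at h1
  field_simp at h1
  nlinarith

/-- The linear part can be removed by completing the square: the Gram determinant is nonzero in
every characteristic. -/
lemma Aniso.dev_affine {a b c : F} (h : Aniso a b c) (u v d : F) :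
    dev (fun p : F × F => a * p.1 ^ 2 + b * p.1 * p.2 + c * p.2 ^ 2 + u * p.1 + v * p.2 + d) =
        1 - Fintype.card F ∨
      dev (fun p : F × F => a * p.1 ^ 2 + b * p.1 * p.2 + c * p.2 ^ 2 + u * p.1 + v * p.2 + d) =
        1 := by
  have hΔ := h.disc
  obtain ⟨s, t, h1, h2⟩ : ∃ s t : F, 2 * a * s + b * t = u ∧ b * s + 2 * c * t = v := by
    have hi := mul_inv_cancel₀ hΔ
    -- Cramer's rule.
    refine ⟨(2 * c * u - b * v) * (4 * a * c - b ^ 2)⁻¹,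
      (2 * a * v - b * u) * (4 * a * c - b ^ 2)⁻¹, ?_, ?_⟩
    · linear_combination u * hi
    · linear_combination v * hi
  set d' : F := d - (a * s ^ 2 + b * s * t + c * t ^ 2) with hd'
  have h3 : dev (fun p : F × F =>
      a * p.1 ^ 2 + b * p.1 * p.2 + c * p.2 ^ 2 + u * p.1 + v * p.2 + d) =
      dev (fun p : F × F => a * p.1 ^ 2 + b * p.1 * p.2 + c * p.2 ^ 2 + d') := by
    rw [← dev_translate (F := F) (fun p : F × F => a * p.1 ^ 2 + b * p.1 * p.2 + c * p.2 ^ 2 + d')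
      (s, t)]
    congr 1
    funext p
    simp only [Prod.fst_add, Prod.snd_add, hd']
    linear_combination (-p.1) * h1 - p.2 * h2
  rw [h3]
  by_cases h0 : d' = 0
  · left
    rw [h0]
    simpa using h.dev_zero
  · right
    exact h.dev_ne h0

end Deviation
-- The absolute trace in characteristic two, and the coefficients of anisotropic planes.
section Trace

variable {F : Type*} [Field F] [Fintype F]

lemma two_eq_zero_iff_even : (2 : F) = 0 ↔ Even (Nat.card F) := by
  rw [Nat.card_eq_fintype_card, Nat.even_iff, ← FiniteField.even_card_iff_char_two]
  constructor
  · intro h2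
    have h3 : ringChar F ∣ 2 := ringChar.dvd (by exact_mod_cast h2)
    rcases (Nat.dvd_prime Nat.prime_two).1 h3 with h | h
    · exact absurd h (CharP.ringChar_ne_one)
    · exact h
  · intro h
    have := CharP.cast_eq_zero F (ringChar F)
    rw [h] at this
    exact_mod_cast this

lemma card_ker_mul_card_range {A B : Type*} [AddCommGroup A] [AddCommGroup B] [Finite A]
    (f : A →+ B) : Nat.card f.ker * Nat.card f.range = Nat.card A := by
  rw [← Nat.card_congr (QuotientAddGroup.quotientKerEquivRange f).toEquiv, mul_comm]
  exact (AddSubgroup.card_eq_card_quotient_mul_card_addSubgroup _).symm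

lemma charP_two (h2 : (2 : F) = 0) : CharP F 2 := by
  have := CharTwo.of_one_ne_zero_of_two_eq_zero (one_ne_zero (α := F)) h2
  exact this

lemma card_prime_subfield (h2 : (2 : F) = 0) : Nat.card (⊥ : Subfield F) = 2 := by
  have := charP_two h2
  have : Fact (Nat.Prime 2) := ⟨Nat.prime_two⟩
  exact Subfield.card_bot F 2

/-- Squaring is the Frobenius automorphism over the prime field, and the trace is invariant under
automorphisms. -/
lemma absTrace_sq (h2 : (2 : F) = 0) (x : F) : absTrace (x ^ 2) = absTrace x := by
  have hc := card_prime_subfield h2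
  have : Fintype (⊥ : Subfield F) := Fintype.ofFinite _
  rw [Nat.card_eq_fintype_card] at hc
  have h := Algebra.trace_eq_of_algEquiv
    (FiniteField.frobeniusAlgEquivOfAlgebraic (⊥ : Subfield F) F) x
  rw [FiniteField.coe_frobeniusAlgEquivOfAlgebraic] at h
  simp only [hc] at h
  exact h

lemma prime_subfield_eq_one (h2 : (2 : F) = 0) {x : (⊥ : Subfield F)} (hx : x ≠ 0) : x = 1 := by
  have hc := card_prime_subfield h2
  have : Fintype (⊥ : Subfield F) := Fintype.ofFinite _
  rw [Nat.card_eq_fintype_card] at hc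
  have := FiniteField.pow_card_sub_one_eq_one x hx
  rw [hc] at this
  simpa using this

/-- Over a field of characteristic two, `x² + x + c` has a root iff `c` has trace zero. -/
lemma absTrace_eq_one_iff (h2 : (2 : F) = 0) (c : F) :
    absTrace c = 1 ↔ ∀ t : F, t ^ 2 + t + c ≠ 0 := by
  have hneg : ∀ x : F, -x = x := fun x => by linear_combination (-x) * h2
  have hadd : ∀ x y : F, absTrace (x + y) = absTrace x + absTrace y := fun x y => map_add _ x y
  have h2' : ∀ x : (⊥ : Subfield F), x + x = 0 := fun x => by
    apply Subtype.ext
    push_cast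
    linear_combination (x : F) * h2
  constructor
  · intro hc t ht
    have : c = t ^ 2 + t := by linear_combination ht - (t ^ 2 + t) * h2
    rw [this, hadd, absTrace_sq h2, h2'] at hc
    exact zero_ne_one hc
  · intro h
    by_contra hc
    -- The image of t ↦ t² + t (whose kernel is {0, 1}) and the kernel of the trace both have index
    -- 2, and the first lies in the second. So they agree.
    let T : F →+ (⊥ : Subfield F) := (Algebra.trace (⊥ : Subfield F) F).toAddMonoidHom
    let S : F →+ F :=
      { toFun := fun t => t ^ 2 + t
        map_zero' := by simp
        map_add' := fun x y => by linear_combination (x * y) * h2 }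
    have hT0 : T c = 0 := by
      by_contra h0
      exact hc (prime_subfield_eq_one h2 h0)
    have hle : S.range ≤ T.ker := by
      rintro _ ⟨t, rfl⟩
      show absTrace (t ^ 2 + t) = 0
      rw [hadd, absTrace_sq h2, h2']
    have hkS : Nat.card S.ker = 2 := by
      have : (S.ker : Set F) = {0, 1} := by
        ext t
        simp only [SetLike.mem_coe, AddMonoidHom.mem_ker, Set.mem_insert_iff,
          Set.mem_singleton_iff]
        show t ^ 2 + t = 0 ↔ _
        have : t ^ 2 + t = t * (t - 1) := by linear_combination t * h2
        rw [this, mul_eq_zero, sub_eq_zero]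
      rw [← SetLike.coe_sort_coe, this, Nat.card_coe_set_eq, Set.ncard_pair zero_ne_one]
    have hrT : Nat.card T.range = 2 := by
      have : T.range = ⊤ := AddMonoidHom.range_eq_top.2 (Algebra.trace_surjective _ F)
      rw [this, Nat.card_congr AddSubgroup.topEquiv.toEquiv, card_prime_subfield h2]
    have h3 := card_ker_mul_card_range S
    have h4 := card_ker_mul_card_range T
    rw [hkS] at h3
    rw [hrT] at h4
    have h5 : S.range = T.ker := by
      apply SetLike.coe_injective
      apply Set.eq_of_subset_of_ncard_le hle _ (Set.toFinite _)
      rw [← Nat.card_coe_set_eq, ← Nat.card_coe_set_eq]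
      simp only [SetLike.coe_sort_coe]
      omega
    have h6 : c ∈ S.range := h5 ▸ hT0
    obtain ⟨t, ht⟩ := h6
    refine h t ?_
    rw [← ht]
    show t ^ 2 + t + (t ^ 2 + t) = 0
    linear_combination (t ^ 2 + t) * h2

/-- The coefficients of the anisotropic planes in the canonical forms of type `-1`. -/
def MinusCoeff (b c : F) : Prop :=
  (b = 0 ∧ Odd (Nat.card F) ∧ ¬ IsSquare (-c)) ∨ (b = 1 ∧ Even (Nat.card F) ∧ absTrace c = 1)

lemma aniso_one_iff {b c : F} : Aniso 1 b c ↔ ∀ t : F, t ^ 2 + b * t + c ≠ 0 := by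
  constructor
  · intro h t ht
    exact one_ne_zero (h t 1 (by linear_combination ht)).2
  · intro h s t hst
    by_cases ht : t = 0
    · subst ht
      refine ⟨?_, rfl⟩
      have : s ^ 2 = 0 := by linear_combination hst
      exact pow_eq_zero_iff (two_ne_zero) |>.1 this
    · exfalso
      apply h (s / t)
      field_simp
      linear_combination hst

lemma minusCoeff_of_aniso_odd (h2 : (2 : F) ≠ 0) {c : F} (h : Aniso 1 0 c) : MinusCoeff 0 c := by
  rw [aniso_one_iff] at h
  refine Or.inl ⟨rfl, ?_, ?_⟩
  · rw [← Nat.not_even_iff_odd, ← two_eq_zero_iff_even]; exact h2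
  · rintro ⟨t, ht⟩
    exact h t (by linear_combination -ht)

lemma minusCoeff_of_aniso_even (h2 : (2 : F) = 0) {c : F} (h : Aniso 1 1 c) : MinusCoeff 1 c := by
  rw [aniso_one_iff] at h
  refine Or.inr ⟨rfl, two_eq_zero_iff_even.1 h2, (absTrace_eq_one_iff h2 c).2 ?_⟩
  simpa using h

lemma MinusCoeff.aniso {b c : F} (h : MinusCoeff b c) : Aniso 1 b c := by
  rw [aniso_one_iff]
  rcases h with ⟨rfl, -, h⟩ | ⟨rfl, h2, h⟩
  · intro t ht
    exact h ⟨t, by linear_combination -ht⟩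
  · simpa using (absTrace_eq_one_iff (two_eq_zero_iff_even.2 h2) c).1 h

end Trace

open QuadraticMap

/-! ### Normal forms of quadratic forms. -/

section Shape

variable {F : Type*} [Field F] {V : Type*} [AddCommGroup V] [Module F V]

/-- The hyperbolic form `φ 0 φ 1 + φ 2 φ 3 + ⋯` built from `2 k` linear functionals. -/
def hyp (φ : ℕ → V →ₗ[F] F) (k : ℕ) : QuadraticForm F V :=
  ∑ i ∈ Finset.range k, linMulLin (φ (2 * i)) (φ (2 * i + 1))

/-- The first `n` members of `φ` and of `e` are dual to each other. -/
def Biorth (n : ℕ) (φ : ℕ → V →ₗ[F] F) (e : ℕ → V) : Prop :=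
  ∀ i < n, ∀ j < n, φ i (e j) = if i = j then 1 else 0

/-- `Q` is a normal form of rank `n` and sign `τ` in the functionals `φ`; the sign is `0` in
odd rank. -/
inductive Shape (φ : ℕ → V →ₗ[F] F) : ℕ → ℤ → QuadraticForm F V → Prop
  | plus (k : ℕ) : Shape φ (2 * k) 1 (hyp φ k)
  | odd (k : ℕ) (a : F) (ha : a ≠ 0) :
      Shape φ (2 * k + 1) 0 (hyp φ k + a • linMulLin (φ (2 * k)) (φ (2 * k)))
  | minus (k : ℕ) (b c : F) (h : MinusCoeff b c) :
      Shape φ (2 * k + 2) (-1)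
        (hyp φ k + (linMulLin (φ (2 * k)) (φ (2 * k)) + b • linMulLin (φ (2 * k)) (φ (2 * k + 1))
          + c • linMulLin (φ (2 * k + 1)) (φ (2 * k + 1))))

lemma hyp_apply (φ : ℕ → V →ₗ[F] F) (k : ℕ) (x : V) :
    hyp φ k x = ∑ i ∈ Finset.range k, φ (2 * i) x * φ (2 * i + 1) x := by
  simp [hyp]

lemma hyp_succ (φ : ℕ → V →ₗ[F] F) (k : ℕ) :
    hyp φ (k + 1) = hyp φ k + linMulLin (φ (2 * k)) (φ (2 * k + 1)) :=
  Finset.sum_range_succ _ _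

lemma hyp_congr {φ ψ : ℕ → V →ₗ[F] F} {k : ℕ} {x y : V} (h : ∀ i < 2 * k, φ i x = ψ i y) :
    hyp φ k x = hyp ψ k y := by
  rw [hyp_apply, hyp_apply]
  refine Finset.sum_congr rfl fun i hi => ?_
  have := Finset.mem_range.1 hi
  rw [h _ (by omega), h _ (by omega)]

lemma Shape.congr {φ : ℕ → V →ₗ[F] F} {n : ℕ} {τ : ℤ} {Q : QuadraticForm F V}
    (hQ : Shape φ n τ Q) {x y : V} (h : ∀ i < n, φ i x = φ i y) : Q x = Q y := by
  cases hQ with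
  | plus k => exact hyp_congr h
  | odd k a ha =>
    simp only [_root_.add_apply, _root_.smul_apply, linMulLin_apply]
    rw [hyp_congr (k := k) (ψ := φ) (y := y) fun i hi => h i (by omega), h _ (by omega)]
  | minus k b c hbc =>
    simp only [_root_.add_apply, _root_.smul_apply, linMulLin_apply]
    rw [hyp_congr (k := k) (ψ := φ) (y := y) fun i hi => h i (by omega), h (2 * k) (by omega),
      h (2 * k + 1) (by omega)]

/-- The sequence `a, b, f 0, f 1, …`. -/
def consTwo {α : Type*} (a b : α) (f : ℕ → α) : ℕ → α
  | 0 => a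
  | 1 => b
  | n + 2 => f n

lemma hyp_consTwo (α β : V →ₗ[F] F) (φ : ℕ → V →ₗ[F] F) (k : ℕ) :
    hyp (consTwo α β φ) (k + 1) = linMulLin α β + hyp φ k := by
  rw [hyp, Finset.sum_range_succ', add_comm]
  rfl

lemma Shape.consTwo {φ : ℕ → V →ₗ[F] F} {n : ℕ} {τ : ℤ} {Q : QuadraticForm F V}
    (hQ : Shape φ n τ Q) (α β : V →ₗ[F] F) :
    Shape (consTwo α β φ) (n + 2) τ (linMulLin α β + Q) := by
  cases hQ with
  | plus k =>
    rw [← hyp_consTwo]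
    exact Shape.plus (k + 1)
  | odd k a ha =>
    rw [← add_assoc, ← hyp_consTwo]
    exact Shape.odd (φ := ReedMuller.consTwo α β φ) (k + 1) a ha
  | minus k b c h =>
    rw [← add_assoc, ← hyp_consTwo]
    exact Shape.minus (φ := ReedMuller.consTwo α β φ) (k + 1) b c h

/-- The old dual vectors lose their components along v and w so that α and β kill them; the old
functionals do not notice, since they vanish on v and w. -/
lemma Biorth.consTwo {n : ℕ} {φ : ℕ → V →ₗ[F] F} {e : ℕ → V} (h : Biorth n φ e)
    {α β : V →ₗ[F] F} {v w : V} (hαv : α v = 1) (hαw : α w = 0) (hβv : β v = 0) (hβw : β w = 1)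
    (hv : ∀ i < n, φ i v = 0) (hw : ∀ i < n, φ i w = 0) :
    Biorth (n + 2) (consTwo α β φ)
      (consTwo v w fun j => e j - α (e j) • v - β (e j) • w) := by
  intro i hi j hj
  match i, j, hi, hj with
  | 0, 0, _, _ => simpa [ReedMuller.consTwo] using hαv
  | 0, 1, _, _ => simpa [ReedMuller.consTwo] using hαw
  | 1, 0, _, _ => simpa [ReedMuller.consTwo] using hβv
  | 1, 1, _, _ => simpa [ReedMuller.consTwo] using hβw
  | 0, j + 2, _, _ => simp [ReedMuller.consTwo, hαv, hαw]
  | 1, j + 2, _, _ => simp [ReedMuller.consTwo, hβv, hβw]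
  | i + 2, 0, hi, _ => simpa [ReedMuller.consTwo] using hv i (by omega)
  | i + 2, 1, hi, _ => simpa [ReedMuller.consTwo] using hw i (by omega)
  | i + 2, j + 2, hi, hj =>
    have := h i (by omega) j (by omega)
    simp [ReedMuller.consTwo, hv i (by omega), hw i (by omega), this]

lemma polarBilin_eq (Q : QuadraticForm F V) (x y : V) :
    Q.polarBilin x y = Q (x + y) - Q x - Q y := rfl

lemma polarBilin_self (Q : QuadraticForm F V) (x : V) : Q.polarBilin x x = 2 * Q x := by
  rw [polarBilin_apply_apply, polar_self]
  simp

lemma polarBilin_comm (Q : QuadraticForm F V) (x y : V) :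
    Q.polarBilin x y = Q.polarBilin y x := by
  rw [polarBilin_apply_apply, polarBilin_apply_apply, polar_comm]

lemma apply_add_polarBilin (Q : QuadraticForm F V) (x y : V) :
    Q (x + y) = Q x + Q y + Q.polarBilin x y := by
  rw [polarBilin_eq]; ring

lemma mem_radical_iff_polarBilin {Q : QuadraticForm F V} {x : V} :
    x ∈ Q.radical ↔ Q x = 0 ∧ ∀ y, Q.polarBilin x y = 0 := by
  rw [mem_radical_iff']
  refine and_congr_right fun h => forall_congr' fun y => ?_
  rw [polarBilin_eq, h, sub_zero, sub_eq_zero]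

/-- Complete the singular vector v to a hyperbolic pair v, w, and let α and β be the polar pairings
with w and v. Then Q - αβ has both v and w in its radical. -/
lemma exists_hyperbolic_split (Q : QuadraticForm F V) {v : V} (hv : Q v = 0)
    (hvR : v ∉ Q.radical) :
    ∃ (α β : V →ₗ[F] F) (w : V) (Q' : QuadraticForm F V), Q = linMulLin α β + Q' ∧ α v = 1 ∧
      α w = 0 ∧ β v = 0 ∧ β w = 1 ∧ v ∈ Q'.radical ∧ w ∈ Q'.radical ∧ Q.radical ≤ Q'.radical ∧
      ∀ x ∈ Q.radical, α x = 0 ∧ β x = 0 := by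
  obtain ⟨w₀, hw₀⟩ : ∃ w₀, Q.polarBilin v w₀ ≠ 0 := by
    by_contra! h
    exact hvR (mem_radical_iff_polarBilin.2 ⟨hv, h⟩)
  have hvv : Q.polarBilin v v = 0 := by rw [polarBilin_self, hv, mul_zero]
  obtain ⟨w₁, h1⟩ : ∃ w₁, Q.polarBilin v w₁ = 1 :=
    ⟨(Q.polarBilin v w₀)⁻¹ • w₀, by rw [map_smul, smul_eq_mul, inv_mul_cancel₀ hw₀]⟩
  -- The multiple of v makes w singular and leaves the pairing with v unchanged, as v pairs to 0
  -- with itself.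
  set w := w₁ + (-Q w₁) • v with hw
  have hvw : Q.polarBilin v w = 1 := by
    rw [hw, map_add, map_smul, h1, hvv]; simp
  have hQw : Q w = 0 := by
    rw [hw, apply_add_polarBilin, QuadraticMap.map_smul, map_smul, hv, polarBilin_comm Q w₁, h1]
    simp
  have hww : Q.polarBilin w w = 0 := by rw [polarBilin_self, hQw, mul_zero]
  have hwv : Q.polarBilin w v = 1 := by rw [polarBilin_comm, hvw]
  refine ⟨Q.polarBilin w, Q.polarBilin v, w,
    Q - linMulLin (Q.polarBilin w) (Q.polarBilin v), by abel, hwv, hww, hvv, hvw, ?_, ?_, ?_, ?_⟩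
  · rw [mem_radical_iff']
    refine ⟨by simp [hv, hvv, -polarBilin_apply_apply], fun y => ?_⟩
    simp only [_root_.sub_apply, linMulLin_apply, map_add, apply_add_polarBilin Q v y, hv,
      hvv, hwv]
    ring
  · rw [mem_radical_iff']
    refine ⟨by simp [hQw, hww, -polarBilin_apply_apply], fun y => ?_⟩
    simp only [_root_.sub_apply, linMulLin_apply, map_add, apply_add_polarBilin Q w y, hQw,
      hww, hvw]
    ring
  · intro x hx
    rw [mem_radical_iff_polarBilin] at hx
    have h1 := hx.2 v
    have h2 := hx.2 w
    rw [polarBilin_comm] at h1 h2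
    rw [mem_radical_iff']
    refine ⟨by simp [hx.1, h1, -polarBilin_apply_apply], fun y => ?_⟩
    simp only [_root_.sub_apply, linMulLin_apply, map_add, apply_add_polarBilin Q x y, hx.1,
      hx.2 y, h1, h2]
    ring
  · intro x hx
    rw [mem_radical_iff_polarBilin] at hx
    rw [polarBilin_comm, hx.2, polarBilin_comm, hx.2]
    exact ⟨rfl, rfl⟩

lemma apply_two (Q : QuadraticForm F V) (s t : F) (x y : V) :
    Q (s • x + t • y) = Q x * s ^ 2 + Q.polarBilin x y * s * t + Q y * t ^ 2 := by
  rw [apply_add_polarBilin, QuadraticMap.map_smul, QuadraticMap.map_smul, map_smul, map_smul]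
  simp only [smul_eq_mul, LinearMap.smul_apply]
  ring

section Finite
variable [Fintype F] [DecidableEq F]

/-- An anisotropic plane contains a basis in which the form is in normal form. -/
lemma exists_minusCoeff (Q : QuadraticForm F V) {x y : V}
    (h : Aniso (Q x) (Q.polarBilin x y) (Q y)) :
    ∃ x' y' : V, Q x' = 1 ∧ MinusCoeff (Q.polarBilin x' y') (Q y') ∧
      Aniso 1 (Q.polarBilin x' y') (Q y') := by
  have hker : ∀ s t : F, Q (s • x + t • y) = 0 → s = 0 ∧ t = 0 := by
    intro s t hst
    rw [apply_two] at hst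
    exact h s t hst
  obtain ⟨s, t, hst⟩ := h.exists_eq 1
  have hx' : Q (s • x + t • y) = 1 := by rw [apply_two]; exact hst
  have key : ∀ u v : F, s * v - t * u ≠ 0 →
      Aniso 1 (Q.polarBilin (s • x + t • y) (u • x + v • y)) (Q (u • x + v • y)) := by
    intro u v huv a b hab
    rw [← hx', ← apply_two] at hab
    have h1 : a • (s • x + t • y) + b • (u • x + v • y) =
        (a * s + b * u) • x + (a * t + b * v) • y := by module
    rw [h1] at hab
    obtain ⟨h2, h3⟩ := hker _ _ hab
    constructor
    · have : a * (s * v - t * u) = 0 := by linear_combination v * h2 - u * h3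
      exact (mul_eq_zero.1 this).resolve_right huv
    · have : b * (s * v - t * u) = 0 := by linear_combination -t * h2 + s * h3
      exact (mul_eq_zero.1 this).resolve_right huv
  have hpol : ∀ u v : F, Q.polarBilin (s • x + t • y) (u • x + v • y) =
      (2 * Q x * s + Q.polarBilin x y * t) * u + (Q.polarBilin x y * s + 2 * Q y * t) * v := by
    intro u v
    rw [polarBilin_eq]
    have h1 : s • x + t • y + (u • x + v • y) = (s + u) • x + (t + v) • y := by module
    rw [h1, apply_two, apply_two, apply_two]
    ring
  -- m and n are the polar pairings of x' = s • x + t • y with x and y; thus m s + n t is the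
  -- pairing of x' with itself, which is 2 Q x' = 2.
  set m := 2 * Q x * s + Q.polarBilin x y * t with hm
  set n := Q.polarBilin x y * s + 2 * Q y * t with hn
  have hmn : m * s + n * t = 2 := by
    rw [hm, hn]
    linear_combination 2 * hst
  by_cases h2 : (2 : F) = 0
  · have hmn0 : ¬ (m = 0 ∧ n = 0) := by
      rintro ⟨h3, h4⟩
      obtain ⟨rfl, rfl⟩ := h.nondeg h3 h4
      simp at hst
    obtain ⟨u, v, huv⟩ : ∃ u v, m * u + n * v = 1 := by
      by_cases hm0 : m = 0
      · have hn0 : n ≠ 0 := fun hn0 => hmn0 ⟨hm0, hn0⟩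
        exact ⟨0, n⁻¹, by field_simp; ring⟩
      · exact ⟨m⁻¹, 0, by field_simp; ring⟩
    have hdet : s * v - t * u ≠ 0 := by
      intro h0
      -- then `(u, v)` is proportional to `(s, t)`
      have h3 : s * (m * u + n * v) = u * 2 := by linear_combination n * h0 + u * hmn
      have h4 : t * (m * u + n * v) = v * 2 := by linear_combination -m * h0 + v * hmn
      rw [huv, h2] at h3 h4
      have hs : s = 0 := by simpa using h3
      have ht : t = 0 := by simpa using h4
      subst hs ht
      simp at hst
    have h5 := key u v hdet
    have h6 := hpol u v
    rw [huv] at h6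
    refine ⟨_, u • x + v • y, hx', ?_, h5⟩
    rw [h6] at h5 ⊢
    exact minusCoeff_of_aniso_even h2 h5
  -- In odd characteristic (-n) • x + m • y is orthogonal to x', and the determinant of the change
  -- of basis is m s + n t = 2.
  · have hdet : s * m - t * (-n) ≠ 0 := by
      have : s * m - t * (-n) = 2 := by linear_combination hmn
      rw [this]; exact h2
    have h5 := key (-n) m hdet
    have h6 := hpol (-n) m
    have h7 : m * -n + n * m = 0 := by ring
    rw [h7] at h6
    refine ⟨_, (-n) • x + m • y, hx', ?_, h5⟩
    rw [h6] at h5 ⊢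
    exact minusCoeff_of_aniso_odd h2 h5

/-- Modulo its radical Q is anisotropic. An anisotropic plane already represents every value, so a
third dimension would produce a singular vector outside the radical; hence the rank is at most 2. -/
lemma exists_shape_aniso (Q : QuadraticForm F V) (hQ : ∀ v, Q v = 0 → v ∈ Q.radical) :
    ∃ (n : ℕ) (φ : ℕ → V →ₗ[F] F) (e : ℕ → V) (τ : ℤ), Biorth n φ e ∧ Shape φ n τ Q ∧
      ∀ i < n, ∀ x ∈ Q.radical, φ i x = 0 := by
  by_cases h0 : ∀ x, Q x = 0
  · have : Q = hyp (fun _ => 0) 0 := by ext x; simp [h0, hyp]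
    refine ⟨0, fun _ => 0, fun _ => 0, 1, fun i hi => by omega, ?_, fun i hi => by omega⟩
    rw [this]
    exact Shape.plus 0
  push Not at h0
  obtain ⟨x, hx⟩ := h0
  have hxR : x ∉ Q.radical := fun h => hx (mem_radical_iff_polarBilin.1 h).1
  by_cases h1 : ∀ y, ∃ s : F, y - s • x ∈ Q.radical
  · obtain ⟨f, hf, hfR⟩ := Submodule.exists_le_ker_of_notMem hxR
    set γ := (f x)⁻¹ • f with hγ
    have hγx : γ x = 1 := by simp [hγ, hf]
    have hγR : ∀ r ∈ Q.radical, γ r = 0 := fun r hr => by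
      have : f r = 0 := hfR hr
      simp [hγ, this]
    have hQ' : Q = hyp (fun _ => γ) 0 + Q x • linMulLin γ γ := by
      ext y
      obtain ⟨s, hs⟩ := h1 y
      have h3 : γ y = s := by
        have := hγR _ hs
        simp only [map_sub, map_smul, hγx, smul_eq_mul, mul_one] at this
        linear_combination this
      have h2 := (mem_radical_iff'.1 hs).2 (s • x)
      rw [sub_add_cancel] at h2
      rw [h2, QuadraticMap.map_smul]
      simp [hyp, h3]
      ring
    refine ⟨1, fun _ => γ, fun _ => x, 0, ?_, ?_, fun i _ => hγR⟩
    · intro i hi j hj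
      obtain rfl : i = 0 := by omega
      obtain rfl : j = 0 := by omega
      simpa using hγx
    · have := Shape.odd (φ := fun _ => γ) 0 (Q x) hx
      rw [← hQ'] at this
      exact this
  · push Not at h1
    obtain ⟨y, hy⟩ := h1
    have han : Aniso (Q x) (Q.polarBilin x y) (Q y) := by
      intro s t hst
      rw [← apply_two] at hst
      have h2 := hQ _ hst
      have ht : t = 0 := by
        by_contra ht
        apply hy (-(t⁻¹ * s))
        have h3 := Q.radical.smul_mem t⁻¹ h2
        convert h3 using 1
        rw [smul_add, smul_smul, smul_smul, inv_mul_cancel₀ ht]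
        module
      subst ht
      refine ⟨?_, rfl⟩
      by_contra hs
      apply hxR
      have h3 := Q.radical.smul_mem s⁻¹ h2
      simpa [smul_smul, hs] using h3
    obtain ⟨x, y, hx1, hmc, han⟩ := exists_minusCoeff Q han
    set b := Q.polarBilin x y with hb
    set c := Q y with hc
    have hxx : Q.polarBilin x x = 2 := by rw [polarBilin_self, hx1, mul_one]
    have hyy : Q.polarBilin y y = 2 * c := by rw [polarBilin_self]
    have hyx : Q.polarBilin y x = b := by rw [polarBilin_comm]
    have hΔ := mul_inv_cancel₀ han.disc
    -- The inverse of the Gram matrix ((2, b), (b, 2c)) turns the pairings with x and y into the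
    -- functionals γ, δ dual to x, y.
    set i := (4 * 1 * c - b ^ 2)⁻¹ with hi
    set γ : V →ₗ[F] F := i • ((2 * c) • Q.polarBilin x - b • Q.polarBilin y) with hγ
    set δ : V →ₗ[F] F := i • ((2 : F) • Q.polarBilin y - b • Q.polarBilin x) with hδ
    have eγ : ∀ z, γ z = i * (2 * c * Q.polarBilin x z - b * Q.polarBilin y z) := fun z => rfl
    have eδ : ∀ z, δ z = i * (2 * Q.polarBilin y z - b * Q.polarBilin x z) := fun z => rfl
    have hγx : γ x = 1 := by rw [eγ, hxx, hyx]; linear_combination hΔ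
    have hγy : γ y = 0 := by rw [eγ, hyy, ← hb]; ring
    have hδx : δ x = 0 := by rw [eδ, hxx, hyx]; ring
    have hδy : δ y = 1 := by rw [eδ, hyy, ← hb]; linear_combination hΔ
    have hQz : ∀ z, Q z = γ z ^ 2 + b * γ z * δ z + c * δ z ^ 2 := by
      intro z
      set z' := z - (γ z • x + δ z • y) with hz'
      have hz'x : Q.polarBilin x z' = 0 := by
        rw [hz', map_sub, map_add, map_smul, map_smul, hxx, ← hb, eγ, eδ]
        simp only [smul_eq_mul]
        linear_combination (-Q.polarBilin x z) * hΔ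
      have hz'y : Q.polarBilin y z' = 0 := by
        rw [hz', map_sub, map_add, map_smul, map_smul, hyy, hyx, eγ, eδ]
        simp only [smul_eq_mul]
        linear_combination (-Q.polarBilin y z) * hΔ
      have hpz : ∀ s t : F, Q.polarBilin (s • x + t • y) z' = 0 := by
        intro s t
        rw [map_add, map_smul, map_smul, LinearMap.add_apply, LinearMap.smul_apply,
          LinearMap.smul_apply, hz'x, hz'y]
        simp
      -- The plane contains a vector of value -Q z'. Its sum with z' is singular, hence in the
      -- radical, and pairing with x and y shows that the vector is 0.
      have h0 : Q z' = 0 := by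
        obtain ⟨s, t, hst⟩ := han.exists_eq (-Q z')
        have h3 : Q (s • x + t • y) = -Q z' := by rw [apply_two, hx1, ← hb, ← hc, hst]
        have h4 : Q (s • x + t • y + z') = 0 := by
          rw [apply_add_polarBilin, hpz, h3]; ring
        have h5 := (mem_radical_iff_polarBilin.1 (hQ _ h4)).2
        have h6 := h5 x
        have h7 := h5 y
        rw [polarBilin_comm, map_add, map_add, map_smul, map_smul, hxx, ← hb, hz'x] at h6
        rw [polarBilin_comm, map_add, map_add, map_smul, map_smul, hyy, hyx, hz'y] at h7
        simp only [smul_eq_mul] at h6 h7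
        obtain ⟨rfl, rfl⟩ := han.nondeg (s := s) (t := t) (by linear_combination h6)
          (by linear_combination h7)
        simpa using hst
      have h8 : z = (γ z • x + δ z • y) + z' := by rw [hz']; abel
      calc Q z = Q ((γ z • x + δ z • y) + z') := by rw [← h8]
        _ = _ := by
          rw [apply_add_polarBilin, hpz, h0, apply_two, hx1, ← hb, ← hc]
          ring
    have hR : ∀ r ∈ Q.radical, γ r = 0 ∧ δ r = 0 := by
      intro r hr
      have h3 := (mem_radical_iff_polarBilin.1 hr).2
      have h4 := h3 x
      have h5 := h3 y
      rw [polarBilin_comm] at h4 h5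
      rw [eγ, eδ, h4, h5]
      simp
    refine ⟨2, consTwo γ δ fun _ => 0, consTwo x y fun _ => 0, -1, ?_, ?_, ?_⟩
    · intro i hi j hj
      interval_cases i <;> interval_cases j <;> simp [consTwo, hγx, hγy, hδx, hδy]
    · have hQe : Q = hyp (consTwo γ δ fun _ => 0) 0 +
          (linMulLin γ γ + b • linMulLin γ δ + c • linMulLin δ δ) := by
        ext z
        rw [hQz]
        simp [hyp]
        ring
      have := Shape.minus (φ := consTwo γ δ fun _ => 0) 0 b c hmc
      simp only [mul_zero, zero_add] at this
      change Shape _ 2 (-1) (hyp (consTwo γ δ fun _ => 0) 0 +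
          (linMulLin γ γ + b • linMulLin γ δ + c • linMulLin δ δ)) at this
      rwa [← hQe] at this
    · intro i hi r hr
      interval_cases i
      · exact (hR r hr).1
      · exact (hR r hr).2

/-- Induction on the codimension of the radical, which drops when a hyperbolic plane is split off
because v enters the radical. Vanishing of the functionals on the radical is carried along so that
those of Q' vanish on v and w, as the extension of the dual system requires. -/
theorem exists_shape_aux [Module.Finite F V] (N : ℕ) : ∀ Q : QuadraticForm F V,
    Module.finrank F V - Module.finrank F Q.radical = N →
    ∃ (n : ℕ) (φ : ℕ → V →ₗ[F] F) (e : ℕ → V) (τ : ℤ), Biorth n φ e ∧ Shape φ n τ Q ∧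
      ∀ i < n, ∀ x ∈ Q.radical, φ i x = 0 := by
  induction N using Nat.strong_induction_on with
  | _ N ih =>
    intro Q hN
    by_cases hQ : ∀ v, Q v = 0 → v ∈ Q.radical
    · exact exists_shape_aniso Q hQ
    push Not at hQ
    obtain ⟨v, hv, hvR⟩ := hQ
    obtain ⟨α, β, w, Q', rfl, hαv, hαw, hβv, hβw, hv', hw', hle, hR⟩ :=
      exists_hyperbolic_split Q hv hvR
    have hlt : Module.finrank F (linMulLin α β + Q').radical < Module.finrank F Q'.radical :=
      Submodule.finrank_lt_finrank_of_lt (lt_of_le_of_ne hle fun h => hvR (h ▸ hv'))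
    have hle' := Submodule.finrank_le Q'.radical
    obtain ⟨n, φ, e, τ, h1, h2, h3⟩ := ih _ (by omega) Q' rfl
    refine ⟨n + 2, _, _, τ, h1.consTwo hαv hαw hβv hβw (fun i hi => h3 i hi v hv')
      (fun i hi => h3 i hi w hw'), h2.consTwo α β, ?_⟩
    intro i hi x hx
    match i, hi with
    | 0, _ => exact (hR x hx).1
    | 1, _ => exact (hR x hx).2
    | i + 2, hi => exact h3 i (by omega) x (hle hx)

end Finite

lemma Shape.mem_radical {φ : ℕ → V →ₗ[F] F} {n : ℕ} {τ : ℤ} {Q : QuadraticForm F V}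
    (hQ : Shape φ n τ Q) {x : V} (h : ∀ i < n, φ i x = 0) : x ∈ Q.radical := by
  rw [mem_radical_iff']
  constructor
  · rw [hQ.congr (y := 0) (by simpa using h), map_zero]
  · intro y
    exact hQ.congr fun i hi => by rw [map_add, h i hi, zero_add]

lemma Biorth.finrank_ker_add [Module.Finite F V] {n : ℕ} {φ : ℕ → V →ₗ[F] F} {e : ℕ → V}
    (h : Biorth n φ e) :
    n + Module.finrank F (LinearMap.pi fun i : Fin n => φ i).ker = Module.finrank F V := by
  have hs : Function.Surjective (LinearMap.pi fun i : Fin n => φ i) := by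
    intro y
    refine ⟨∑ j : Fin n, y j • e j, ?_⟩
    funext i
    simp only [LinearMap.pi_apply, map_sum, map_smul, smul_eq_mul]
    rw [Finset.sum_eq_single i]
    · rw [h i i.2 i i.2]; simp
    · intro j _ hj
      rw [h i i.2 j j.2, if_neg fun h => hj (Fin.ext h.symm), mul_zero]
    · simp
  have h1 := LinearMap.finrank_range_add_finrank_ker (LinearMap.pi fun i : Fin n => φ i)
  rw [LinearMap.range_eq_top.2 hs, finrank_top, Module.finrank_fin_fun] at h1
  exact h1

end Shape

/-! ### The number of functionals in a normal form is the rank. -/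

section Standard

variable {F : Type*} [Field F] [Fintype F] [DecidableEq F] {m : ℕ}

lemma quadRank_le (Q : QuadraticForm F (Fin m → F)) : quadRank Q ≤ m := Nat.sub_le _ _

lemma finrank_radical (Q : QuadraticForm F (Fin m → F)) :
    Module.finrank F Q.radical + quadRank Q = m := by
  have := Submodule.finrank_le Q.radical
  rw [Module.finrank_fin_fun] at this
  rw [quadRank]
  omega

/-- Classification: every quadratic form is in normal form with respect to suitable functionals. -/
theorem exists_shape (Q : QuadraticForm F (Fin m → F)) :
    ∃ (φ : ℕ → (Fin m → F) →ₗ[F] F) (e : ℕ → Fin m → F) (τ : ℤ),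
      Biorth (quadRank Q) φ e ∧ Shape φ (quadRank Q) τ Q := by
  obtain ⟨n, φ, e, τ, h1, h2, h3⟩ := exists_shape_aux _ Q rfl
  -- Identifying the radical with the common kernel of the n functionals makes n equal to the rank.
  have h4 : Q.radical = (LinearMap.pi fun i : Fin n => φ i).ker := by
    ext x
    rw [LinearMap.mem_ker]
    constructor
    · intro hx
      funext i
      exact h3 i i.2 x hx
    · intro hx
      exact h2.mem_radical fun i hi => congr_fun hx ⟨i, hi⟩
  have h5 := h1.finrank_ker_add
  rw [← h4, Module.finrank_fin_fun] at h5
  have h6 : quadRank Q = n := by rw [quadRank]; omega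
  rw [h6]
  exact ⟨φ, e, τ, h1, h2⟩

end Standard
-- Possible deviations of a quadratic function.
section DevValues

variable {F : Type*} [Field F] [Fintype F] [DecidableEq F]
variable {V : Type*} [AddCommGroup V] [Module F V] [Fintype V]

variable (F V) in
/-- The absolute value of the small deviations for forms of rank `2 k` and `2 k + 1`. -/
def scale (k : ℕ) : ℚ := (Fintype.card V : ℚ) / (Fintype.card F : ℚ) ^ (k + 1)

lemma scale_ne_zero [Nonempty V] (k : ℕ) : scale F V k ≠ 0 :=
  div_ne_zero (by exact_mod_cast Fintype.card_ne_zero) (pow_ne_zero _ card_ne_zero')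

/-- The possible deviations of `Q + L + c` for a form `Q` of rank `2 k` and type `τ`. -/
def EvenDev (Q : QuadraticForm F V) (k : ℕ) (τ : ℤ) : Prop :=
  dev Q = τ * (Fintype.card F - 1) * scale F V k ∧
    ∀ (L : V →ₗ[F] F) (c : F), dev (fun x => Q x + L x + c) = 0 ∨
      dev (fun x => Q x + L x + c) = τ * (Fintype.card F - 1) * scale F V k ∨
      dev (fun x => Q x + L x + c) = -τ * scale F V k

/-- The possible deviations of `Q + L + c` for a form `Q` of rank `2 k + 1`. -/
def OddDev (Q : QuadraticForm F V) (k : ℕ) : Prop :=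
  dev Q = 0 ∧
    ∀ (L : V →ₗ[F] F) (c : F), dev (fun x => Q x + L x + c) = 0 ∨
      dev (fun x => Q x + L x + c) = scale F V k ∨
      dev (fun x => Q x + L x + c) = -scale F V k

/-- With l = L(e) and l' = L(e') for the vectors dual to φ, φ', one has φφ' + lφ + l'φ' = (φ +
l')(φ' + l) - ll'. So a plane absorbs its part of L at the price of a constant, and dividing by q is
`dev_hyperbolic`. The clause for L = 0 is needed to evaluate the deviation of Q itself. -/
lemma dev_hyp_add {n : ℕ} {φ : ℕ → V →ₗ[F] F} {e : ℕ → V} (h : Biorth n φ e) (k : ℕ)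
    (hk : 2 * k ≤ n) (A : V → F) (hA : ∀ i < 2 * k, ∀ x (s : F), A (x + s • e i) = A x) :
    ∀ (L : V →ₗ[F] F) (c : F), ∃ (L' : V →ₗ[F] F) (c' : F), (L = 0 → L' = 0 ∧ c' = c) ∧
      (Fintype.card F : ℚ) ^ k * dev (fun x => hyp φ k x + A x + L x + c) =
        dev (fun x => A x + L' x + c') := by
  induction k with
  | zero =>
    intro L c
    exact ⟨L, c, fun h => ⟨h, rfl⟩, by simp [hyp]⟩
  | succ k ih =>
    intro L c
    set L₁ := L - L (e (2 * k)) • φ (2 * k) - L (e (2 * k + 1)) • φ (2 * k + 1) with hL₁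
    obtain ⟨L', c', h1, h2⟩ := ih (by omega) (fun i hi => hA i (by omega)) L₁
      (c - L (e (2 * k)) * L (e (2 * k + 1)))
    refine ⟨L', c', ?_, ?_⟩
    · intro h0
      have := h1 (by rw [hL₁, h0]; simp)
      rw [h0] at this
      simpa using this
    · have b11 := h (2 * k) (by omega) (2 * k) (by omega)
      have b12 := h (2 * k) (by omega) (2 * k + 1) (by omega)
      have b21 := h (2 * k + 1) (by omega) (2 * k) (by omega)
      have b22 := h (2 * k + 1) (by omega) (2 * k + 1) (by omega)
      rw [if_pos rfl] at b11 b22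
      rw [if_neg (by omega)] at b12 b21
      rw [← h2, pow_succ, mul_assoc]
      congr 1
      refine dev_hyperbolic _ _ (fun x => φ (2 * k) x + L (e (2 * k + 1)))
        (fun x => φ (2 * k + 1) x + L (e (2 * k))) (e (2 * k)) (e (2 * k + 1)) ?_ ?_ ?_ ?_
      · intro x
        rw [hyp_succ, hL₁]
        simp only [_root_.add_apply, linMulLin_apply, LinearMap.sub_apply, LinearMap.smul_apply,
          smul_eq_mul]
        ring
      · intro x s t
        have e1 : hyp φ k (x + (s • e (2 * k) + t • e (2 * k + 1))) = hyp φ k x := by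
          apply hyp_congr
          intro i hi
          have c1 := h i (by omega) (2 * k) (by omega)
          have c2 := h i (by omega) (2 * k + 1) (by omega)
          rw [if_neg (by omega)] at c1 c2
          simp [c1, c2]
        have e2 : A (x + (s • e (2 * k) + t • e (2 * k + 1))) = A x := by
          rw [← add_assoc, hA _ (by omega), hA _ (by omega)]
        have e3 : L₁ (x + (s • e (2 * k) + t • e (2 * k + 1))) = L₁ x := by
          simp [hL₁, b11, b12, b21, b22]
          ring
        rw [e1, e2, e3]
      · intro x s t
        simp [b11, b12]
        ring
      · intro x s t
        simp [b21, b22]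
        ring

lemma dev_linear_shift {L : V →ₗ[F] F} {A : V → F} {z : V} (hA : ∀ x (s : F), A (x + s • z) = A x)
    (hL : L z ≠ 0) (c : F) : dev (fun x => A x + L x + c) = 0 := by
  refine dev_eq_zero_of_shift _ ((L z)⁻¹ • z) fun x s => ?_
  rw [smul_smul, hA, map_add, map_smul, smul_eq_mul]
  field_simp
  ring

/-- Once the hyperbolic planes are removed, a core in 0, 1 or 2 coordinates plus an affine function
is left. If the linear part does not factor through the core, some direction fixes the core and
moves the linear part, and the deviation is 0. Otherwise it is that of a constant, a univariate
quadratic or an anisotropic binary quadratic, times the fibre size. -/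
theorem Shape.evenDev_or_oddDev {n : ℕ} {φ : ℕ → V →ₗ[F] F} {e : ℕ → V} {τ : ℤ}
    {Q : QuadraticForm F V} (h : Biorth n φ e) (hQ : Shape φ n τ Q) :
    (∃ k, n = 2 * k + 1 ∧ OddDev Q k) ∨
      ∃ k, n = 2 * k ∧ (τ = 1 ∨ τ = -1) ∧ EvenDev Q k τ := by
  have hq := card_ne_zero' (F := F)
  have hqk := fun k => pow_ne_zero k hq
  cases hQ with
  | plus k =>
    right
    refine ⟨k, rfl, Or.inl rfl, ?_, ?_⟩
    · obtain ⟨L', c', h1, h2⟩ := dev_hyp_add h k le_rfl (fun _ => 0) (by simp) 0 0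
      obtain ⟨rfl, rfl⟩ := h1 rfl
      simp only [add_zero, LinearMap.zero_apply] at h2
      apply mul_left_cancel₀ (hqk k)
      refine h2.trans ?_
      rw [dev_const, scale, delta]
      field_simp
      simp
      ring
    · intro L c
      obtain ⟨L', c', -, h2⟩ := dev_hyp_add h k le_rfl (fun _ => 0) (by simp) L c
      simp only [add_zero, zero_add] at h2
      by_cases hL : L' = 0
      · right
        subst hL
        simp only [LinearMap.zero_apply, zero_add] at h2
        rw [dev_const, delta] at h2
        by_cases hc : c' = 0
        · left
          apply mul_left_cancel₀ (hqk k)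
          rw [h2, if_pos hc, scale]
          field_simp
          simp
          ring
        · right
          apply mul_left_cancel₀ (hqk k)
          rw [h2, if_neg hc, scale]
          field_simp
          simp
          ring
      · left
        rw [dev_linear hL] at h2
        exact (mul_eq_zero.1 h2).resolve_left (hqk k)
  | odd k a ha =>
    left
    have b11 := h (2 * k) (by omega) (2 * k) (by omega)
    rw [if_pos rfl] at b11
    have hA : ∀ i < 2 * k, ∀ x (s : F), a * φ (2 * k) (x + s • e i) ^ 2 = a * φ (2 * k) x ^ 2 := by
      intro i hi x s
      have := h (2 * k) (by omega) i (by omega)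
      rw [if_neg (by omega)] at this
      simp [this]
    have hf : ∀ x, (hyp φ k + a • linMulLin (φ (2 * k)) (φ (2 * k))) x =
        hyp φ k x + a * φ (2 * k) x ^ 2 := by
      intro x
      simp only [_root_.add_apply, _root_.smul_apply, linMulLin_apply, smul_eq_mul]
      ring
    refine ⟨k, rfl, ?_, ?_⟩
    · obtain ⟨L', c', h1, h2⟩ := dev_hyp_add h k (by omega)
        (fun x => a * φ (2 * k) x ^ 2) hA 0 0
      obtain ⟨rfl, rfl⟩ := h1 rfl
      simp only [add_zero, LinearMap.zero_apply] at h2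
      apply mul_left_cancel₀ (hqk k)
      have h3 : dev (fun x => a * φ (2 * k) x ^ 2) = 0 := by
        rw [dev, sum_comp_one b11 (fun t => delta (a * t ^ 2))]
        have : ∑ t : F, delta (a * t ^ 2) = 0 := by
          have e1 : ∀ t : F, a * t ^ 2 = 0 ↔ t = 0 := fun t => by simp [ha]
          simp [delta, e1, Finset.sum_sub_distrib, hq]
        rw [this, mul_zero]
      rw [mul_zero, ← h3, ← h2]
      congr 2
      funext x
      exact hf x
    · intro L c
      obtain ⟨L', c', -, h2⟩ := dev_hyp_add h k (by omega)
        (fun x => a * φ (2 * k) x ^ 2) hA L c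
      simp only [hf]
      by_cases hL : L' = L' (e (2 * k)) • φ (2 * k)
      · have h3 : dev (fun x => a * φ (2 * k) x ^ 2 + L' x + c') =
            (Fintype.card V : ℚ) / Fintype.card F *
              ∑ t : F, delta (a * t ^ 2 + L' (e (2 * k)) * t + c') := by
          rw [← sum_comp_one b11 (fun t => delta (a * t ^ 2 + L' (e (2 * k)) * t + c')), dev]
          refine Finset.sum_congr rfl fun x _ => ?_
          conv_lhs => rw [hL]
          rfl
        rw [h3] at h2
        rcases sum_delta_univariate ha (L' (e (2 * k))) c' with h4 | h4 | h4
        · left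
          apply mul_left_cancel₀ (hqk k)
          rw [h2, h4, mul_zero, mul_zero]
        · right; left
          apply mul_left_cancel₀ (hqk k)
          rw [h2, h4, scale]
          field_simp
          ring
        · right; right
          apply mul_left_cancel₀ (hqk k)
          rw [h2, h4, scale]
          field_simp
          ring
      · left
        obtain ⟨z, hz⟩ : ∃ z, L' z ≠ L' (e (2 * k)) * φ (2 * k) z := by
          by_contra! h5
          exact hL (LinearMap.ext h5)
        have h3 : dev (fun x => a * φ (2 * k) x ^ 2 + L' x + c') = 0 := by
          refine dev_linear_shift (z := z - φ (2 * k) z • e (2 * k)) ?_ ?_ c'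
          · intro x s
            simp [b11]
          · rw [map_sub, map_smul, smul_eq_mul]
            intro h6
            exact hz (by linear_combination h6)
        rw [h3] at h2
        exact (mul_eq_zero.1 h2).resolve_left (hqk k)
  | minus k b c hbc =>
    right
    have han := hbc.aniso
    have b11 := h (2 * k) (by omega) (2 * k) (by omega)
    have b12 := h (2 * k) (by omega) (2 * k + 1) (by omega)
    have b21 := h (2 * k + 1) (by omega) (2 * k) (by omega)
    have b22 := h (2 * k + 1) (by omega) (2 * k + 1) (by omega)
    rw [if_pos rfl] at b11 b22
    rw [if_neg (by omega)] at b12 b21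
    set A : V → F := fun x => 1 * φ (2 * k) x ^ 2 + b * φ (2 * k) x * φ (2 * k + 1) x +
      c * φ (2 * k + 1) x ^ 2 with hAdef
    have hA : ∀ i < 2 * k, ∀ x (s : F), A (x + s • e i) = A x := by
      intro i hi x s
      have c1 := h (2 * k) (by omega) i (by omega)
      have c2 := h (2 * k + 1) (by omega) i (by omega)
      rw [if_neg (by omega)] at c1 c2
      simp [hAdef, c1, c2]
    have hf : ∀ x, (hyp φ k + (linMulLin (φ (2 * k)) (φ (2 * k)) +
        b • linMulLin (φ (2 * k)) (φ (2 * k + 1)) +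
        c • linMulLin (φ (2 * k + 1)) (φ (2 * k + 1)))) x = hyp φ k x + A x := by
      intro x
      simp only [_root_.add_apply, _root_.smul_apply, linMulLin_apply, smul_eq_mul, hAdef]
      ring
    -- The anisotropic plane is the (k+1)-st plane; its deviation 1 - q, against q - 1 for a
    -- hyperbolic one, produces the sign -1.
    refine ⟨k + 1, rfl, Or.inr rfl, ?_, ?_⟩
    · obtain ⟨L', c', h1, h2⟩ := dev_hyp_add h k (by omega) _ hA 0 0
      obtain ⟨rfl, rfl⟩ := h1 rfl
      simp only [add_zero, LinearMap.zero_apply] at h2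
      apply mul_left_cancel₀ (hqk k)
      have h3 : dev A = (Fintype.card V : ℚ) / (Fintype.card F : ℚ) ^ 2 * (1 - Fintype.card F) := by
        rw [← han.dev_zero]
        exact sum_comp_two b11 b21 b12 b22 (fun s t => delta (1 * s ^ 2 + b * s * t + c * t ^ 2))
      have h4 : dev (hyp φ k + (linMulLin (φ (2 * k)) (φ (2 * k)) +
        b • linMulLin (φ (2 * k)) (φ (2 * k + 1)) +
        c • linMulLin (φ (2 * k + 1)) (φ (2 * k + 1)))) = dev fun x => hyp φ k x + A x := by
        congr 1
        funext x
        exact hf x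
      rw [h4, h2, h3, scale]
      field_simp
      push_cast
      ring
    · intro L d
      obtain ⟨L', d', -, h2⟩ := dev_hyp_add h k (by omega) _ hA L d
      simp only [hf]
      by_cases hL : L' = L' (e (2 * k)) • φ (2 * k) + L' (e (2 * k + 1)) • φ (2 * k + 1)
      · have h3 : dev (fun x => A x + L' x + d') =
            (Fintype.card V : ℚ) / (Fintype.card F : ℚ) ^ 2 *
              dev (fun p : F × F => 1 * p.1 ^ 2 + b * p.1 * p.2 + c * p.2 ^ 2 +
                L' (e (2 * k)) * p.1 + L' (e (2 * k + 1)) * p.2 + d') := by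
          have h4 := sum_comp_two b11 b21 b12 b22 (fun s t => delta (1 * s ^ 2 + b * s * t +
            c * t ^ 2 + L' (e (2 * k)) * s + L' (e (2 * k + 1)) * t + d'))
          refine Eq.trans ?_ h4
          refine Finset.sum_congr rfl fun x _ => ?_
          conv_lhs => rw [hL]
          simp only [hAdef, LinearMap.add_apply, LinearMap.smul_apply, smul_eq_mul]
          congr 1
          ring
        rw [h3] at h2
        right
        rcases han.dev_affine (L' (e (2 * k))) (L' (e (2 * k + 1))) d' with h4 | h4
        · left
          apply mul_left_cancel₀ (hqk k)
          rw [h2, h4, scale]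
          field_simp
          push_cast
          ring
        · right
          apply mul_left_cancel₀ (hqk k)
          rw [h2, h4, scale]
          field_simp
          push_cast
          ring
      · left
        obtain ⟨z, hz⟩ : ∃ z, L' z ≠ L' (e (2 * k)) * φ (2 * k) z +
            L' (e (2 * k + 1)) * φ (2 * k + 1) z := by
          by_contra! h5
          exact hL (LinearMap.ext h5)
        have h3 : dev (fun x => A x + L' x + d') = 0 := by
          refine dev_linear_shift
            (z := z - φ (2 * k) z • e (2 * k) - φ (2 * k + 1) z • e (2 * k + 1)) ?_ ?_ d'
          · intro x s
            simp [hAdef, b11, b12, b21, b22]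
          · rw [map_sub, map_sub, map_smul, map_smul, smul_eq_mul, smul_eq_mul]
            intro h6
            exact hz (by linear_combination h6)
        rw [h3] at h2
        exact (mul_eq_zero.1 h2).resolve_left (hqk k)

end DevValues

/-! ### Changing two functionals of a dual system. -/

section ChangeOfBasis

variable {F : Type*} [Field F] {V : Type*} [AddCommGroup V] [Module F V]

/-- Replace the members number `n` and `n + 1` of a sequence. -/
def replaceTwo {α : Type*} (n : ℕ) (f : ℕ → α) (a b : α) : ℕ → α :=
  fun i => if i = n then a else if i = n + 1 then b else f i

lemma replaceTwo_fst {α : Type*} (n : ℕ) (f : ℕ → α) (a b : α) : replaceTwo n f a b n = a := by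
  simp [replaceTwo]

lemma replaceTwo_snd {α : Type*} (n : ℕ) (f : ℕ → α) (a b : α) :
    replaceTwo n f a b (n + 1) = b := by
  simp [replaceTwo]

lemma replaceTwo_lt {α : Type*} {n : ℕ} (f : ℕ → α) (a b : α) {i : ℕ} (hi : i < n) :
    replaceTwo n f a b i = f i := by
  rw [replaceTwo, if_neg (by omega), if_neg (by omega)]

/-- The dual vectors transform by the inverse transpose matrix. -/
lemma Biorth.replaceTwo {n : ℕ} {φ : ℕ → V →ₗ[F] F} {e : ℕ → V} (h : Biorth (n + 2) φ e)
    {a b c d : F} (hΔ : a * d - b * c ≠ 0) :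
    Biorth (n + 2) (replaceTwo n φ (a • φ n + b • φ (n + 1)) (c • φ n + d • φ (n + 1)))
      (replaceTwo n e ((a * d - b * c)⁻¹ • (d • e n - c • e (n + 1)))
        ((a * d - b * c)⁻¹ • (a • e (n + 1) - b • e n))) := by
  have b11 := h n (by omega) n (by omega)
  have b12 := h n (by omega) (n + 1) (by omega)
  have b21 := h (n + 1) (by omega) n (by omega)
  have b22 := h (n + 1) (by omega) (n + 1) (by omega)
  rw [if_pos rfl] at b11 b22
  rw [if_neg (by omega)] at b12 b21
  have key : ∀ k < n + 2, k < n ∨ k = n ∨ k = n + 1 := fun k hk => by omega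
  intro i hi j hj
  rcases key i hi with hi' | rfl | rfl <;> rcases key j hj with hj' | rfl | rfl
  · rw [replaceTwo_lt _ _ _ hi', replaceTwo_lt _ _ _ hj']
    exact h i hi j hj
  · have c1 := h i hi j hj
    have c2 := h i hi (j + 1) (by omega)
    rw [if_neg (by omega)] at c1 c2
    rw [replaceTwo_lt _ _ _ hi', replaceTwo_fst, if_neg (by omega)]
    simp [c1, c2]
  · have c1 := h i hi n (by omega)
    have c2 := h i hi (n + 1) (by omega)
    rw [if_neg (by omega)] at c1 c2
    rw [replaceTwo_lt _ _ _ hi', replaceTwo_snd, if_neg (by omega)]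
    simp [c1, c2]
  · have c1 := h i hi j hj
    have c2 := h (i + 1) (by omega) j hj
    rw [if_neg (by omega)] at c1 c2
    rw [replaceTwo_lt _ _ _ hj', replaceTwo_fst, if_neg (by omega)]
    simp [c1, c2]
  · rw [replaceTwo_fst, replaceTwo_fst, if_pos rfl]
    simp [b11, b12, b21, b22]
    linear_combination mul_inv_cancel₀ hΔ
  · rw [replaceTwo_fst, replaceTwo_snd, if_neg (by omega)]
    simp [b11, b12, b21, b22]
    right; ring
  · have c1 := h n (by omega) j hj
    have c2 := h (n + 1) (by omega) j hj
    rw [if_neg (by omega)] at c1 c2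
    rw [replaceTwo_lt _ _ _ hj', replaceTwo_snd, if_neg (by omega)]
    simp [c1, c2]
  · rw [replaceTwo_snd, replaceTwo_fst, if_neg (by omega)]
    simp [b11, b12, b21, b22]
    right; ring
  · rw [replaceTwo_snd, replaceTwo_snd, if_pos rfl]
    simp [b11, b12, b21, b22]
    linear_combination mul_inv_cancel₀ hΔ

/-- A hyperbolic plane in diagonal form, in odd characteristic. -/
lemma exists_diagonal_hyp (h2 : (2 : F) ≠ 0) {k : ℕ} {φ : ℕ → V →ₗ[F] F} {e : ℕ → V}
    (h : Biorth (2 * k + 2) φ e) :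
    ∃ (ψ : ℕ → V →ₗ[F] F) (d : ℕ → V), Biorth (2 * k + 2) ψ d ∧ ∀ x,
      hyp φ (k + 1) x = hyp ψ k x + ψ (2 * k) x * ψ (2 * k) x -
        ψ (2 * k + 1) x * ψ (2 * k + 1) x := by
  have hi := mul_inv_cancel₀ h2
  -- The identity uv = ((u + v)/2)² - ((u - v)/2)².
  refine ⟨_, _, h.replaceTwo (a := 2⁻¹) (b := 2⁻¹) (c := 2⁻¹) (d := -2⁻¹) ?_, fun x => ?_⟩
  · have : (2⁻¹ : F) * -2⁻¹ - 2⁻¹ * 2⁻¹ = -2⁻¹ := by linear_combination (-2⁻¹) * hi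
    rw [this, neg_ne_zero]
    exact inv_ne_zero h2
  · rw [replaceTwo_fst, replaceTwo_snd, hyp_succ, _root_.add_apply]
    have : hyp φ k x = hyp (replaceTwo (2 * k) φ ((2⁻¹ : F) • φ (2 * k) +
        (2⁻¹ : F) • φ (2 * k + 1)) ((2⁻¹ : F) • φ (2 * k) + (-2⁻¹ : F) • φ (2 * k + 1))) k x :=
      hyp_congr fun i hi => by rw [replaceTwo_lt _ _ _ hi]
    rw [← this]
    simp only [linMulLin_apply, LinearMap.add_apply, LinearMap.smul_apply, smul_eq_mul]
    linear_combination (-(φ (2 * k) x * φ (2 * k + 1) x)) * (1 + 2 * 2⁻¹) * hi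

lemma exists_hyp_diagonal (h2 : (2 : F) ≠ 0) {k : ℕ} {φ : ℕ → V →ₗ[F] F} {e : ℕ → V}
    (h : Biorth (2 * k + 2) φ e) :
    ∃ (ψ : ℕ → V →ₗ[F] F) (d : ℕ → V), Biorth (2 * k + 2) ψ d ∧ ∀ x,
      hyp φ k x + φ (2 * k) x * φ (2 * k) x - φ (2 * k + 1) x * φ (2 * k + 1) x =
        hyp ψ (k + 1) x := by
  refine ⟨_, _, h.replaceTwo (a := 1) (b := 1) (c := 1) (d := -1) ?_, fun x => ?_⟩
  · have : (1 : F) * -1 - 1 * 1 = -2 := by ring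
    rw [this, neg_ne_zero]
    exact h2
  · rw [hyp_succ, _root_.add_apply, linMulLin_apply, replaceTwo_fst, replaceTwo_snd]
    have : hyp φ k x = hyp (replaceTwo (2 * k) φ ((1 : F) • φ (2 * k) +
        (1 : F) • φ (2 * k + 1)) ((1 : F) • φ (2 * k) + (-1 : F) • φ (2 * k + 1))) k x :=
      hyp_congr fun i hi => by rw [replaceTwo_lt _ _ _ hi]
    rw [← this]
    simp only [LinearMap.add_apply, LinearMap.smul_apply, smul_eq_mul]
    ring

end ChangeOfBasis

/-! ### Comparison of normal forms with the canonical forms of given type. -/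

section Standard

variable {F : Type*} [Field F] {m : ℕ}

lemma coord_apply {i : ℕ} (hi : i < m) (x : Fin m → F) : coord F m i x = x ⟨i, hi⟩ := by
  simp [coord, hi]

lemma exists_biorth_coord {n : ℕ} (hn : n ≤ m) :
    ∃ e : ℕ → Fin m → F, Biorth n (coord F m) e := by
  refine ⟨fun j => if h : j < m then Pi.single ⟨j, h⟩ 1 else 0, fun i hi j hj => ?_⟩
  have hjm : j < m := by omega
  rw [coord_apply (by omega)]
  simp [hjm, Pi.single_apply, Fin.ext_iff]

/-- Complete the functionals to a basis of the dual space, by induction on the number d of missing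
ones; a basis of the dual is a coordinate system. -/
lemma exists_equiv_of_linearIndependent (d : ℕ) : ∀ (n : ℕ)
    (ψ : Fin n → ((Fin m → F) →ₗ[F] F)), LinearIndependent F ψ → n + d = m →
    ∃ E : (Fin m → F) ≃ₗ[F] (Fin m → F), ∀ (i : Fin n) (x : Fin m → F),
      coord F m i (E x) = ψ i x := by
  induction d with
  | zero =>
    rintro n ψ h rfl
    have hd : Module.finrank F (Module.Dual F (Fin n → F)) = n := by
      rw [Subspace.dual_finrank_eq, Module.finrank_fin_fun]
    have hinj : Function.Injective (LinearMap.pi ψ) := by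
      rw [← LinearMap.ker_eq_bot, LinearMap.ker_eq_bot']
      intro x hx
      rw [← Module.forall_dual_apply_eq_zero_iff F x]
      have htop := h.span_eq_top_of_card_eq_finrank' (by rw [Fintype.card_fin]; exact hd.symm)
      intro f
      have hf : f ∈ Submodule.span F (Set.range ψ) := by rw [htop]; trivial
      induction hf using Submodule.span_induction with
      | mem g hg =>
        obtain ⟨i, rfl⟩ := hg
        exact congr_fun hx i
      | zero => rfl
      | add f g _ _ hf hg => rw [LinearMap.add_apply, hf, hg, add_zero]
      | smul a f _ hf => rw [LinearMap.smul_apply, hf, smul_zero]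
    refine ⟨LinearEquiv.ofInjectiveEndo (LinearMap.pi ψ) hinj, fun i x => ?_⟩
    rw [coord_apply (by omega)]
    rfl
  | succ d ih =>
    intro n ψ h hn
    obtain ⟨f, hf⟩ := exists_linearIndependent_snoc_of_lt_finrank h (by
      have : Module.finrank F (Module.Dual F (Fin m → F)) = m := by
        rw [Subspace.dual_finrank_eq, Module.finrank_fin_fun]
      show n < Module.finrank F (Module.Dual F (Fin m → F))
      omega)
    obtain ⟨E, hE⟩ := ih (n + 1) _ hf (by omega)
    refine ⟨E, fun i x => ?_⟩
    have := hE i.castSucc x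
    simpa using this

lemma Biorth.exists_equiv {n : ℕ} {φ : ℕ → (Fin m → F) →ₗ[F] F} {e : ℕ → Fin m → F}
    (h : Biorth n φ e) (hn : n ≤ m) :
    ∃ E : (Fin m → F) ≃ₗ[F] (Fin m → F), ∀ i < n, ∀ x, coord F m i (E x) = φ i x := by
  have hli : LinearIndependent F (fun i : Fin n => φ i) := by
    refine LinearIndependent.of_pairwise_dual_eq_zero_one _
      (fun j : Fin n => Module.Dual.eval F (Fin m → F) (e j)) ?_ ?_
    · intro i j hij
      rw [Module.Dual.eval_apply, h j j.2 i i.2, if_neg fun h => hij (Fin.ext h.symm)]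
    · intro i
      rw [Module.Dual.eval_apply, h i i.2 i i.2, if_pos rfl]
  obtain ⟨E, hE⟩ := exists_equiv_of_linearIndependent (m - n) n _ hli (by omega)
  exact ⟨E, fun i hi x => hE ⟨i, hi⟩ x⟩

lemma equivalent_of_forall {Q Q₀ : QuadraticForm F (Fin m → F)}
    (E : (Fin m → F) ≃ₗ[F] (Fin m → F)) (h : ∀ x, Q₀ (E x) = Q x) : Q.Equivalent Q₀ :=
  ⟨{ E with map_app' := h }⟩

lemma hyperbolic_eq (k : ℕ) : hyperbolic F m k = hyp (coord F m) k := rfl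

lemma monom_apply (i j : ℕ) (x : Fin m → F) : monom F m i j x = coord F m i x * coord F m j x := rfl

variable [Fintype F] [DecidableEq F]

/-- Every normal form of even rank is equivalent to a canonical one. -/
lemma Shape.exists_isCanonical {k : ℕ} (hk : 2 * k ≤ m) {φ : ℕ → (Fin m → F) →ₗ[F] F}
    {e : ℕ → Fin m → F} {τ : ℤˣ} {Q : QuadraticForm F (Fin m → F)} (h : Biorth (2 * k) φ e)
    {n : ℕ} (hn : n = 2 * k) {t : ℤ} (ht : t = τ) (hQ : Shape φ n t Q) :
    ∃ Q₀, IsCanonical F m (2 * k) τ Q₀ ∧ Q.Equivalent Q₀ := by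
  cases hQ with
  | plus k' =>
    obtain rfl : k' = k := by omega
    obtain rfl : τ = 1 := Units.ext ht.symm
    rcases k' with _ | k
    · refine ⟨0, IsCanonical.zero, ?_⟩
      simp only [hyp, Finset.range_zero, Finset.sum_empty]
      exact Equivalent.refl _
    · by_cases h2 : (2 : F) = 0
      · obtain ⟨E, hE⟩ := h.exists_equiv hk
        refine ⟨_, IsCanonical.even_plus (two_eq_zero_iff_even.1 h2) k,
          equivalent_of_forall E fun x => ?_⟩
        rw [hyperbolic_eq]
        exact hyp_congr fun i hi => hE i hi x
      · obtain ⟨ψ, d, hψ, hφψ⟩ := exists_diagonal_hyp h2 h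
        obtain ⟨E, hE⟩ := hψ.exists_equiv hk
        have hodd : Odd (Nat.card F) := by
          rw [← Nat.not_even_iff_odd, ← two_eq_zero_iff_even]; exact h2
        refine ⟨_, IsCanonical.odd_even_plus hodd k, equivalent_of_forall E fun x => ?_⟩
        rw [hφψ, hyperbolic_eq, _root_.sub_apply, _root_.add_apply, monom_apply, monom_apply,
          hE (2 * k) (by omega), hE (2 * k + 1) (by omega),
          hyp_congr (ψ := ψ) (y := x) fun i hi => hE i (by omega) x]
  | odd k' a ha => omega
  | minus k' b c hbc =>
    obtain rfl : k = k' + 1 := by omega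
    obtain rfl : τ = -1 := Units.ext ht.symm
    obtain ⟨E, hE⟩ := h.exists_equiv hk
    have e1 := hE (2 * k') (by omega)
    have e2 := hE (2 * k' + 1) (by omega)
    have e3 := fun x => hyp_congr (ψ := φ) (k := k') (y := x) fun i hi => hE i (by omega) x
    rcases hbc with ⟨rfl, hodd, hsq⟩ | ⟨rfl, heven, htr⟩
    · refine ⟨_, IsCanonical.odd_even_minus hodd k' (-c) hsq, equivalent_of_forall E fun x => ?_⟩
      rw [hyperbolic_eq]
      simp only [_root_.sub_apply, _root_.add_apply, _root_.smul_apply, monom_apply, e1, e2, e3,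
        linMulLin_apply, smul_eq_mul]
      ring
    · have hc : c ≠ 0 := by
        rintro rfl
        have : absTrace (0 : F) = 0 := map_zero _
        rw [this] at htr
        exact zero_ne_one htr
      refine ⟨_, IsCanonical.even_minus heven k' c hc htr, equivalent_of_forall E fun x => ?_⟩
      rw [hyperbolic_eq]
      simp only [_root_.add_apply, _root_.smul_apply, monom_apply, e1, e2, e3,
        linMulLin_apply, smul_eq_mul]
      ring

/-- Puts canonical forms under the deviation computation, so that a type, however witnessed,
determines the deviation. -/
lemma IsCanonical.exists_shape {k n : ℕ} (hk : 2 * k ≤ m) (hn : n = 2 * k) {τ : ℤˣ}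
    {Q₀ : QuadraticForm F (Fin m → F)} (h : IsCanonical F m n τ Q₀) :
    ∃ (φ : ℕ → (Fin m → F) →ₗ[F] F) (e : ℕ → Fin m → F), Biorth n φ e ∧ Shape φ n τ Q₀ := by
  obtain ⟨e, he⟩ := exists_biorth_coord (F := F) (m := m) (n := n) (by omega)
  cases h with
  | zero =>
    refine ⟨_, e, he, ?_⟩
    have := Shape.plus (φ := coord F m) 0
    simpa [hyp] using this
  | even_plus hF k' => exact ⟨_, e, he, Shape.plus (k' + 1)⟩
  | even_minus hF k' l hl0 hl =>
    refine ⟨_, e, he, ?_⟩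
    have := Shape.minus (φ := coord F m) k' 1 l (Or.inr ⟨rfl, hF, hl⟩)
    rw [one_smul, ← add_assoc, ← add_assoc] at this
    exact this
  | odd_odd_plus hF k' => omega
  | odd_odd_minus hF k' l hl => omega
  | odd_even_plus hF k' =>
    have h2 : (2 : F) ≠ 0 := by
      rw [Ne, two_eq_zero_iff_even, Nat.not_even_iff_odd]; exact hF
    obtain ⟨ψ, d, hψ, hφψ⟩ := exists_hyp_diagonal h2 he
    refine ⟨ψ, d, hψ, ?_⟩
    have : hyperbolic F m k' + monom F m (2 * k') (2 * k') -
        monom F m (2 * k' + 1) (2 * k' + 1) = hyp ψ (k' + 1) := by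
      ext x
      exact hφψ x
    rw [this]
    exact Shape.plus (k' + 1)
  | odd_even_minus hF k' l hl =>
    refine ⟨_, e, he, ?_⟩
    -- The last coefficient of the canonical form is -l, and the normal form asks that its negative
    -- be a nonsquare.
    have := Shape.minus (φ := coord F m) k' 0 (-l) (Or.inl ⟨rfl, hF, by rwa [neg_neg]⟩)
    convert this using 1
    · rfl
    · ext x
      simp only [hyperbolic_eq, _root_.sub_apply, _root_.add_apply, _root_.smul_apply, monom_apply,
        linMulLin_apply, smul_eq_mul]
      ring

lemma dev_equivalent {Q Q₀ : QuadraticForm F (Fin m → F)} (h : Q.Equivalent Q₀) :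
    dev Q = dev Q₀ := by
  obtain ⟨E⟩ := h
  exact Fintype.sum_equiv E.toEquiv _ _ fun x => congrArg delta (E.map_app x).symm

theorem evenDev_or_oddDev (Q : QuadraticForm F (Fin m → F)) :
    (∃ k, quadRank Q = 2 * k + 1 ∧ OddDev Q k) ∨
      ∃ k, quadRank Q = 2 * k ∧ ∃ τ : ℤˣ, HasType Q τ ∧ EvenDev Q k τ := by
  obtain ⟨φ, e, τ, h1, h2⟩ := exists_shape Q
  rcases h2.evenDev_or_oddDev h1 with h3 | ⟨k, hk, hτ, h3⟩
  · exact Or.inl h3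
  · right
    obtain ⟨σ, rfl⟩ : ∃ σ : ℤˣ, τ = σ := by
      rcases hτ with rfl | rfl
      · exact ⟨1, rfl⟩
      · exact ⟨-1, rfl⟩
    have hm := quadRank_le Q
    refine ⟨k, hk, σ, ?_, h3⟩
    rw [HasType, hk]
    rw [hk] at h1
    exact h2.exists_isCanonical (by omega) h1 hk rfl

lemma HasType.dev_eq {Q : QuadraticForm F (Fin m → F)} {τ : ℤˣ} (h : HasType Q τ) {k : ℕ}
    (hk : quadRank Q = 2 * k) :
    dev Q = (τ : ℤ) * (Fintype.card F - 1) * scale F (Fin m → F) k := by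
  obtain ⟨Q₀, hc, he⟩ := h
  have hm := quadRank_le Q
  obtain ⟨φ, e, h1, h2⟩ := hc.exists_shape (k := k) (by omega) hk
  rw [dev_equivalent he]
  rcases h2.evenDev_or_oddDev h1 with ⟨j, hj, -⟩ | ⟨j, hj, -, h3⟩
  · omega
  · obtain rfl : j = k := by omega
    exact h3.1

end Standard

/-! ### How often each deviation occurs among the functions Q + L + c. -/

section Counting

variable {F : Type*} [Field F] [Fintype F] [DecidableEq F] {m : ℕ}

noncomputable instance instFintypeDual : Fintype ((Fin m → F) →ₗ[F] F) :=
  @Fintype.ofFinite _ (DFunLike.finite _)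

noncomputable instance instFintypeQuadraticForm : Fintype (QuadraticForm F (Fin m → F)) :=
  @Fintype.ofFinite _ (DFunLike.finite _)

lemma card_dual : Fintype.card ((Fin m → F) →ₗ[F] F) = Fintype.card F ^ m := by
  have h : Fintype.card (Module.Dual F (Fin m → F)) =
      Fintype.card F ^ Module.finrank F (Module.Dual F (Fin m → F)) :=
    Module.card_eq_pow_finrank
  rw [Subspace.dual_finrank_eq, Module.finrank_fin_fun] at h
  exact h

lemma sum_dev_affine (Q : QuadraticForm F (Fin m → F)) :
    ∑ p : ((Fin m → F) →ₗ[F] F) × F, dev (fun x => Q x + p.1 x + p.2) = 0 := by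
  rw [Fintype.sum_prod_type]
  refine Finset.sum_eq_zero fun L _ => ?_
  simp only [dev]
  rw [Finset.sum_comm]
  simp [sum_delta_add]

lemma sum_delta_dual {z : Fin m → F} (hz : z ≠ 0) (a : F) :
    ∑ L : (Fin m → F) →ₗ[F] F, delta (a + L z) = 0 := by
  have h := dev_linear (V := (Fin m → F) →ₗ[F] F) (L := Module.Dual.eval F (Fin m → F) z)
    (fun h => hz ((Module.eval_apply_eq_zero_iff F z).1 h)) a
  rw [← h]
  refine Finset.sum_congr rfl fun L _ => ?_
  rw [add_comm]
  rfl

/-- Summing over constants leaves `delta` of the difference of the values at x and y. For x ≠ y the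
number L(x - y) is equidistributed as L varies, so only the diagonal survives and Q drops out. -/
lemma sum_dev_affine_sq (Q : QuadraticForm F (Fin m → F)) :
    ∑ p : ((Fin m → F) →ₗ[F] F) × F, dev (fun x => Q x + p.1 x + p.2) ^ 2 =
      ((Fintype.card F : ℚ) ^ m) ^ 2 * (1 - 1 / Fintype.card F) := by
  calc ∑ p : ((Fin m → F) →ₗ[F] F) × F, dev (fun x => Q x + p.1 x + p.2) ^ 2
      = ∑ L : (Fin m → F) →ₗ[F] F, ∑ c : F, ∑ x, ∑ y,
          delta (Q x + L x + c) * delta (Q y + L y + c) := by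
        rw [Fintype.sum_prod_type]
        simp only [dev, pow_two, Finset.sum_mul_sum]
    _ = ∑ L : (Fin m → F) →ₗ[F] F, ∑ x, ∑ y, delta ((Q x - Q y) + L (x - y)) := by
        refine Finset.sum_congr rfl fun L _ => ?_
        rw [Finset.sum_comm]
        refine Finset.sum_congr rfl fun x _ => ?_
        rw [Finset.sum_comm]
        refine Finset.sum_congr rfl fun y _ => ?_
        rw [sum_delta_mul_delta, map_sub]
        congr 1
        ring
    _ = ∑ x, ∑ y, ∑ L : (Fin m → F) →ₗ[F] F, delta ((Q x - Q y) + L (x - y)) := by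
        rw [Finset.sum_comm]
        exact Finset.sum_congr rfl fun x _ => Finset.sum_comm
    _ = ∑ x, ∑ y, if x = y then (Fintype.card F : ℚ) ^ m * (1 - 1 / Fintype.card F) else 0 := by
        refine Finset.sum_congr rfl fun x _ => Finset.sum_congr rfl fun y _ => ?_
        split_ifs with h
        · subst h
          simp [delta, card_dual]
          ring
        · exact sum_delta_dual (sub_ne_zero.2 h) _
    _ = _ := by
        simp
        ring

/-- The number of affine functions whose addition to `Q` gives deviation `d`. -/
noncomputable def cnt (Q : QuadraticForm F (Fin m → F)) (d : ℚ) : ℕ :=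
  (Finset.univ.filter fun p : ((Fin m → F) →ₗ[F] F) × F =>
    dev (fun x => Q x + p.1 x + p.2) = d).card

lemma three_values {ι : Type*} [Fintype ι] (f : ι → ℚ) {a b : ℚ} (ha : a ≠ 0) (hb : b ≠ 0)
    (hab : a ≠ b) (h : ∀ i, f i = 0 ∨ f i = a ∨ f i = b) :
    ∑ i, f i = (Finset.univ.filter fun i => f i = a).card * a +
        (Finset.univ.filter fun i => f i = b).card * b ∧
      ∑ i, f i ^ 2 = (Finset.univ.filter fun i => f i = a).card * a ^ 2 +
        (Finset.univ.filter fun i => f i = b).card * b ^ 2 ∧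
      (Fintype.card ι : ℚ) = (Finset.univ.filter fun i => f i = 0).card +
        (Finset.univ.filter fun i => f i = a).card +
        (Finset.univ.filter fun i => f i = b).card := by
  have key : ∀ g : ℚ → ℚ, ∑ i, g (f i) = (Finset.univ.filter fun i => f i = 0).card * g 0 +
      (Finset.univ.filter fun i => f i = a).card * g a +
        (Finset.univ.filter fun i => f i = b).card * g b := by
    intro g
    have h1 : ∀ i, g (f i) = (if f i = 0 then g 0 else 0) + (if f i = a then g a else 0) +
        (if f i = b then g b else 0) := by
      intro i
      rcases h i with h | h | h <;> rw [h] <;> simp [ha, hb, hab, ha.symm, hb.symm, hab.symm]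
    simp only [h1, Finset.sum_add_distrib, ← Finset.sum_filter, Finset.sum_const, nsmul_eq_mul]
  refine ⟨?_, ?_, ?_⟩
  · simpa using key id
  · exact (key fun x => x ^ 2).trans (by ring)
  · simpa using key fun _ => 1

lemma card_affine : (Fintype.card (((Fin m → F) →ₗ[F] F) × F) : ℚ) =
    (Fintype.card F : ℚ) ^ (m + 1) := by
  rw [Fintype.card_prod, card_dual]
  push_cast
  ring

lemma scale_eq (k : ℕ) :
    scale F (Fin m → F) k = (Fintype.card F : ℚ) ^ m / (Fintype.card F : ℚ) ^ (k + 1) := by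
  simp [scale]

lemma cnt_eq_zero {Q : QuadraticForm F (Fin m → F)} {d : ℚ}
    (h : ∀ (L : (Fin m → F) →ₗ[F] F) (c : F), dev (fun x => Q x + L x + c) ≠ d) :
    cnt Q d = 0 := by
  rw [cnt, Finset.card_eq_zero, Finset.filter_eq_empty_iff]
  exact fun p _ => h p.1 p.2

/-- Three unknown multiplicities and three equations. The first moment makes the small deviation q -
1 times as frequent as the large one, the second moment fixes the scale, and the total gives the
multiplicity of 0. -/
lemma EvenDev.cnt_eq {Q : QuadraticForm F (Fin m → F)} {k : ℕ} {τ : ℤˣ} (h : EvenDev Q k τ)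
    (d : ℚ) :
    (cnt Q d : ℚ) = if d = 0 then
        (Fintype.card F : ℚ) ^ (m + 1) - (Fintype.card F : ℚ) ^ (2 * k + 1)
      else if d = (τ : ℤ) * (Fintype.card F - 1) * scale F (Fin m → F) k then
        (Fintype.card F : ℚ) ^ (2 * k)
      else if d = -(τ : ℤ) * scale F (Fin m → F) k then
        (Fintype.card F - 1) * (Fintype.card F : ℚ) ^ (2 * k)
      else 0 := by
  have hq := card_ne_zero' (F := F)
  have hq1 : (Fintype.card F : ℚ) - 1 ≠ 0 := by
    have := one_lt_card' (F := F); linarith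
  have hX := scale_ne_zero (F := F) (V := Fin m → F) k
  have hXe := scale_eq (F := F) (m := m) k
  have hτ2 : (((τ : ℤ) : ℚ)) ^ 2 = 1 := by
    rcases Int.units_eq_one_or τ with rfl | rfl <;> norm_num
  have hτ : ((τ : ℤ) : ℚ) ≠ 0 := by
    intro h0; rw [h0] at hτ2; norm_num at hτ2
  set q : ℚ := (Fintype.card F : ℚ) with hqdef
  set X := scale F (Fin m → F) k with hXdef
  set t : ℚ := ((τ : ℤ) : ℚ) with ht
  have hA : t * (q - 1) * X ≠ 0 := mul_ne_zero (mul_ne_zero hτ hq1) hX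
  have hB : -t * X ≠ 0 := mul_ne_zero (neg_ne_zero.2 hτ) hX
  have hAB : t * (q - 1) * X ≠ -t * X := by
    intro h0
    have : t * q * X = 0 := by linear_combination h0
    exact mul_ne_zero (mul_ne_zero hτ hq) hX this
  obtain ⟨h1, h2, h3⟩ := three_values
    (fun p : ((Fin m → F) →ₗ[F] F) × F => dev (fun x => Q x + p.1 x + p.2)) hA hB hAB
    (fun p => h.2 p.1 p.2)
  rw [sum_dev_affine] at h1
  rw [sum_dev_affine_sq] at h2
  rw [card_affine] at h3
  simp only [← hqdef] at h1 h2 h3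
  change 0 = (cnt Q (t * (q - 1) * X) : ℚ) * _ + (cnt Q (-t * X) : ℚ) * _ at h1
  change _ = (cnt Q (t * (q - 1) * X) : ℚ) * _ + (cnt Q (-t * X) : ℚ) * _ at h2
  change _ = (cnt Q 0 : ℚ) + (cnt Q (t * (q - 1) * X) : ℚ) + (cnt Q (-t * X) : ℚ) at h3
  have h4 : (cnt Q (-t * X) : ℚ) = (q - 1) * cnt Q (t * (q - 1) * X) := by
    have : (t * X) * ((q - 1) * cnt Q (t * (q - 1) * X) - cnt Q (-t * X)) = 0 := by
      linear_combination -h1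
    have := (mul_eq_zero.1 this).resolve_left (mul_ne_zero hτ hX)
    linear_combination -this
  have h5 : (cnt Q (t * (q - 1) * X) : ℚ) = q ^ (2 * k) := by
    rw [h4] at h2
    have h6 : (q ^ m) ^ 2 * (1 - 1 / q) =
        (q - 1) * q * X ^ 2 * cnt Q (t * (q - 1) * X) := by
      linear_combination h2 + cnt Q (t * (q - 1) * X) * (q - 1) * q * X ^ 2 * hτ2
    have h7 : (q ^ m) ^ 2 * (1 - 1 / q) = (q - 1) * q * X ^ 2 * q ^ (2 * k) := by
      rw [hXe]
      field_simp
      ring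
    rw [h7] at h6
    exact (mul_left_cancel₀ (mul_ne_zero (mul_ne_zero hq1 hq) (pow_ne_zero 2 hX)) h6).symm
  split_ifs with c1 c2 c3
  · rw [c1]
    rw [h4, h5] at h3
    linear_combination -h3
  · rw [c2, h5]
  · rw [c3, h4, h5]
  · rw [cnt_eq_zero]
    · simp
    · rintro L c rfl
      rcases h.2 L c with h0 | h0 | h0
      · exact c1 h0
      · exact c2 h0
      · exact c3 h0

/-- As in even rank, except that the vanishing first moment now makes the two opposite deviations
equally frequent. -/
lemma OddDev.cnt_eq {Q : QuadraticForm F (Fin m → F)} {k : ℕ} (h : OddDev Q k) (d : ℚ) :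
    (cnt Q d : ℚ) = if d = 0 then
        (Fintype.card F : ℚ) ^ (m + 1) -
          (Fintype.card F - 1) * (Fintype.card F : ℚ) ^ (2 * k + 1)
      else if d = scale F (Fin m → F) k ∨ d = -scale F (Fin m → F) k then
        (Fintype.card F - 1) / 2 * (Fintype.card F : ℚ) ^ (2 * k + 1)
      else 0 := by
  have hq := card_ne_zero' (F := F)
  have hX := scale_ne_zero (F := F) (V := Fin m → F) k
  have hXe := scale_eq (F := F) (m := m) k
  set q : ℚ := (Fintype.card F : ℚ) with hqdef
  set X := scale F (Fin m → F) k with hXdef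
  have hB : -X ≠ 0 := neg_ne_zero.2 hX
  have hAB : X ≠ -X := by
    intro h0
    exact hX (by linarith)
  obtain ⟨h1, h2, h3⟩ := three_values
    (fun p : ((Fin m → F) →ₗ[F] F) × F => dev (fun x => Q x + p.1 x + p.2)) hX hB hAB
    (fun p => h.2 p.1 p.2)
  rw [sum_dev_affine] at h1
  rw [sum_dev_affine_sq] at h2
  rw [card_affine] at h3
  simp only [← hqdef] at h1 h2 h3
  change 0 = (cnt Q X : ℚ) * _ + (cnt Q (-X) : ℚ) * _ at h1
  change _ = (cnt Q X : ℚ) * _ + (cnt Q (-X) : ℚ) * _ at h2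
  change _ = (cnt Q 0 : ℚ) + (cnt Q X : ℚ) + (cnt Q (-X) : ℚ) at h3
  have h4 : (cnt Q (-X) : ℚ) = cnt Q X := by
    have : X * (cnt Q X - cnt Q (-X)) = 0 := by linear_combination -h1
    have := (mul_eq_zero.1 this).resolve_left hX
    linear_combination -this
  have h5 : (cnt Q X : ℚ) = (q - 1) / 2 * q ^ (2 * k + 1) := by
    rw [h4] at h2
    have h7 : (q ^ m) ^ 2 * (1 - 1 / q) = 2 * X ^ 2 * ((q - 1) / 2 * q ^ (2 * k + 1)) := by
      rw [hXe]
      field_simp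
      ring
    have h6 : 2 * X ^ 2 * (cnt Q X : ℚ) = 2 * X ^ 2 * ((q - 1) / 2 * q ^ (2 * k + 1)) := by
      rw [← h7, h2]; ring
    exact mul_left_cancel₀ (mul_ne_zero two_ne_zero (pow_ne_zero 2 hX)) h6
  split_ifs with c1 c2
  · rw [c1]
    rw [h4, h5] at h3
    linear_combination -h3
  · rcases c2 with c2 | c2
    · rw [c2, h5]
    · rw [c2, h4, h5]
  · rw [cnt_eq_zero]
    · simp
    · rintro L c rfl
      rcases h.2 L c with h0 | h0 | h0
      · exact c1 h0
      · exact c2 (Or.inl h0)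
      · exact c2 (Or.inr h0)

end Counting

/-! ### Quadratic forms in one more variable. -/

section Extension

variable {F : Type*} [Field F] {m : ℕ}

variable (F m) in
/-- The embedding `x ↦ (0, x)`. -/
def consZero : (Fin m → F) →ₗ[F] (Fin (m + 1) → F) where
  toFun x := Fin.cons 0 x
  map_add' x y := by
    funext i
    refine Fin.cases ?_ (fun i => ?_) i <;> simp
  map_smul' a x := by
    funext i
    refine Fin.cases ?_ (fun i => ?_) i <;> simp

lemma consZero_apply (x : Fin m → F) : consZero F m x = Fin.cons 0 x := rfl

lemma consZero_injective : Function.Injective (consZero F m) := fun x y h => by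
  funext i
  have := congr_fun h i.succ
  simpa [consZero_apply] using this

/-- The form `(t, x) ↦ Q x + t L x + a t²`. -/
def extend (Q : QuadraticForm F (Fin m → F)) (L : (Fin m → F) →ₗ[F] F) (a : F) :
    QuadraticForm F (Fin (m + 1) → F) :=
  Q.comp (LinearMap.funLeft F F Fin.succ) +
    linMulLin (LinearMap.proj 0) (L ∘ₗ LinearMap.funLeft F F Fin.succ) +
    a • linMulLin (LinearMap.proj 0) (LinearMap.proj 0)

lemma extend_apply (Q : QuadraticForm F (Fin m → F)) (L : (Fin m → F) →ₗ[F] F) (a : F)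
    (y : Fin (m + 1) → F) :
    extend Q L a y = Q (Fin.tail y) + y 0 * L (Fin.tail y) + a * y 0 ^ 2 := by
  rw [pow_two]
  rfl

lemma extend_cons (Q : QuadraticForm F (Fin m → F)) (L : (Fin m → F) →ₗ[F] F) (a t : F)
    (x : Fin m → F) :
    extend Q L a (Fin.cons t x : Fin (m + 1) → F) = Q x + t * L x + a * t ^ 2 := by
  rw [extend_apply]
  simp

lemma tail_add (x y : Fin (m + 1) → F) : Fin.tail (x + y) = Fin.tail x + Fin.tail y := rfl

/-- Q is the restriction to t = 0, L the polar pairing with the first basis vector, and a the value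
there. -/
lemma extend_bijective : Function.Bijective
    (fun p : QuadraticForm F (Fin m → F) × (((Fin m → F) →ₗ[F] F) × F) =>
      extend p.1 p.2.1 p.2.2) := by
  constructor
  · rintro ⟨Q, L, a⟩ ⟨Q', L', a'⟩ h
    have h1 : ∀ t x, Q x + t * L x + a * t ^ 2 = Q' x + t * L' x + a' * t ^ 2 := by
      intro t x
      have := DFunLike.congr_fun h (Fin.cons t x : Fin (m + 1) → F)
      simpa only [extend_cons] using this
    have hQ : Q = Q' := by
      ext x
      have := h1 0 x
      simpa using this
    subst hQ
    have ha : a = a' := by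
      have := h1 1 0
      simpa using this
    subst ha
    have hL : L = L' := by
      refine LinearMap.ext fun x => ?_
      have := h1 1 x
      simpa using this
    rw [hL]
  · intro Q
    refine ⟨⟨Q.comp (consZero F m), Q.polarBilin (Pi.single 0 1) ∘ₗ consZero F m,
      Q (Pi.single 0 1)⟩, ?_⟩
    ext y
    have hy : y = y 0 • Pi.single 0 1 + consZero F m (Fin.tail y) := by
      funext i
      refine Fin.cases ?_ (fun i => ?_) i
      · simp [consZero_apply]
      · simp [consZero_apply, Fin.tail]
    conv_rhs => rw [hy, apply_add_polarBilin, QuadraticMap.map_smul, map_smul,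
      LinearMap.smul_apply]
    rw [extend_apply]
    simp only [QuadraticMap.comp_apply, LinearMap.comp_apply, smul_eq_mul]
    ring

lemma tail_mem_radical {Q : QuadraticForm F (Fin m → F)} {L : (Fin m → F) →ₗ[F] F} {a : F}
    {y : Fin (m + 1) → F} (hy : y ∈ (extend Q L a).radical) (h0 : y 0 = 0) :
    Fin.tail y ∈ Q.radical ∧ L (Fin.tail y) = 0 := by
  obtain ⟨h1, h2⟩ := mem_radical_iff'.1 hy
  have hQ : Q (Fin.tail y) = 0 := by
    rw [extend_apply, h0] at h1
    simpa using h1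
  refine ⟨mem_radical_iff'.2 ⟨hQ, fun x => ?_⟩, ?_⟩
  · have := h2 (Fin.cons 0 x)
    rw [extend_cons, extend_apply, tail_add, Pi.add_apply, h0] at this
    simpa using this
  · have := h2 (Fin.cons 1 0)
    rw [extend_cons, extend_apply, tail_add, Pi.add_apply, h0] at this
    simpa [hQ] using this

lemma cons_mem_radical {Q : QuadraticForm F (Fin m → F)} {L : (Fin m → F) →ₗ[F] F} {a : F}
    {x : Fin m → F} (hx : x ∈ Q.radical) (hL : L x = 0) :
    consZero F m x ∈ (extend Q L a).radical := by
  obtain ⟨h1, h2⟩ := mem_radical_iff'.1 hx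
  rw [consZero_apply]
  refine mem_radical_iff'.2 ⟨?_, fun n => ?_⟩
  · rw [extend_cons, h1]; ring
  · rw [extend_apply, extend_apply, tail_add, Fin.tail_cons, h2, map_add, hL]
    simp

lemma eq_consZero_tail {y : Fin (m + 1) → F} (h : y 0 = 0) : y = consZero F m (Fin.tail y) := by
  rw [consZero_apply, ← h, Fin.cons_self_tail]

variable [Fintype F] [DecidableEq F]

/-- Pairing with an r in the radical where L r ≠ 0 forces t = 0 on the new radical, which becomes
the kernel of L on the old one. The radical loses one dimension while the space gains one. -/
lemma quadRank_extend_of_ne {Q : QuadraticForm F (Fin m → F)} {L : (Fin m → F) →ₗ[F] F}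
    (hL : ¬ Q.radical ≤ L.ker) (a : F) : quadRank (extend Q L a) = quadRank Q + 2 := by
  obtain ⟨r, hr, hLr⟩ := SetLike.not_le_iff_exists.1 hL
  rw [LinearMap.mem_ker] at hLr
  have h1 : (extend Q L a).radical =
      ((L.domRestrict Q.radical).ker.map (consZero F m ∘ₗ Q.radical.subtype)) := by
    ext y
    constructor
    · intro hy
      have hy0 : y 0 = 0 := by
        obtain ⟨h1, h2⟩ := mem_radical_iff'.1 hy
        obtain ⟨h3, h4⟩ := mem_radical_iff'.1 hr
        have h5 := h2 (Fin.cons 0 r)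
        have h6 : Q (Fin.tail y + r) = Q (Fin.tail y) := by rw [add_comm, h4]
        rw [extend_cons, extend_apply, tail_add, Pi.add_apply, Fin.tail_cons, h6, h3] at h5
        rw [extend_apply] at h1
        simp only [Fin.cons_zero, map_add] at h5
        have : y 0 * L r = 0 := by linear_combination h5 - h1
        exact (mul_eq_zero.1 this).resolve_right hLr
      obtain ⟨h1, h2⟩ := tail_mem_radical hy hy0
      exact ⟨⟨Fin.tail y, h1⟩, h2, (eq_consZero_tail hy0).symm⟩
    · rintro ⟨⟨x, hx⟩, hLx, rfl⟩
      exact cons_mem_radical hx hLx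
  have hinj : Function.Injective (consZero F m ∘ₗ Q.radical.subtype) :=
    consZero_injective.comp Subtype.val_injective
  have h2 := (Submodule.equivMapOfInjective _ hinj (L.domRestrict Q.radical).ker).finrank_eq
  rw [← h1] at h2
  have h3 := LinearMap.finrank_range_add_finrank_ker (L.domRestrict Q.radical)
  have h4 : (L.domRestrict Q.radical).range = ⊤ := by
    rw [LinearMap.range_eq_top]
    intro c
    refine ⟨(c * (L r)⁻¹) • ⟨r, hr⟩, ?_⟩
    simp [hLr]
  rw [h4, finrank_top, Module.finrank_self] at h3
  have h5 := finrank_radical Q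
  have h6 := finrank_radical (extend Q L a)
  omega

/-- The new radical contains a copy of the old one, which is exactly its part with t = 0; so its
dimension grows by at most 1. -/
lemma quadRank_extend_of_le {Q : QuadraticForm F (Fin m → F)} {L : (Fin m → F) →ₗ[F] F}
    (hL : Q.radical ≤ L.ker) (a : F) :
    quadRank Q ≤ quadRank (extend Q L a) ∧ quadRank (extend Q L a) ≤ quadRank Q + 1 := by
  have h5 := finrank_radical Q
  have h6 := finrank_radical (extend Q L a)
  have h1 : Q.radical.map (consZero F m) ≤ (extend Q L a).radical := by
    rintro _ ⟨x, hx, rfl⟩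
    exact cons_mem_radical hx (hL hx)
  have h2 := Submodule.finrank_mono h1
  rw [← (Submodule.equivMapOfInjective _ consZero_injective Q.radical).finrank_eq] at h2
  set W := (extend Q L a).radical with hW
  set p : W →ₗ[F] F := (LinearMap.proj (0 : Fin (m + 1))).domRestrict W with hp
  have h3 := LinearMap.finrank_range_add_finrank_ker p
  have h4 := Submodule.finrank_le p.range
  rw [Module.finrank_self] at h4
  have h7 : p.ker.map W.subtype ≤ Q.radical.map (consZero F m) := by
    rintro _ ⟨⟨y, hy⟩, hy0, rfl⟩
    have hy0 : y 0 = 0 := hy0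
    exact ⟨Fin.tail y, (tail_mem_radical hy hy0).1, (eq_consZero_tail hy0).symm⟩
  have h8 := Submodule.finrank_mono h7
  rw [← (Submodule.equivMapOfInjective _ consZero_injective Q.radical).finrank_eq,
    ← (Submodule.equivMapOfInjective _ W.subtype_injective p.ker).finrank_eq] at h8
  omega

lemma delta_sq_mul {t : F} (ht : t ≠ 0) (c : F) : delta (t ^ 2 * c) = delta c := by
  simp [delta, ht]

/-- The slice t = 0 gives `dev Q`. In each of the q - 1 other slices the substitution x ↦ t x pulls
out a factor t², which does not affect zeros. -/
lemma dev_extend (Q : QuadraticForm F (Fin m → F)) (L : (Fin m → F) →ₗ[F] F) (a : F) :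
    dev (extend Q L a) = dev Q + (Fintype.card F - 1) * dev (fun x => Q x + L x + a) := by
  have h1 : dev (extend Q L a) = ∑ t : F, ∑ x, delta (Q x + t * L x + a * t ^ 2) := by
    rw [dev, ← Fintype.sum_prod_type' (fun (t : F) x => delta (Q x + t * L x + a * t ^ 2))]
    refine (Fintype.sum_equiv (Fin.consEquiv fun _ : Fin (m + 1) => F) _ _ fun p => ?_).symm
    congr 1
    exact (extend_cons Q L a p.1 p.2).symm
  have h2 : ∀ t ∈ Finset.univ.erase (0 : F), ∑ x, delta (Q x + t * L x + a * t ^ 2) =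
      dev (fun x => Q x + L x + a) := by
    intro t ht
    have ht : t ≠ 0 := Finset.ne_of_mem_erase ht
    symm
    refine Fintype.sum_equiv (LinearEquiv.smulOfNeZero F (Fin m → F) t ht).toEquiv _ _ fun x => ?_
    rw [← delta_sq_mul ht]
    congr 1
    change _ = Q (t • x) + t * L (t • x) + a * t ^ 2
    rw [QuadraticMap.map_smul, map_smul]
    simp only [smul_eq_mul]
    ring
  rw [h1, ← Finset.add_sum_erase _ _ (Finset.mem_univ (0 : F)), Finset.sum_congr rfl h2]
  have h3 : ((Fintype.card F - 1 : ℕ) : ℚ) = Fintype.card F - 1 := by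
    rw [Nat.cast_sub Fintype.card_pos, Nat.cast_one]
  simp [dev, Finset.card_erase_of_mem, h3]

end Extension

/-! ### Recursions in m for the numbers of forms. -/

section Recursion

variable {F : Type*} [Field F] [Fintype F] [DecidableEq F] {m : ℕ}

lemma scale_succ_succ (k : ℕ) :
    scale F (Fin (m + 1) → F) (k + 1) = scale F (Fin m → F) k := by
  have hq := card_ne_zero' (F := F)
  rw [scale_eq, scale_eq]
  field_simp
  ring

lemma card_mul_scale_succ (k : ℕ) :
    (Fintype.card F : ℚ) * scale F (Fin m → F) (k + 1) = scale F (Fin m → F) k := by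
  have hq := card_ne_zero' (F := F)
  rw [scale_eq, scale_eq]
  field_simp
  ring

lemma scale_pos (k : ℕ) : 0 < scale F (Fin m → F) k := by
  have hq : (0 : ℚ) < Fintype.card F := lt_trans one_pos one_lt_card'
  rw [scale_eq]
  positivity

lemma scale_inj {i k : ℕ} (h : scale F (Fin m → F) i = scale F (Fin m → F) k) : i = k := by
  have hq := card_ne_zero' (F := F)
  have h1 := pow_ne_zero m hq
  rw [scale_eq, scale_eq, div_eq_div_iff (pow_ne_zero _ hq) (pow_ne_zero _ hq)] at h
  have h2 : Fintype.card F ^ (k + 1) = Fintype.card F ^ (i + 1) := by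
    exact_mod_cast mul_left_cancel₀ h1 h
  have := Nat.pow_right_injective Fintype.one_lt_card h2
  omega

lemma unit_mul_scale_inj {i k : ℕ} {σ τ : ℤˣ} :
    ((σ : ℤ) : ℚ) * scale F (Fin m → F) i = ((τ : ℤ) : ℚ) * scale F (Fin m → F) k ↔
      i = k ∧ σ = τ := by
  constructor
  · intro h
    have hi := scale_pos (F := F) (m := m) i
    have hk := scale_pos (F := F) (m := m) k
    rcases Int.units_eq_one_or σ with rfl | rfl <;> rcases Int.units_eq_one_or τ with rfl | rfl <;>
      push_cast at h
    · exact ⟨scale_inj (by linarith), rfl⟩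
    · exfalso; linarith
    · exfalso; linarith
    · exact ⟨scale_inj (by linarith), rfl⟩
  · rintro ⟨rfl, rfl⟩; rfl

lemma card_sub_one_ne_zero : (Fintype.card F : ℚ) - 1 ≠ 0 := by
  have := one_lt_card' (F := F); linarith

lemma unit_ne_zero (τ : ℤˣ) : ((τ : ℤ) : ℚ) ≠ 0 := by
  rcases Int.units_eq_one_or τ with rfl | rfl <;> norm_num

/-- The values τ(q-1)X_k are nonzero and pairwise distinct, whereas odd rank has deviation 0. Hence
rank and type in even rank can be read off from one number. -/
lemma quadRank_hasType_iff (Q : QuadraticForm F (Fin m → F)) (k : ℕ) (τ : ℤˣ) :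
    (quadRank Q = 2 * k ∧ HasType Q τ) ↔
      dev Q = ((τ : ℤ) : ℚ) * (Fintype.card F - 1) * scale F (Fin m → F) k := by
  constructor
  · rintro ⟨h1, h2⟩
    exact h2.dev_eq h1
  · intro h
    have hq := card_sub_one_ne_zero (F := F)
    rcases evenDev_or_oddDev Q with ⟨i, -, hi, -⟩ | ⟨i, hi, σ, hσ, h1, -⟩
    · rw [hi] at h
      exact absurd h.symm
        (mul_ne_zero (mul_ne_zero (unit_ne_zero τ) hq) (scale_pos k).ne')
    · rw [h1] at h
      have h2 : ((σ : ℤ) : ℚ) * scale F (Fin m → F) i = ((τ : ℤ) : ℚ) * scale F (Fin m → F) k :=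
        mul_left_cancel₀ hq (by linear_combination h)
      obtain ⟨rfl, rfl⟩ := unit_mul_scale_inj.1 h2
      exact ⟨hi, hσ⟩

lemma odd_quadRank_iff (Q : QuadraticForm F (Fin m → F)) : Odd (quadRank Q) ↔ dev Q = 0 := by
  rcases evenDev_or_oddDev Q with ⟨i, hi, h, -⟩ | ⟨i, hi, σ, -, h, -⟩
  · simp [h, hi]
  · have h1 : dev Q ≠ 0 := by
      rw [h]
      exact mul_ne_zero (mul_ne_zero (unit_ne_zero σ) card_sub_one_ne_zero) (scale_pos i).ne'
    simp [h1, hi]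

lemma ncard_setOf_eq_sum {α : Type*} [Fintype α] (p : α → Prop) [DecidablePred p] :
    ((Set.ncard {x | p x} : ℕ) : ℚ) = ∑ x, if p x then 1 else 0 := by
  rw [Finset.sum_boole, ← Nat.card_coe_set_eq, Nat.card_eq_fintype_card, Fintype.card_subtype]
  simp

lemma cnt_eq_sum (Q : QuadraticForm F (Fin m → F)) (d : ℚ) :
    (cnt Q d : ℚ) = ∑ p : ((Fin m → F) →ₗ[F] F) × F,
      if dev (fun x => Q x + p.1 x + p.2) = d then 1 else 0 := by
  rw [Finset.sum_boole, cnt]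

lemma sum_extend (g : QuadraticForm F (Fin (m + 1) → F) → ℚ) :
    ∑ Q, g Q = ∑ Q : QuadraticForm F (Fin m → F), ∑ p : ((Fin m → F) →ₗ[F] F) × F,
      g (extend Q p.1 p.2) := by
  rw [← Fintype.sum_prod_type' (fun (Q : QuadraticForm F (Fin m → F))
    (p : ((Fin m → F) →ₗ[F] F) × F) => g (extend Q p.1 p.2))]
  exact (extend_bijective.sum_comp g).symm

open Classical in
/-- The number of extensions of a given form that have rank `2 k + 2` and type `τ`. -/
lemma sum_extend_hasType (Q : QuadraticForm F (Fin m → F)) (k : ℕ) (τ : ℤˣ) :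
    ∑ p : ((Fin m → F) →ₗ[F] F) × F,
      (if quadRank (extend Q p.1 p.2) = 2 * (k + 1) ∧ HasType (extend Q p.1 p.2) τ
        then (1 : ℚ) else 0) =
      (Fintype.card F : ℚ) ^ (2 * k + 2) *
          (if quadRank Q = 2 * (k + 1) ∧ HasType Q τ then 1 else 0) +
        (Fintype.card F - 1) / 2 * (Fintype.card F : ℚ) ^ (2 * k + 1) *
          (if quadRank Q = 2 * k + 1 then 1 else 0) +
        ((Fintype.card F : ℚ) ^ (m + 1) - (Fintype.card F : ℚ) ^ (2 * k + 1)) *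
          (if quadRank Q = 2 * k ∧ HasType Q τ then 1 else 0) := by
  have hq := card_ne_zero' (F := F)
  have hq1 := card_sub_one_ne_zero (F := F)
  -- X_(k+1) in dimension m + 1 equals X_k in dimension m, so the condition prescribes the deviation
  -- of Q + L + a.
  have h1 : ∀ p : ((Fin m → F) →ₗ[F] F) × F,
      (quadRank (extend Q p.1 p.2) = 2 * (k + 1) ∧ HasType (extend Q p.1 p.2) τ) ↔
        dev (fun x => Q x + p.1 x + p.2) =
          ((τ : ℤ) : ℚ) * scale F (Fin m → F) k - dev Q / (Fintype.card F - 1) := by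
    intro p
    rw [quadRank_hasType_iff, dev_extend, scale_succ_succ]
    constructor
    · intro h
      field_simp
      linear_combination h
    · intro h
      rw [h]
      field_simp
      ring
  simp only [h1, ← cnt_eq_sum]
  rcases evenDev_or_oddDev Q with ⟨i, hi, h⟩ | ⟨i, hi, σ, hσ, h⟩
  · have e1 : ¬ (quadRank Q = 2 * (k + 1) ∧ HasType Q τ) := fun h' => by omega
    have e2 : ¬ (quadRank Q = 2 * k ∧ HasType Q τ) := fun h' => by omega
    rw [if_neg e1, if_neg e2, h.cnt_eq, h.1, zero_div, sub_zero,
      if_neg (mul_ne_zero (unit_ne_zero τ) (scale_pos k).ne')]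
    have e3 : (((τ : ℤ) : ℚ) * scale F (Fin m → F) k = scale F (Fin m → F) i ∨
        ((τ : ℤ) : ℚ) * scale F (Fin m → F) k = -scale F (Fin m → F) i) ↔
        quadRank Q = 2 * k + 1 := by
      have a1 := unit_mul_scale_inj (F := F) (m := m) (i := k) (k := i) (σ := τ) (τ := 1)
      have a2 := unit_mul_scale_inj (F := F) (m := m) (i := k) (k := i) (σ := τ) (τ := -1)
      push_cast at a1 a2
      rw [one_mul] at a1
      rw [neg_one_mul] at a2
      rw [a1, a2, hi]
      rcases Int.units_eq_one_or τ with rfl | rfl <;> constructor <;> intro h <;> simp at h ⊢ <;>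
        omega
    simp only [e3]
    split_ifs with h4
    · obtain rfl : i = k := by omega
      ring
    · ring
  · have e0 : ¬ (quadRank Q = 2 * k + 1) := by omega
    -- For Q of rank 2i and type σ the prescribed deviation is τX_k - σX_i. It is 0 for the same
    -- rank and type, equals σ(q-1)X_i when σ = τ and i = k + 1 because qX_(k+1) = X_k, and is never
    -- -σX_i.
    have c1 : (((τ : ℤ) : ℚ) * scale F (Fin m → F) k - dev Q / (Fintype.card F - 1) = 0) ↔
        (quadRank Q = 2 * k ∧ HasType Q τ) := by
      rw [quadRank_hasType_iff, sub_eq_zero, eq_div_iff hq1]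
      constructor <;> intro h <;> linear_combination -h
    have c2 : (((τ : ℤ) : ℚ) * scale F (Fin m → F) k - dev Q / (Fintype.card F - 1) =
        ((σ : ℤ) : ℚ) * (Fintype.card F - 1) * scale F (Fin m → F) i) ↔
        (quadRank Q = 2 * (k + 1) ∧ HasType Q τ) := by
      rw [quadRank_hasType_iff, h.1]
      have : ((σ : ℤ) : ℚ) * (Fintype.card F - 1) * scale F (Fin m → F) i /
          ((Fintype.card F : ℚ) - 1) = ((σ : ℤ) : ℚ) * scale F (Fin m → F) i := by
        field_simp
      rw [this, ← card_mul_scale_succ]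
      constructor
      · intro h
        have h2 : ((σ : ℤ) : ℚ) * scale F (Fin m → F) i =
            ((τ : ℤ) : ℚ) * scale F (Fin m → F) (k + 1) :=
          mul_left_cancel₀ hq (by linear_combination -h)
        linear_combination ((Fintype.card F : ℚ) - 1) * h2
      · intro h
        have h2 : ((σ : ℤ) : ℚ) * scale F (Fin m → F) i =
            ((τ : ℤ) : ℚ) * scale F (Fin m → F) (k + 1) :=
          mul_left_cancel₀ hq1 (by linear_combination h)
        linear_combination (-(Fintype.card F : ℚ)) * h2
    have c3 : ((τ : ℤ) : ℚ) * scale F (Fin m → F) k - dev Q / (Fintype.card F - 1) ≠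
        -((σ : ℤ) : ℚ) * scale F (Fin m → F) i := by
      rw [h.1]
      have : ((σ : ℤ) : ℚ) * (Fintype.card F - 1) * scale F (Fin m → F) i /
          ((Fintype.card F : ℚ) - 1) = ((σ : ℤ) : ℚ) * scale F (Fin m → F) i := by
        field_simp
      rw [this]
      intro h
      exact mul_ne_zero (unit_ne_zero τ) (scale_pos (F := F) (m := m) k).ne'
        (by linear_combination h)
    rw [h.cnt_eq, if_neg e0]
    simp only [c1, c2, if_neg c3]
    by_cases b1 : quadRank Q = 2 * k ∧ HasType Q τ
    · have b2 : ¬ (quadRank Q = 2 * (k + 1) ∧ HasType Q τ) := fun h' => by omega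
      rw [if_pos b1, if_neg b2, if_pos b1]
      obtain rfl : i = k := by omega
      ring
    · rw [if_neg b1, if_neg b1]
      split_ifs with b2
      · obtain rfl : i = k + 1 := by omega
        ring
      · ring

/-- The functionals killing the radical form its annihilator, of dimension the rank of Q. -/
lemma sum_not_radical_le_ker (Q : QuadraticForm F (Fin m → F)) [∀ L : (Fin m → F) →ₗ[F] F,
    Decidable (Q.radical ≤ L.ker)] :
    ∑ p : ((Fin m → F) →ₗ[F] F) × F, (if ¬ Q.radical ≤ p.1.ker then (1 : ℚ) else 0) =
      (Fintype.card F : ℚ) ^ (m + 1) - (Fintype.card F : ℚ) ^ (quadRank Q + 1) := by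
  have h1 : ∑ L : (Fin m → F) →ₗ[F] F, (if Q.radical ≤ L.ker then (1 : ℚ) else 0) =
      (Fintype.card F : ℚ) ^ quadRank Q := by
    rw [← ncard_setOf_eq_sum]
    have h2 : {L : (Fin m → F) →ₗ[F] F | Q.radical ≤ L.ker} =
        (Q.radical.dualAnnihilator : Set (Module.Dual F (Fin m → F))) := by
      ext L
      rw [SetLike.mem_coe, Submodule.mem_dualAnnihilator]
      rfl
    have h3 := Subspace.finrank_add_finrank_dualAnnihilator_eq Q.radical
    rw [Module.finrank_fin_fun] at h3
    have h4 := finrank_radical Q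
    have h5 : Nat.card Q.radical.dualAnnihilator =
        Nat.card F ^ Module.finrank F Q.radical.dualAnnihilator :=
      Module.natCard_eq_pow_finrank (K := F) (V := Q.radical.dualAnnihilator)
    rw [h2, ← Nat.card_coe_set_eq]
    rw [show Module.finrank F Q.radical.dualAnnihilator = quadRank Q by omega,
      Nat.card_eq_fintype_card (α := F)] at h5
    exact_mod_cast h5
  have h2 : ∀ p : ((Fin m → F) →ₗ[F] F) × F, (if ¬ Q.radical ≤ p.1.ker then (1 : ℚ) else 0) =
      1 - if Q.radical ≤ p.1.ker then (1 : ℚ) else 0 := by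
    intro p
    split_ifs <;> simp_all
  simp only [h2, Finset.sum_sub_distrib]
  rw [Fintype.sum_prod_type' (fun (L : (Fin m → F) →ₗ[F] F) (_ : F) =>
    if Q.radical ≤ L.ker then (1 : ℚ) else 0)]
  simp only [Finset.sum_const, Finset.card_univ, nsmul_eq_mul, mul_one, card_affine,
    ← Finset.mul_sum, h1]
  ring

open Classical in
/-- The number of extensions of a given form that have rank `2 j + 1`. -/
lemma sum_extend_quadRank (Q : QuadraticForm F (Fin m → F)) (j : ℕ) :
    ∑ p : ((Fin m → F) →ₗ[F] F) × F,
      (if quadRank (extend Q p.1 p.2) = 2 * j + 1 then (1 : ℚ) else 0) =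
      (Fintype.card F : ℚ) ^ (2 * j + 1) * (if quadRank Q = 2 * j + 1 then 1 else 0) +
        (Fintype.card F - 1) * (Fintype.card F : ℚ) ^ (2 * j) *
          (if quadRank Q = 2 * j then 1 else 0) +
        ((Fintype.card F : ℚ) ^ (m + 1) - (Fintype.card F : ℚ) ^ (2 * j)) *
          (if quadRank Q + 2 = 2 * j + 1 then 1 else 0) := by
  have hq := card_ne_zero' (F := F)
  have hq1 := card_sub_one_ne_zero (F := F)
  have hodd : ∀ p : ((Fin m → F) →ₗ[F] F) × F, Odd (quadRank (extend Q p.1 p.2)) ↔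
      dev (fun x => Q x + p.1 x + p.2) = -(dev Q / (Fintype.card F - 1)) := by
    intro p
    rw [odd_quadRank_iff, dev_extend]
    constructor
    · intro h
      field_simp
      linear_combination h
    · intro h
      rw [h]
      field_simp
      ring
  -- The new rank is r, r + 1 or r + 2; its parity, read off from the deviation, together with
  -- whether L kills the radical determines it.
  have hcases : ∀ p : ((Fin m → F) →ₗ[F] F) × F,
      (¬ Q.radical ≤ p.1.ker ∧ quadRank (extend Q p.1 p.2) = quadRank Q + 2) ∨
      (Q.radical ≤ p.1.ker ∧ (quadRank (extend Q p.1 p.2) = quadRank Q ∨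
        quadRank (extend Q p.1 p.2) = quadRank Q + 1)) := by
    intro p
    by_cases h : Q.radical ≤ p.1.ker
    · have := quadRank_extend_of_le h p.2
      exact Or.inr ⟨h, by omega⟩
    · exact Or.inl ⟨h, quadRank_extend_of_ne h p.2⟩
  rcases evenDev_or_oddDev Q with ⟨i, hi, h⟩ | ⟨i, hi, σ, hσ, h⟩
  · rw [if_neg (show ¬ quadRank Q = 2 * j by omega)]
    by_cases hij : i = j
    · subst hij
      rw [if_pos hi, if_neg (by omega)]
      -- From odd rank, the rank is kept exactly by the extensions of odd rank that do not jump by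
      -- two.
      have h1 : ∀ p : ((Fin m → F) →ₗ[F] F) × F,
          (if quadRank (extend Q p.1 p.2) = 2 * i + 1 then (1 : ℚ) else 0) =
          (if dev (fun x => Q x + p.1 x + p.2) = 0 then 1 else 0) -
            if ¬ Q.radical ≤ p.1.ker then 1 else 0 := by
        intro p
        have e1 := hodd p
        rw [h.1, zero_div, neg_zero] at e1
        simp only [← e1]
        rcases hcases p with ⟨c1, c2⟩ | ⟨c1, c2 | c2⟩
        · rw [if_neg (by omega), if_pos (by rw [c2, hi]; exact ⟨i + 1, by ring⟩), if_pos c1]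
          ring
        · rw [if_pos (by omega), if_pos (by rw [c2, hi]; exact ⟨i, by ring⟩),
            if_neg (not_not.2 c1)]
          ring
        · rw [if_neg (by omega), if_neg (by rw [c2, hi, Nat.not_odd_iff_even]; exact ⟨i + 1, by ring⟩),
            if_neg (not_not.2 c1)]
          ring
      simp only [h1, Finset.sum_sub_distrib]
      rw [sum_not_radical_le_ker, ← cnt_eq_sum, h.cnt_eq, if_pos rfl, hi]
      ring
    · rw [if_neg (by omega)]
      by_cases hij' : j = i + 1
      · rw [if_pos (by omega)]
        have h1 : ∀ p : ((Fin m → F) →ₗ[F] F) × F,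
            (if quadRank (extend Q p.1 p.2) = 2 * j + 1 then (1 : ℚ) else 0) =
              if ¬ Q.radical ≤ p.1.ker then 1 else 0 := by
          intro p
          rcases hcases p with ⟨c1, c2⟩ | ⟨c1, c2⟩
          · rw [if_pos (by omega), if_pos c1]
          · rw [if_neg (by omega), if_neg (not_not.2 c1)]
        simp only [h1]
        rw [sum_not_radical_le_ker, hi, hij']
        ring
      · rw [if_neg (by omega)]
        rw [Finset.sum_eq_zero]
        · ring
        · intro p _
          have e1 := hodd p
          rcases hcases p with ⟨c1, c2⟩ | ⟨c1, c2 | c2⟩ <;> rw [if_neg (by omega)]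
  · rw [if_neg (show ¬ quadRank Q = 2 * j + 1 by omega),
      if_neg (show ¬ quadRank Q + 2 = 2 * j + 1 by omega)]
    by_cases hij : i = j
    · subst hij
      rw [if_pos hi]
      -- From rank 2i the only odd rank within reach is 2i + 1, so parity alone decides.
      have h1 : ∀ p : ((Fin m → F) →ₗ[F] F) × F,
          quadRank (extend Q p.1 p.2) = 2 * i + 1 ↔
          dev (fun x => Q x + p.1 x + p.2) = -((σ : ℤ) : ℚ) * scale F (Fin m → F) i := by
        intro p
        have e1 := hodd p
        rw [h.1] at e1
        have e2 : -(((σ : ℤ) : ℚ) * (Fintype.card F - 1) * scale F (Fin m → F) i /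
          ((Fintype.card F : ℚ) - 1)) = -((σ : ℤ) : ℚ) * scale F (Fin m → F) i := by
          field_simp
        rw [← e2, ← e1]
        constructor
        · intro h; exact ⟨i, h⟩
        · rintro ⟨l, hl⟩
          rcases hcases p with ⟨c1, c2⟩ | ⟨c1, c2 | c2⟩ <;> omega
      simp only [h1, ← cnt_eq_sum]
      have hX := (scale_pos (F := F) (m := m) i).ne'
      have hσ0 := unit_ne_zero σ
      rw [h.cnt_eq, if_neg (mul_ne_zero (neg_ne_zero.2 hσ0) hX), if_neg, if_pos rfl]
      · ring
      · intro h
        exact mul_ne_zero (mul_ne_zero hσ0 hq) hX (by linear_combination -h)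
    · rw [if_neg (by omega), Finset.sum_eq_zero]
      · ring
      · intro p _
        rcases hcases p with ⟨c1, c2⟩ | ⟨c1, c2 | c2⟩ <;> rw [if_neg (by omega)]

lemma vRank_eq_sum (r : ℕ) : (vRank F m r : ℚ) =
    ∑ Q : QuadraticForm F (Fin m → F), if quadRank Q = r then 1 else 0 :=
  ncard_setOf_eq_sum _

open Classical in
lemma vRankType_eq_sum (r : ℕ) (τ : ℤˣ) : (vRankType F m r τ : ℚ) =
    ∑ Q : QuadraticForm F (Fin m → F), if quadRank Q = r ∧ HasType Q τ then 1 else 0 :=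
  ncard_setOf_eq_sum _

lemma vRank_even (k : ℕ) :
    (vRank F m (2 * k) : ℚ) = vRankType F m (2 * k) 1 + vRankType F m (2 * k) (-1) := by
  classical
  rw [vRank_eq_sum, vRankType_eq_sum, vRankType_eq_sum, ← Finset.sum_add_distrib]
  refine Finset.sum_congr rfl fun Q _ => ?_
  simp only [quadRank_hasType_iff]
  have hX := scale_pos (F := F) (m := m) k
  have hq1 : (0 : ℚ) < Fintype.card F - 1 := by have := one_lt_card' (F := F); linarith
  have hp := mul_pos hq1 hX
  by_cases hk : quadRank Q = 2 * k
  · rw [if_pos hk]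
    rcases evenDev_or_oddDev Q with ⟨i, hi, h⟩ | ⟨i, hi, σ, hσ, h⟩
    · omega
    · obtain rfl : i = k := by omega
      rw [h.1]
      rcases Int.units_eq_one_or σ with rfl | rfl
      · rw [if_pos rfl, if_neg]
        · ring
        · push_cast; intro h; linarith
      · rw [if_neg, if_pos rfl]
        · ring
        · push_cast; intro h; linarith
  · rw [if_neg hk, if_neg, if_neg]
    · ring
    · rw [← quadRank_hasType_iff]; exact fun h => hk h.1
    · rw [← quadRank_hasType_iff]; exact fun h => hk h.1

lemma vRankType_succ (k : ℕ) (τ : ℤˣ) :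
    (vRankType F (m + 1) (2 * (k + 1)) τ : ℚ) =
      (Fintype.card F : ℚ) ^ (2 * k + 2) * vRankType F m (2 * (k + 1)) τ +
        (Fintype.card F - 1) / 2 * (Fintype.card F : ℚ) ^ (2 * k + 1) * vRank F m (2 * k + 1) +
        ((Fintype.card F : ℚ) ^ (m + 1) - (Fintype.card F : ℚ) ^ (2 * k + 1)) *
          vRankType F m (2 * k) τ := by
  classical
  simp only [vRankType_eq_sum, vRank_eq_sum, sum_extend (m := m), sum_extend_hasType,
    Finset.sum_add_distrib, ← Finset.mul_sum]

lemma vRank_odd_succ (j : ℕ) :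
    (vRank F (m + 1) (2 * (j + 1) + 1) : ℚ) =
      (Fintype.card F : ℚ) ^ (2 * j + 3) * vRank F m (2 * (j + 1) + 1) +
        (Fintype.card F - 1) * (Fintype.card F : ℚ) ^ (2 * j + 2) * vRank F m (2 * (j + 1)) +
        ((Fintype.card F : ℚ) ^ (m + 1) - (Fintype.card F : ℚ) ^ (2 * j + 2)) *
          vRank F m (2 * j + 1) := by
  simp only [vRank_eq_sum, sum_extend (m := m), sum_extend_quadRank,
    Finset.sum_add_distrib, ← Finset.mul_sum]
  have : ∀ Q : QuadraticForm F (Fin m → F), (quadRank Q + 2 = 2 * (j + 1) + 1) ↔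
      quadRank Q = 2 * j + 1 := fun Q => by omega
  simp only [this]
  ring

lemma vRank_one_succ :
    (vRank F (m + 1) 1 : ℚ) =
      (Fintype.card F : ℚ) * vRank F m 1 + (Fintype.card F - 1) * vRank F m 0 := by
  have h := fun Q : QuadraticForm F (Fin m → F) => sum_extend_quadRank Q 0
  simp only [mul_zero, zero_add, pow_one, pow_zero, mul_one] at h
  simp only [vRank_eq_sum, sum_extend (m := m), h, Finset.sum_add_distrib, ← Finset.mul_sum]
  have : ∀ Q : QuadraticForm F (Fin m → F), ¬ (quadRank Q + 2 = 1) := fun Q => by omega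
  simp [this]

lemma quadRank_eq_zero_iff (Q : QuadraticForm F (Fin m → F)) : quadRank Q = 0 ↔ Q = 0 := by
  constructor
  · intro h
    have h1 := finrank_radical Q
    have h2 : Q.radical = ⊤ := by
      apply Submodule.eq_top_of_finrank_eq
      rw [Module.finrank_fin_fun]; omega
    ext x
    have : x ∈ Q.radical := by rw [h2]; trivial
    exact (mem_radical_iff'.1 this).1
  · rintro rfl
    have h2 : (0 : QuadraticForm F (Fin m → F)).radical = ⊤ := by
      rw [eq_top_iff]
      intro x _
      exact mem_radical_iff'.2 ⟨rfl, fun y => rfl⟩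
    have h1 := finrank_radical (0 : QuadraticForm F (Fin m → F))
    rw [h2, finrank_top, Module.finrank_fin_fun] at h1
    omega

lemma vRankType_zero_one : vRankType F m 0 1 = 1 := by
  have : {Q : QuadraticForm F (Fin m → F) | quadRank Q = 0 ∧ HasType Q 1} = {0} := by
    ext Q
    simp only [Set.mem_ofPred_eq, Set.mem_singleton_iff, quadRank_eq_zero_iff]
    constructor
    · exact fun h => h.1
    · rintro rfl
      refine ⟨rfl, 0, ?_, Equivalent.refl _⟩
      rw [(quadRank_eq_zero_iff _).2 rfl]
      exact IsCanonical.zero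
  rw [vRankType, this, Set.ncard_singleton]

lemma vRank_zero : vRank F m 0 = 1 := by
  have : {Q : QuadraticForm F (Fin m → F) | quadRank Q = 0} = {0} := by
    ext Q
    simp [quadRank_eq_zero_iff]
  rw [vRank, this, Set.ncard_singleton]

/-- The factor (q^k + τ)/2 of the closed form at k = 0, which makes that formula valid there for
both signs. -/
lemma vRankType_zero (τ : ℤˣ) : (vRankType F m 0 τ : ℚ) = (1 + ((τ : ℤ) : ℚ)) / 2 := by
  have h1 := vRank_even (F := F) (m := m) 0
  rw [mul_zero, vRank_zero, vRankType_zero_one] at h1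
  rcases Int.units_eq_one_or τ with rfl | rfl
  · rw [vRankType_zero_one]; norm_num
  · push_cast at h1 ⊢
    linarith

lemma vRank_eq_zero {r : ℕ} (h : m < r) : vRank F m r = 0 := by
  have : {Q : QuadraticForm F (Fin m → F) | quadRank Q = r} = ∅ := by
    ext Q
    have := quadRank_le Q
    simp only [Set.mem_ofPred_eq, Set.mem_empty_iff_false, iff_false]
    omega
  rw [vRank, this, Set.ncard_empty]

lemma vRankType_eq_zero {r : ℕ} (h : m < r) (τ : ℤˣ) : vRankType F m r τ = 0 := by
  have : {Q : QuadraticForm F (Fin m → F) | quadRank Q = r ∧ HasType Q τ} = ∅ := by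
    ext Q
    have := quadRank_le Q
    simp only [Set.mem_ofPred_eq, Set.mem_empty_iff_false, iff_false]
    omega
  rw [vRankType, this, Set.ncard_empty]

end Recursion

/-! ### Solution of the recursions. -/

section ClosedForm

/-- The product of the `k` factors `q ^ m - 1, q ^ (m - 1) - 1, …`. -/
def qFall (q : ℚ) (m k : ℕ) : ℚ := ∏ i ∈ Finset.range k, (q ^ m / q ^ i - 1)

/-- The product of `q ^ (2 i) - 1` for `1 ≤ i ≤ j`. -/
def evenProd (q : ℚ) (j : ℕ) : ℚ := ∏ i ∈ Finset.Icc 1 j, (q ^ (2 * i) - 1)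

lemma qFall_succ (q : ℚ) (m k : ℕ) : qFall q m (k + 1) = qFall q m k * (q ^ m / q ^ k - 1) :=
  Finset.prod_range_succ _ _

lemma qFall_succ_succ {q : ℚ} (hq : q ≠ 0) (m k : ℕ) :
    qFall q (m + 1) (k + 1) = (q ^ (m + 1) - 1) * qFall q m k := by
  rw [qFall, Finset.prod_range_succ', mul_comm, pow_zero, div_one, qFall]
  congr 1
  refine Finset.prod_congr rfl fun i _ => ?_
  field_simp
  ring

lemma qFall_zero_succ (q : ℚ) (k : ℕ) : qFall q 0 (k + 1) = 0 :=
  Finset.prod_eq_zero (Finset.mem_range.2 (Nat.succ_pos k)) (by simp)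

lemma qFall_eq_prod {q : ℚ} (hq : q ≠ 0) {m k : ℕ} (hk : k ≤ m) :
    qFall q m k = ∏ i ∈ Finset.Icc (m - k + 1) m, (q ^ i - 1) := by
  refine Finset.prod_nbij' (fun i => m - i) (fun i => m - i) ?_ ?_ ?_ ?_ ?_
  · intro i hi
    rw [Finset.mem_range] at hi
    rw [Finset.mem_Icc]
    omega
  · intro i hi
    rw [Finset.mem_Icc] at hi
    rw [Finset.mem_range]
    omega
  · intro i hi
    rw [Finset.mem_range] at hi
    omega
  · intro i hi
    rw [Finset.mem_Icc] at hi
    omega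
  · intro i hi
    rw [Finset.mem_range] at hi
    rw [pow_sub₀ q hq (by omega)]
    rfl

lemma evenProd_succ (q : ℚ) (j : ℕ) :
    evenProd q (j + 1) = evenProd q j * (q ^ (2 * (j + 1)) - 1) :=
  Finset.prod_Icc_succ_top (by omega) _

lemma evenProd_ne_zero {q : ℚ} (hq : 1 < q) (j : ℕ) : evenProd q j ≠ 0 := by
  refine Finset.prod_ne_zero_iff.2 fun i hi => ?_
  have := one_lt_pow₀ hq (n := 2 * i) (by rw [Finset.mem_Icc] at hi; omega)
  linarith

variable {F : Type*} [Field F] [Fintype F] [DecidableEq F]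

/-- Induction on m for both families together, since each recursion involves the other. No bound on
k is needed: beyond m the product `qFall` contains the factor q^m/q^m - 1 = 0. -/
theorem vRank_closed_form (m : ℕ) :
    (∀ (k : ℕ) (τ : ℤˣ), (vRankType F m (2 * k) τ : ℚ) =
      (Fintype.card F : ℚ) ^ (k ^ 2) * ((Fintype.card F : ℚ) ^ k + ((τ : ℤ) : ℚ)) / 2 *
        qFall (Fintype.card F) m (2 * k) / evenProd (Fintype.card F) k) ∧
    ∀ k : ℕ, (vRank F m (2 * k + 1) : ℚ) =
      (Fintype.card F : ℚ) ^ (k ^ 2 + k) * qFall (Fintype.card F) m (2 * k + 1) /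
        evenProd (Fintype.card F) k := by
  have hq := card_ne_zero' (F := F)
  have hq1 := one_lt_card' (F := F)
  have h0 : ∀ (m : ℕ) (τ : ℤˣ), (vRankType F m (2 * 0) τ : ℚ) =
      (Fintype.card F : ℚ) ^ (0 ^ 2) * ((Fintype.card F : ℚ) ^ 0 + ((τ : ℤ) : ℚ)) / 2 *
        qFall (Fintype.card F) m (2 * 0) / evenProd (Fintype.card F) 0 := by
    intro m τ
    rw [mul_zero, vRankType_zero]
    simp [qFall, evenProd]
  induction m with
  | zero =>
    refine ⟨fun k τ => ?_, fun k => ?_⟩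
    · rcases k with _ | k
      · exact h0 0 τ
      · rw [vRankType_eq_zero (by omega), show 2 * (k + 1) = 2 * k + 1 + 1 by ring,
          qFall_zero_succ]
        simp
    · rw [vRank_eq_zero (by omega), qFall_zero_succ]
      simp
  | succ m ih =>
    obtain ⟨ih1, ih2⟩ := ih
    refine ⟨fun k τ => ?_, fun k => ?_⟩
    · rcases k with _ | k
      · exact h0 _ τ
      · rw [vRankType_succ, ih1, ih1, ih2, evenProd_succ]
        rw [show 2 * (k + 1) = 2 * k + 1 + 1 by ring, qFall_succ_succ hq, qFall_succ, qFall_succ]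
        have hE := evenProd_ne_zero hq1 k
        have hE' : (Fintype.card F : ℚ) ^ (2 * k + 1 + 1) - 1 ≠ 0 := by
          have := one_lt_pow₀ hq1 (n := 2 * k + 1 + 1) (by omega)
          linarith
        generalize (Fintype.card F : ℚ) = q at *
        generalize evenProd q k = E at *
        generalize qFall q m (2 * k) = P at *
        -- In terms of q, b = q^k, s = q^m and c = q^(k²), treated as independent quantities, the
        -- recursion becomes a rational identity.
        have e1 : q ^ ((k + 1) ^ 2) = q ^ (k ^ 2) * (q ^ k) ^ 2 * q := by ring
        have e2 : q ^ (k ^ 2 + k) = q ^ (k ^ 2) * q ^ k := by ring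
        have e3 : q ^ (2 * k + 2) = (q ^ k) ^ 2 * q ^ 2 := by ring
        have e4 : q ^ (2 * k + 1) = (q ^ k) ^ 2 * q := by ring
        have e5 : q ^ (2 * k) = (q ^ k) ^ 2 := by ring
        have e6 : q ^ (k + 1) = q ^ k * q := by ring
        have e7 : q ^ (m + 1) = q ^ m * q := by ring
        have e8 : q ^ (2 * k + 1 + 1) = (q ^ k) ^ 2 * q ^ 2 := by ring
        rw [e8] at hE'
        rw [e1, e2, e3, e4, e5, e6, e7]
        have hb : q ^ k ≠ 0 := pow_ne_zero k hq
        generalize q ^ k = b at *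
        generalize q ^ m = s at *
        generalize q ^ (k ^ 2) = c at *
        field_simp
        ring
    · rcases k with _ | k
      · rw [mul_zero, zero_add, vRank_one_succ, vRank_zero]
        have := ih2 0
        simp only [mul_zero, zero_add] at this
        rw [this]
        simp [qFall, evenProd]
        ring
      · rw [vRank_odd_succ, vRank_even, ih1, ih1, ih2, ih2, evenProd_succ]
        rw [show 2 * (k + 1) = 2 * k + 1 + 1 by ring, qFall_succ_succ hq, qFall_succ, qFall_succ]
        have hE := evenProd_ne_zero hq1 k
        have hE' : (Fintype.card F : ℚ) ^ (2 * k + 1 + 1) - 1 ≠ 0 := by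
          have := one_lt_pow₀ hq1 (n := 2 * k + 1 + 1) (by omega)
          linarith
        generalize (Fintype.card F : ℚ) = q at *
        generalize evenProd q k = E at *
        generalize qFall q m (2 * k + 1) = P at *
        have e1 : q ^ ((k + 1) ^ 2) = q ^ (k ^ 2) * (q ^ k) ^ 2 * q := by ring
        have e1' : q ^ ((k + 1) ^ 2 + (k + 1)) = q ^ (k ^ 2) * (q ^ k) ^ 3 * q ^ 2 := by ring
        have e2 : q ^ (k ^ 2 + k) = q ^ (k ^ 2) * q ^ k := by ring
        have e3 : q ^ (2 * k + 2) = (q ^ k) ^ 2 * q ^ 2 := by ring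
        have e3' : q ^ (2 * k + 3) = (q ^ k) ^ 2 * q ^ 3 := by ring
        have e4 : q ^ (2 * k + 1) = (q ^ k) ^ 2 * q := by ring
        have e6 : q ^ (k + 1) = q ^ k * q := by ring
        have e7 : q ^ (m + 1) = q ^ m * q := by ring
        have e8 : q ^ (2 * k + 1 + 1) = (q ^ k) ^ 2 * q ^ 2 := by ring
        rw [e8] at hE'
        rw [e1', e1, e2, e3', e3, e4, e6, e7]
        have hb : q ^ k ≠ 0 := pow_ne_zero k hq
        generalize q ^ k = b at *
        generalize q ^ m = s at *
        generalize q ^ (k ^ 2) = c at *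
        push_cast
        field_simp
        ring

end ClosedForm

/-! ### Reed–Muller words as values of quadratic functions. -/

section Code

variable {F : Type*} [Field F] {m : ℕ}

variable (F m) in
/-- The value table of `Q + L + a`. -/
def quadFun : (QuadraticForm F (Fin m → F) × (((Fin m → F) →ₗ[F] F) × F)) →ₗ[F]
    ((Fin m → F) → F) where
  toFun p x := p.1 x + p.2.1 x + p.2.2
  map_add' p p' := by
    funext x
    simp
    ring
  map_smul' c p := by
    funext x
    simp
    ring

lemma quadFun_apply (Q : QuadraticForm F (Fin m → F)) (L : (Fin m → F) →ₗ[F] F) (a : F) :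
    quadFun F m (Q, L, a) = fun x => Q x + L x + a := rfl

lemma exists_prod_pow_eq (d : Fin m → ℕ) (hd : d ≠ 0) :
    ∃ (i : Fin m) (d' : Fin m → ℕ), ∑ j, d j = ∑ j, d' j + 1 ∧
      ∀ x : Fin m → F, ∏ j, x j ^ d j = x i * ∏ j, x j ^ d' j := by
  obtain ⟨i, hi⟩ : ∃ i, d i ≠ 0 := by
    by_contra! h
    exact hd (funext h)
  have h1 : d = Pi.single i 1 + (d - Pi.single i 1) := by
    funext j
    by_cases hj : j = i
    · subst hj
      simp
      omega
    · simp [hj]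
  refine ⟨i, d - Pi.single i 1, ?_, fun x => ?_⟩
  · conv_lhs => rw [h1]
    simp only [Pi.add_apply, Finset.sum_add_distrib]
    rw [Finset.sum_pi_single' i 1]
    simp [add_comm]
  · conv_lhs => rw [h1]
    simp only [Pi.add_apply, pow_add, Finset.prod_mul_distrib]
    congr 1
    rw [Finset.prod_eq_single i]
    · simp
    · intro j _ hj
      simp [hj]
    · simp

lemma prod_pow_mem_range (d : Fin m → ℕ) (hd : ∑ j, d j ≤ 2) :
    (fun x : Fin m → F => ∏ j, x j ^ d j) ∈ (quadFun F m).range := by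
  by_cases h0 : d = 0
  · subst h0
    exact ⟨(0, 0, 1), by rw [quadFun_apply]; funext x; simp⟩
  obtain ⟨i, d', h1, h2⟩ := exists_prod_pow_eq (F := F) d h0
  by_cases h0' : d' = 0
  · subst h0'
    exact ⟨(0, LinearMap.proj i, 0), by rw [quadFun_apply]; funext x; simp [h2]⟩
  obtain ⟨i', d'', h1', h2'⟩ := exists_prod_pow_eq (F := F) d' h0'
  have h0'' : d'' = 0 := by
    have : ∑ j, d'' j = 0 := by omega
    funext j
    exact Finset.sum_eq_zero_iff.1 this j (Finset.mem_univ j)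
  subst h0''
  exact ⟨(linMulLin (LinearMap.proj i) (LinearMap.proj i'), 0, 0), by
    rw [quadFun_apply]; funext x; simp [h2, h2']⟩

lemma eval_mem_RM {p : MvPolynomial (Fin m) F} (hp : p.totalDegree ≤ 2) :
    (fun x => MvPolynomial.eval x p) ∈ RM F 2 m :=
  ⟨p, (MvPolynomial.mem_restrictTotalDegree _ _ _).2 hp, rfl⟩

lemma proj_mul_proj_mem_RM (i j : Fin m) : (fun x : Fin m → F => x i * x j) ∈ RM F 2 m := by
  have := eval_mem_RM (F := F) (p := MvPolynomial.X i * MvPolynomial.X j) (by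
    refine (MvPolynomial.totalDegree_mul _ _).trans ?_
    rw [MvPolynomial.totalDegree_X, MvPolynomial.totalDegree_X])
  simpa using this

lemma proj_mem_RM (i : Fin m) : (fun x : Fin m → F => x i) ∈ RM F 2 m := by
  have := eval_mem_RM (F := F) (p := MvPolynomial.X i) (by
    rw [MvPolynomial.totalDegree_X]; norm_num)
  simpa using this

lemma const_mem_RM (a : F) : (fun _ : Fin m → F => a) ∈ RM F 2 m := by
  have := eval_mem_RM (F := F) (m := m) (p := MvPolynomial.C a) (by
    rw [MvPolynomial.totalDegree_C]; norm_num)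
  simpa using this

lemma linear_apply_eq_sum (L : (Fin m → F) →ₗ[F] F) (x : Fin m → F) :
    L x = ∑ i, L (Pi.single i 1) * x i := by
  conv_lhs => rw [pi_eq_sum_univ' x]
  simp [mul_comm]

/-- The second order Reed–Muller code consists of the value tables of the functions
`Q + L + a`. -/
theorem RM_two_eq_range : RM F 2 m = (quadFun F m).range := by
  apply le_antisymm
  · rintro _ ⟨p, hp, rfl⟩
    have hp : p.totalDegree ≤ 2 := (MvPolynomial.mem_restrictTotalDegree _ _ _).1 hp
    have h1 : MvPolynomial.evalₗ F (Fin m) p =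
        ∑ d ∈ p.support, p.coeff d • fun x : Fin m → F => ∏ j, x j ^ d j := by
      funext x
      rw [MvPolynomial.evalₗ_apply, MvPolynomial.eval_eq']
      simp
    rw [h1]
    refine Submodule.sum_mem _ fun d hd => Submodule.smul_mem _ _ (prod_pow_mem_range d ?_)
    have := MvPolynomial.le_totalDegree hd
    rw [Finsupp.sum_fintype _ _ fun _ => rfl] at this
    exact this.trans hp
  · rintro _ ⟨⟨Q, L, a⟩, rfl⟩
    -- The bilinear form B with B x x = Q x need not be symmetric, so it exists in characteristic
    -- two as well.
    have hQ : (fun x => Q x) = ∑ i, ∑ j,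
        Q.toBilin (Pi.basisFun F (Fin m)) (Pi.single i 1) (Pi.single j 1) •
          fun x : Fin m → F => x i * x j := by
      funext x
      have h1 := DFunLike.congr_fun (toQuadraticMap_toBilin Q (Pi.basisFun F (Fin m))) x
      rw [← h1, LinearMap.BilinMap.toQuadraticMap_apply]
      generalize Q.toBilin (Pi.basisFun F (Fin m)) = B
      have h2 : B x x = ∑ i, B (Pi.single i 1) x * x i :=
        linear_apply_eq_sum (B.flip x) x
      rw [h2]
      simp only [Finset.sum_apply, Pi.smul_apply, smul_eq_mul]
      refine Finset.sum_congr rfl fun i _ => ?_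
      rw [linear_apply_eq_sum (B (Pi.single i 1)) x, Finset.sum_mul]
      refine Finset.sum_congr rfl fun j _ => ?_
      ring
    have hL : (fun x => L x) = ∑ i, L (Pi.single i 1) • fun x : Fin m → F => x i := by
      funext x
      rw [linear_apply_eq_sum]
      simp
    have h : quadFun F m (Q, L, a) = (fun x => Q x) + (fun x => L x) + fun _ => a := rfl
    rw [h, hQ, hL]
    refine Submodule.add_mem _ (Submodule.add_mem _ ?_ ?_) (const_mem_RM a)
    · exact Submodule.sum_mem _ fun i _ => Submodule.sum_mem _ fun j _ =>
        Submodule.smul_mem _ _ (proj_mul_proj_mem_RM i j)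
    · exact Submodule.sum_mem _ fun i _ => Submodule.smul_mem _ _ (proj_mem_RM i)

variable [Fintype F] [DecidableEq F]

/-- An element t other than 0 and 1 has t² ≠ t, so scaling x by t separates the quadratic part from
the linear part. -/
lemma card_ker_quadFun_of_two_lt (hq : 2 < Fintype.card F) : Nat.card (quadFun F m).ker = 1 := by
  obtain ⟨t, ht⟩ : ∃ t : F, t ∉ ({0, 1} : Finset F) := by
    by_contra! h
    have h1 : (Finset.univ : Finset F) ⊆ {0, 1} := fun x _ => h x
    have h2 := Finset.card_le_card h1
    have h3 := Finset.card_le_two (a := (0 : F)) (b := 1)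
    rw [Finset.card_univ] at h2
    omega
  have ht0 : t ≠ 0 := fun h => ht (by simp [h])
  have ht1 : t - 1 ≠ 0 := fun h => ht (by simp [sub_eq_zero.1 h])
  have : (quadFun F m).ker = ⊥ := by
    rw [LinearMap.ker_eq_bot']
    rintro ⟨Q, L, a⟩ h
    have h : ∀ x, Q x + L x + a = 0 := fun x => congr_fun h x
    have ha : a = 0 := by simpa using h 0
    subst ha
    have hQ : ∀ x, Q x = 0 := by
      intro x
      have h1 := h x
      have h2 := h (t • x)
      rw [QuadraticMap.map_smul, map_smul, smul_eq_mul, smul_eq_mul] at h2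
      have : t * (t - 1) * Q x = 0 := by linear_combination h2 - t * h1
      exact (mul_eq_zero.1 this).resolve_left (mul_ne_zero ht0 ht1)
    have hL : ∀ x, L x = 0 := by
      intro x
      have h1 := h x
      rw [hQ] at h1
      simpa using h1
    have e1 : Q = 0 := QuadraticMap.ext hQ
    have e2 : L = 0 := LinearMap.ext hL
    rw [e1, e2]
    rfl
  rw [this]
  simp

/-- Over two elements L² = L as functions, so the kernel consists of the triples (L², L, 0), one for
each L. -/
lemma card_ker_quadFun_of_eq_two (hq : Fintype.card F = 2) :
    Nat.card (quadFun F m).ker = 2 ^ m := by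
  have h2 : (2 : F) = 0 := by
    rw [two_eq_zero_iff_even, Nat.card_eq_fintype_card, hq]
    exact even_two
  have hsq : ∀ x : F, x * x = x := by
    intro x
    have := FiniteField.pow_card x
    rw [hq] at this
    linear_combination this
  have hb : Function.Bijective (fun p : (quadFun F m).ker => p.1.2.1) := by
    constructor
    · rintro ⟨⟨Q, L, a⟩, h⟩ ⟨⟨Q', L', a'⟩, h'⟩ hLL'
      have hLL' : L = L' := hLL'
      subst hLL'
      have h : ∀ x, Q x + L x + a = 0 := fun x => congr_fun h x
      have h' : ∀ x, Q' x + L x + a' = 0 := fun x => congr_fun h' x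
      have ha : a = 0 := by simpa using h 0
      have ha' : a' = 0 := by simpa using h' 0
      subst ha ha'
      have : Q = Q' := QuadraticMap.ext fun x => by linear_combination h x - h' x
      subst this
      rfl
    · intro L
      refine ⟨⟨(linMulLin L L, L, 0), ?_⟩, rfl⟩
      rw [LinearMap.mem_ker, quadFun_apply]
      funext x
      rw [linMulLin_apply, hsq]
      show L x + L x + 0 = 0
      linear_combination L x * h2
  rw [Nat.card_congr (Equiv.ofBijective _ hb), Nat.card_eq_fintype_card, card_dual, hq]

lemma hammingNorm_eq_iff (c : (Fin m → F) → F) (w : ℤ) :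
    (hammingNorm c : ℤ) = w ↔
      dev c = (Fintype.card F : ℚ) ^ m - (Fintype.card F : ℚ) ^ m / Fintype.card F - w := by
  have h1 : (hammingNorm c : ℚ) = (Fintype.card F : ℚ) ^ m -
      (Finset.univ.filter fun x => c x = 0).card := by
    have h2 := Finset.card_filter_add_card_filter_not (s := (Finset.univ : Finset (Fin m → F)))
      (fun x => c x = 0)
    rw [Finset.card_univ, Fintype.card_fun, Fintype.card_fin] at h2
    have h3 : hammingNorm c = (Finset.univ.filter fun x => ¬ c x = 0).card := rfl
    rw [h3]
    have h4 : ((Finset.univ.filter fun x => c x = 0).card : ℚ) +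
        (Finset.univ.filter fun x => ¬ c x = 0).card = (Fintype.card F : ℚ) ^ m := by
      exact_mod_cast h2
    linear_combination h4
  have h2 : dev c = (Finset.univ.filter fun x => c x = 0).card -
      (Fintype.card F : ℚ) ^ m / Fintype.card F := by
    simp [dev, delta, Finset.sum_sub_distrib]
    ring
  rw [h2]
  have h3 : (hammingNorm c : ℤ) = w ↔ (hammingNorm c : ℚ) = w := by
    constructor
    · intro h; exact_mod_cast h
    · intro h; exact_mod_cast h
  rw [h3, h1]
  constructor <;> intro h <;> linear_combination -h

/-- Codewords of given weight, counted through quadratic, linear and constant parts. -/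
theorem weightFreq_mul_card_ker (w : ℤ) :
    (weightFreq (RM F 2 m) w : ℚ) * Nat.card (quadFun F m).ker =
      ∑ Q : QuadraticForm F (Fin m → F), (cnt Q ((Fintype.card F : ℚ) ^ m -
        (Fintype.card F : ℚ) ^ m / Fintype.card F - w) : ℚ) := by
  classical
  set d : ℚ := (Fintype.card F : ℚ) ^ m - (Fintype.card F : ℚ) ^ m / Fintype.card F - w with hd
  have h1 : {c : (Fin m → F) → F | c ∈ RM F 2 m ∧ (hammingNorm c : ℤ) = w} =
      ((Finset.univ.filter fun c : (Fin m → F) → F =>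
        c ∈ (quadFun F m).range ∧ dev c = d : Finset _) : Set ((Fin m → F) → F)) := by
    ext c
    rw [Finset.coe_filter]
    simp only [Set.mem_ofPred_eq, Finset.mem_univ, true_and, RM_two_eq_range, hammingNorm_eq_iff,
      ← hd]
  have h2 : ∑ Q : QuadraticForm F (Fin m → F), (cnt Q d : ℚ) =
      ((Finset.univ.filter fun p : QuadraticForm F (Fin m → F) × (((Fin m → F) →ₗ[F] F) × F) =>
        dev (quadFun F m p) = d).card : ℚ) := by
    rw [← Finset.sum_boole, Fintype.sum_prod_type]
    refine Finset.sum_congr rfl fun Q _ => ?_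
    rw [cnt_eq_sum]
    rfl
  rw [h2, weightFreq, h1, Set.ncard_coe_finset]
  -- The triples of the given deviation are grouped by the word they define; each fibre is a coset
  -- of the kernel.
  rw [Finset.card_eq_sum_card_fiberwise (f := quadFun F m)
    (t := Finset.univ.filter fun c => c ∈ (quadFun F m).range ∧ dev c = d)]
  · rw [Finset.sum_congr rfl fun c hc => ?_, Finset.sum_const (Nat.card (quadFun F m).ker),
      smul_eq_mul, Nat.cast_mul]
    obtain ⟨hc1, hc2⟩ := (Finset.mem_filter.1 hc).2
    have h3 := AddMonoidHom.card_fiber_eq_of_mem_range (quadFun F m) (x := c) (y := 0)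
      (by obtain ⟨p, hp⟩ := hc1; exact ⟨p, hp⟩) ⟨0, map_zero _⟩
    have h4 : Nat.card (quadFun F m).ker =
        (Finset.univ.filter fun p => quadFun F m p = 0).card := by
      rw [Nat.card_eq_fintype_card, ← Fintype.card_subtype]
      exact Fintype.card_congr (Equiv.refl _)
    rw [h4, ← h3]
    congr 1
    ext p
    simp only [Finset.mem_filter, Finset.mem_univ, true_and]
    exact ⟨fun h => h.2, fun h => ⟨by rw [h]; exact hc2, h⟩⟩
  · intro p hp
    have hp : dev (quadFun F m p) = d := by simpa using hp
    simp only [Finset.coe_filter, Set.mem_ofPred_eq, Finset.mem_univ, true_and]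
    exact ⟨⟨p, rfl⟩, hp⟩

end Code

/-! ### Summing multiplicities over all quadratic forms. -/

section Weights

variable {F : Type*} [Field F] [Fintype F] [DecidableEq F] {m : ℕ}

lemma sum_range_two_mul {M : Type*} [AddCommMonoid M] (h : ℕ → M) (n : ℕ) :
    ∑ r ∈ Finset.range (2 * n), h r = ∑ i ∈ Finset.range n, (h (2 * i) + h (2 * i + 1)) := by
  induction n with
  | zero => simp
  | succ n ih =>
    rw [show 2 * (n + 1) = 2 * n + 1 + 1 by ring, Finset.sum_range_succ, Finset.sum_range_succ, ih,
      Finset.sum_range_succ, add_assoc]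

/-- Ranks are grouped in pairs 2i, 2i + 1. For even m the last pair contains the rank m + 1, which
does not occur and contributes 0. -/
lemma sum_comp_quadRank (g : ℕ → ℚ) :
    ∑ Q : QuadraticForm F (Fin m → F), g (quadRank Q) =
      ∑ i ∈ Finset.range (m / 2 + 1),
        (g (2 * i) * vRank F m (2 * i) + g (2 * i + 1) * vRank F m (2 * i + 1)) := by
  rw [← sum_range_two_mul fun r => g r * (vRank F m r : ℚ)]
  simp only [vRank_eq_sum, Finset.mul_sum]
  rw [Finset.sum_comm]
  refine Finset.sum_congr rfl fun Q _ => ?_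
  have := quadRank_le Q
  rw [Finset.sum_eq_single (quadRank Q)]
  · simp
  · intro r _ hr
    rw [if_neg fun h => hr h.symm, mul_zero]
  · intro h
    exact absurd (Finset.mem_range.2 (by omega)) h

lemma card_quadraticForm :
    Fintype.card (QuadraticForm F (Fin m → F)) = Fintype.card F ^ (m * (m + 1) / 2) := by
  induction m with
  | zero =>
    simp only [zero_mul, Nat.zero_div, pow_zero]
    rw [Fintype.card_eq_one_iff]
    exact ⟨0, fun Q => QuadraticMap.ext fun x => by
      rw [Subsingleton.elim x 0, QuadraticMap.map_zero, QuadraticMap.map_zero]⟩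
  | succ m ih =>
    have h := Fintype.card_of_bijective (extend_bijective (F := F) (m := m))
    rw [Fintype.card_prod, Fintype.card_prod, card_dual, ih] at h
    rw [← h, ← pow_succ, ← pow_add]
    congr 1
    have : (m + 1) * (m + 1 + 1) = m * (m + 1) + (m + 1) * 2 := by ring
    rw [this, Nat.add_mul_div_right _ _ (by norm_num)]

/-- The number of affine functions `L + a` with `Q + L + a` of nonzero deviation, as a function of
the rank of `Q`. -/
def unbalancedCount (q : ℚ) (r : ℕ) : ℚ := if Even r then q ^ (r + 1) else (q - 1) * q ^ r

lemma unbalancedCount_even (q : ℚ) (i : ℕ) : unbalancedCount q (2 * i) = q ^ (2 * i + 1) :=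
  if_pos (even_two_mul i)

lemma unbalancedCount_odd (q : ℚ) (i : ℕ) :
    unbalancedCount q (2 * i + 1) = (q - 1) * q ^ (2 * i + 1) :=
  if_neg (by simp)

lemma sum_cnt_zero :
    ∑ Q : QuadraticForm F (Fin m → F), (cnt Q 0 : ℚ) =
      ∑ i ∈ Finset.range (m / 2 + 1),
        (((Fintype.card F : ℚ) ^ (m + 1) - (Fintype.card F : ℚ) ^ (2 * i + 1)) *
          vRank F m (2 * i) +
        ((Fintype.card F : ℚ) ^ (m + 1) -
          (Fintype.card F - 1) * (Fintype.card F : ℚ) ^ (2 * i + 1)) * vRank F m (2 * i + 1)) := by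
  have h := sum_comp_quadRank (F := F) (m := m)
    fun r => (Fintype.card F : ℚ) ^ (m + 1) - unbalancedCount (Fintype.card F) r
  simp only [unbalancedCount_even, unbalancedCount_odd] at h
  rw [← h]
  refine Finset.sum_congr rfl fun Q _ => ?_
  rcases evenDev_or_oddDev Q with ⟨i, hi, h⟩ | ⟨i, hi, σ, hσ, h⟩
  · rw [hi, unbalancedCount_odd, h.cnt_eq, if_pos rfl]
  · rw [hi, unbalancedCount_even, h.cnt_eq, if_pos rfl]

lemma sum_vRank : ∑ i ∈ Finset.range (m / 2 + 1),
    ((vRank F m (2 * i) : ℚ) + vRank F m (2 * i + 1)) =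
      (Fintype.card F : ℚ) ^ (m * (m + 1) / 2) := by
  have h := sum_comp_quadRank (F := F) (m := m) fun _ => 1
  simp only [one_mul] at h
  rw [← h]
  simp [card_quadraticForm]

/-- The scale X_0, coming from ranks 0 and 1, is kept apart: it produces the exceptional weights 0,
q^m - 2q^(m-1) and q^m. -/
lemma exists_of_cnt_ne_zero {Q : QuadraticForm F (Fin m → F)} {d : ℚ} (h : cnt Q d ≠ 0) :
    d = 0 ∨ d = (Fintype.card F - 1) * scale F (Fin m → F) 0 ∨
      (∃ τ : ℤˣ, d = ((τ : ℤ) : ℚ) * scale F (Fin m → F) 0) ∨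
      ∃ k, 1 ≤ k ∧ k ≤ m / 2 ∧ ∃ τ : ℤˣ,
        d = ((τ : ℤ) : ℚ) * (Fintype.card F - 1) * scale F (Fin m → F) k ∨
        d = ((τ : ℤ) : ℚ) * scale F (Fin m → F) k := by
  have hm := quadRank_le Q
  obtain ⟨L, c, hd⟩ : ∃ (L : (Fin m → F) →ₗ[F] F) (c : F), dev (fun x => Q x + L x + c) = d := by
    by_contra! h'
    exact h (cnt_eq_zero h')
  rw [← hd]
  rcases evenDev_or_oddDev Q with ⟨i, hi, h⟩ | ⟨i, hi, σ, hσ, h⟩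
  · rcases h.2 L c with h0 | h0 | h0
    · exact Or.inl h0
    · have h1 : dev (fun x => Q x + L x + c) = (((1 : ℤˣ) : ℤ) : ℚ) * scale F (Fin m → F) i := by
        rw [h0]; norm_num
      rcases Nat.eq_zero_or_pos i with rfl | hp
      · exact Or.inr (Or.inr (Or.inl ⟨1, h1⟩))
      · exact Or.inr (Or.inr (Or.inr ⟨i, hp, by omega, 1, Or.inr h1⟩))
    · have h1 : dev (fun x => Q x + L x + c) = (((-1 : ℤˣ) : ℤ) : ℚ) * scale F (Fin m → F) i := by
        rw [h0]; norm_num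
      rcases Nat.eq_zero_or_pos i with rfl | hp
      · exact Or.inr (Or.inr (Or.inl ⟨-1, h1⟩))
      · exact Or.inr (Or.inr (Or.inr ⟨i, hp, by omega, -1, Or.inr h1⟩))
  · rcases h.2 L c with h0 | h0 | h0
    · exact Or.inl h0
    · rcases Nat.eq_zero_or_pos i with rfl | hp
      · right; left
        obtain rfl := (quadRank_eq_zero_iff Q).1 hi
        have h2 := h.1
        have h3 : dev (0 : QuadraticForm F (Fin m → F)) =
            (Fintype.card F - 1) * scale F (Fin m → F) 0 := by
          have := card_ne_zero' (F := F)
          have e : dev (0 : QuadraticForm F (Fin m → F)) = dev (fun _ : Fin m → F => (0 : F)) := rfl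
          rw [e, dev_const, scale, delta]
          field_simp
          simp
          ring
        rw [h0, ← h2, h3]
      · exact Or.inr (Or.inr (Or.inr ⟨i, hp, by omega, σ, Or.inl h0⟩))
    · have h1 : dev (fun x => Q x + L x + c) = (((-σ : ℤˣ) : ℤ) : ℚ) * scale F (Fin m → F) i := by
        rw [h0]; push_cast; ring
      rcases Nat.eq_zero_or_pos i with rfl | hp
      · exact Or.inr (Or.inr (Or.inl ⟨-σ, h1⟩))
      · exact Or.inr (Or.inr (Or.inr ⟨i, hp, by omega, -σ, Or.inr h1⟩))

/-- For more than two elements, the large and small deviations never agree. -/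
lemma card_sub_one_mul_scale_ne (hq : 2 < Fintype.card F) (i k : ℕ) :
    ((Fintype.card F : ℚ) - 1) * scale F (Fin m → F) k ≠ scale F (Fin m → F) i := by
  intro h
  have hq0 := card_ne_zero' (F := F)
  rw [scale_eq, scale_eq, mul_div_assoc', div_eq_div_iff (pow_ne_zero _ hq0) (pow_ne_zero _ hq0)]
    at h
  have h1 : ((Fintype.card F : ℚ) - 1) * (Fintype.card F : ℚ) ^ (i + 1) =
      (Fintype.card F : ℚ) ^ (k + 1) := by
    apply mul_left_cancel₀ (pow_ne_zero m hq0)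
    linear_combination h
  obtain ⟨n, hn⟩ : ∃ n, Fintype.card F = n + 1 := ⟨Fintype.card F - 1, by omega⟩
  rw [hn] at h1 hq
  have h2 : n * (n + 1) ^ (i + 1) = (n + 1) ^ (k + 1) := by
    have h3 : ((n : ℚ)) * ((n : ℚ) + 1) ^ (i + 1) = ((n : ℚ) + 1) ^ (k + 1) := by
      push_cast at h1
      linear_combination h1
    exact_mod_cast h3
  -- With n = q - 1 ≥ 2, the number n q^(i+1) lies strictly between q^(i+1) and q^(i+2), so it is no
  -- power of q.
  rcases lt_or_ge i k with hik | hik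
  · have h4 : (n + 1) ^ (i + 2) ≤ (n + 1) ^ (k + 1) := Nat.pow_le_pow_right (by omega) (by omega)
    rw [← h2, pow_succ (n + 1) (i + 1)] at h4
    have h5 : 0 < (n + 1) ^ (i + 1) := by positivity
    nlinarith
  · have h4 : (n + 1) ^ (k + 1) ≤ (n + 1) ^ (i + 1) := Nat.pow_le_pow_right (by omega) (by omega)
    rw [← h2] at h4
    have h5 : 0 < (n + 1) ^ (i + 1) := by positivity
    nlinarith

lemma unit_mul_card_sub_one_mul_scale_ne (hq : 2 < Fintype.card F) (i k : ℕ) (σ τ : ℤˣ) :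
    ((τ : ℤ) : ℚ) * (Fintype.card F - 1) * scale F (Fin m → F) k ≠
      ((σ : ℤ) : ℚ) * scale F (Fin m → F) i := by
  intro h
  apply card_sub_one_mul_scale_ne hq i k
  have hi := scale_pos (F := F) (m := m) i
  have hk := scale_pos (F := F) (m := m) k
  have hq1 : (0 : ℚ) < Fintype.card F - 1 := by have := one_lt_card' (F := F); linarith
  have hp := mul_pos hq1 hk
  rcases Int.units_eq_one_or σ with rfl | rfl <;> rcases Int.units_eq_one_or τ with rfl | rfl <;>
    push_cast at h <;> linarith

lemma sum_cnt_large (hq : 2 < Fintype.card F) (k : ℕ) (τ : ℤˣ) :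
    ∑ Q : QuadraticForm F (Fin m → F),
      (cnt Q (((τ : ℤ) : ℚ) * (Fintype.card F - 1) * scale F (Fin m → F) k) : ℚ) =
        (Fintype.card F : ℚ) ^ (2 * k) * vRankType F m (2 * k) τ := by
  classical
  have hq1 := card_sub_one_ne_zero (F := F)
  have hX := (scale_pos (F := F) (m := m) k).ne'
  have hd := mul_ne_zero (mul_ne_zero (unit_ne_zero τ) hq1) hX
  rw [vRankType_eq_sum, Finset.mul_sum]
  refine Finset.sum_congr rfl fun Q _ => ?_
  rcases evenDev_or_oddDev Q with ⟨i, hi, h⟩ | ⟨i, hi, σ, hσ, h⟩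
  · have h1 := unit_mul_card_sub_one_mul_scale_ne (F := F) (m := m) hq i k 1 τ
    have h2 := unit_mul_card_sub_one_mul_scale_ne (F := F) (m := m) hq i k (-1) τ
    rw [Units.val_one, Int.cast_one, one_mul] at h1
    rw [Units.val_neg, Units.val_one, Int.cast_neg, Int.cast_one, neg_one_mul] at h2
    rw [h.cnt_eq, if_neg hd, if_neg (not_or.2 ⟨h1, h2⟩), if_neg fun h => by omega, mul_zero]
  · have h1 := unit_mul_card_sub_one_mul_scale_ne (F := F) (m := m) hq i k (-σ) τ
    rw [Units.val_neg, Int.cast_neg] at h1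
    rw [h.cnt_eq, if_neg hd, if_neg h1]
    simp only [quadRank_hasType_iff, h.1]
    by_cases h2 : ((τ : ℤ) : ℚ) * (Fintype.card F - 1) * scale F (Fin m → F) k =
      ((σ : ℤ) : ℚ) * (Fintype.card F - 1) * scale F (Fin m → F) i
    · rw [if_pos h2, if_pos h2.symm]
      have h3 : ((τ : ℤ) : ℚ) * scale F (Fin m → F) k = ((σ : ℤ) : ℚ) * scale F (Fin m → F) i :=
        mul_left_cancel₀ hq1 (by linear_combination h2)
      rw [(unit_mul_scale_inj.1 h3).1, mul_one]
    · rw [if_neg h2, if_neg fun h => h2 h.symm, mul_zero]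

/-- A small deviation -τX_k arises from rank 2k with type τ and from rank 2k + 1 with either sign,
hence the two summands. -/
lemma sum_cnt_small (hq : 2 < Fintype.card F) (k : ℕ) (τ : ℤˣ) :
    ∑ Q : QuadraticForm F (Fin m → F),
      (cnt Q (-((τ : ℤ) : ℚ) * scale F (Fin m → F) k) : ℚ) =
        (Fintype.card F - 1) * (Fintype.card F : ℚ) ^ (2 * k) * vRankType F m (2 * k) τ +
          (Fintype.card F - 1) / 2 * (Fintype.card F : ℚ) ^ (2 * k + 1) *
            vRank F m (2 * k + 1) := by
  classical
  have hq1 := card_sub_one_ne_zero (F := F)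
  have hX := (scale_pos (F := F) (m := m) k).ne'
  have hd := mul_ne_zero (neg_ne_zero.2 (unit_ne_zero τ)) hX
  rw [vRankType_eq_sum, vRank_eq_sum, Finset.mul_sum, Finset.mul_sum, ← Finset.sum_add_distrib]
  refine Finset.sum_congr rfl fun Q _ => ?_
  rcases evenDev_or_oddDev Q with ⟨i, hi, h⟩ | ⟨i, hi, σ, hσ, h⟩
  · have e1 : (-((τ : ℤ) : ℚ) * scale F (Fin m → F) k = scale F (Fin m → F) i ∨
        -((τ : ℤ) : ℚ) * scale F (Fin m → F) k = -scale F (Fin m → F) i) ↔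
        quadRank Q = 2 * k + 1 := by
      have a1 := unit_mul_scale_inj (F := F) (m := m) (i := k) (k := i) (σ := -τ) (τ := 1)
      have a2 := unit_mul_scale_inj (F := F) (m := m) (i := k) (k := i) (σ := -τ) (τ := -1)
      push_cast at a1 a2
      rw [one_mul] at a1
      rw [neg_one_mul] at a2
      rw [a1, a2, hi]
      rcases Int.units_eq_one_or τ with rfl | rfl <;> constructor <;> intro h <;> simp at h ⊢ <;>
        omega
    rw [h.cnt_eq, if_neg hd, if_neg (show ¬ (quadRank Q = 2 * k ∧ HasType Q τ) from
      fun h => by omega)]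
    simp only [e1]
    split_ifs with h1
    · obtain rfl : i = k := by omega
      ring
    · ring
  · have h1 : -((τ : ℤ) : ℚ) * scale F (Fin m → F) k ≠
        ((σ : ℤ) : ℚ) * (Fintype.card F - 1) * scale F (Fin m → F) i := by
      have := unit_mul_card_sub_one_mul_scale_ne (F := F) (m := m) hq k i (-τ) σ
      rw [Units.val_neg, Int.cast_neg] at this
      exact this.symm
    rw [h.cnt_eq, if_neg hd, if_neg h1, if_neg (show ¬ quadRank Q = 2 * k + 1 by omega)]
    simp only [quadRank_hasType_iff, h.1]
    by_cases h2 : -((τ : ℤ) : ℚ) * scale F (Fin m → F) k = -((σ : ℤ) : ℚ) * scale F (Fin m → F) i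
    · have h3 : ((τ : ℤ) : ℚ) * scale F (Fin m → F) k = ((σ : ℤ) : ℚ) * scale F (Fin m → F) i := by
        linear_combination -h2
      obtain ⟨rfl, rfl⟩ := unit_mul_scale_inj.1 h3
      rw [if_pos rfl, if_pos rfl]
      ring
    · rw [if_neg h2, if_neg]
      · ring
      · intro h3
        apply h2
        have h4 : ((σ : ℤ) : ℚ) * scale F (Fin m → F) i = ((τ : ℤ) : ℚ) * scale F (Fin m → F) k :=
          mul_left_cancel₀ hq1 (by linear_combination h3)
        linear_combination h4

/-- Over the field with two elements the large and small deviations agree. -/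
lemma sum_cnt_binary (hq : Fintype.card F = 2) (k : ℕ) (τ : ℤˣ) :
    ∑ Q : QuadraticForm F (Fin m → F),
      (cnt Q (((τ : ℤ) : ℚ) * scale F (Fin m → F) k) : ℚ) =
        (2 : ℚ) ^ (2 * k) * (vRank F m (2 * k) + vRank F m (2 * k + 1)) := by
  have hq' : (Fintype.card F : ℚ) = 2 := by rw [hq]; norm_num
  have hX := (scale_pos (F := F) (m := m) k).ne'
  have hd := mul_ne_zero (unit_ne_zero τ) hX
  rw [vRank_eq_sum, vRank_eq_sum, ← Finset.sum_add_distrib, Finset.mul_sum]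
  refine Finset.sum_congr rfl fun Q _ => ?_
  have hτ1 : ((τ : ℤ) : ℚ) = 1 ∨ ((τ : ℤ) : ℚ) = -1 := by
    rcases Int.units_eq_one_or τ with rfl | rfl <;> norm_num
  have hXk := scale_pos (F := F) (m := m) k
  rcases evenDev_or_oddDev Q with ⟨i, hi, h⟩ | ⟨i, hi, σ, hσ, h⟩
  · have hXi := scale_pos (F := F) (m := m) i
    rw [h.cnt_eq, if_neg hd, if_neg (show ¬ quadRank Q = 2 * k by omega), hq']
    by_cases hik : i = k
    · subst hik
      rw [if_pos, if_pos hi]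
      · ring
      · rcases hτ1 with h1 | h1 <;> rw [h1] <;> simp
    · rw [if_neg, if_neg (by omega)]
      · ring
      · intro h2
        apply hik
        apply scale_inj (F := F) (m := m)
        rcases hτ1 with h1 | h1 <;> rw [h1] at h2 <;> rcases h2 with h2 | h2 <;> linarith
  · have hXi := scale_pos (F := F) (m := m) i
    have hσ1 : ((σ : ℤ) : ℚ) = 1 ∨ ((σ : ℤ) : ℚ) = -1 := by
      rcases Int.units_eq_one_or σ with rfl | rfl <;> norm_num
    rw [h.cnt_eq, if_neg hd, if_neg (show ¬ quadRank Q = 2 * k + 1 by omega), hq']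
    by_cases hik : i = k
    · subst hik
      rw [if_pos hi]
      by_cases h2 : ((τ : ℤ) : ℚ) * scale F (Fin m → F) i =
          ((σ : ℤ) : ℚ) * (2 - 1) * scale F (Fin m → F) i
      · rw [if_pos h2]; ring
      · rw [if_neg h2, if_pos]
        · ring
        · rcases hτ1 with h1 | h1 <;> rcases hσ1 with h3 | h3 <;> rw [h1, h3] at h2 ⊢
          · exact absurd (by ring) h2
          · ring
          · exact absurd (by ring) h2
    · rw [if_neg (show ¬ quadRank Q = 2 * k by omega), if_neg, if_neg]
      · ring
      · intro h2
        apply hik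
        apply scale_inj (F := F) (m := m)
        rcases hτ1 with h1 | h1 <;> rcases hσ1 with h3 | h3 <;> rw [h1, h3] at h2 <;> linarith
      · intro h2
        apply hik
        apply scale_inj (F := F) (m := m)
        rcases hτ1 with h1 | h1 <;> rcases hσ1 with h3 | h3 <;> rw [h1, h3] at h2 <;> linarith

lemma scale_eq_pow {k : ℕ} (hk : k + 1 ≤ m) :
    scale F (Fin m → F) k = (Fintype.card F : ℚ) ^ (m - k - 1) := by
  rw [scale_eq, Nat.sub_sub, pow_sub₀ _ card_ne_zero' hk]
  rfl

end Weights

/-! ### Product formulas for the numbers of forms. -/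

section Formulas

variable {F : Type*} [Field F] [Fintype F] [DecidableEq F] {m : ℕ}

lemma vRank_odd_eq_prod {j : ℕ} (hj : 2 * j + 1 ≤ m) :
    (vRank F m (2 * j + 1) : ℚ) =
      (Fintype.card F : ℚ) ^ (j ^ 2 + j) *
        (∏ i ∈ Finset.Icc (m - 2 * j) m, ((Fintype.card F : ℚ) ^ i - 1)) /
          (∏ i ∈ Finset.Icc 1 j, ((Fintype.card F : ℚ) ^ (2 * i) - 1)) := by
  rw [(vRank_closed_form m).2 j, qFall_eq_prod card_ne_zero' hj,
    show m - (2 * j + 1) + 1 = m - 2 * j by omega, evenProd]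

lemma vRankType_even_eq_prod {j : ℕ} (hj : 2 * j ≤ m) (τ : ℤˣ) :
    (vRankType F m (2 * j) τ : ℚ) =
      (Fintype.card F : ℚ) ^ (j ^ 2) * ((Fintype.card F : ℚ) ^ j + ((τ : ℤ) : ℚ)) / 2 *
        (∏ i ∈ Finset.Icc (m - 2 * j + 1) m, ((Fintype.card F : ℚ) ^ i - 1)) /
          (∏ i ∈ Finset.Icc 1 j, ((Fintype.card F : ℚ) ^ (2 * i) - 1)) := by
  rw [(vRank_closed_form m).1 j, qFall_eq_prod card_ne_zero' hj, evenProd]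

lemma vRank_even_eq (j : ℕ) :
    (vRank F m (2 * j) : ℚ) =
      (Fintype.card F : ℚ) ^ (j ^ 2 + j) * qFall (Fintype.card F) m (2 * j) /
        evenProd (Fintype.card F) j := by
  rw [vRank_even, (vRank_closed_form m).1, (vRank_closed_form m).1, pow_add]
  push_cast
  ring

/-- The closed forms differ by one factor: v_(2j+1) = v_(2j)(q^m/q^(2j) - 1). This is what merges
two ranks into a single product in the binary case. -/
lemma pow_mul_vRank_add (j : ℕ) :
    (Fintype.card F : ℚ) ^ (2 * j) * (vRank F m (2 * j) + vRank F m (2 * j + 1)) =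
      (Fintype.card F : ℚ) ^ m * vRank F m (2 * j) := by
  have hq := card_ne_zero' (F := F)
  have he := evenProd_ne_zero (one_lt_card' (F := F)) j
  rw [vRank_even_eq, (vRank_closed_form m).2, qFall_succ]
  field_simp
  ring

lemma vRank_one : (vRank F m 1 : ℚ) = (Fintype.card F : ℚ) ^ m - 1 := by
  have h := pow_mul_vRank_add (F := F) (m := m) 0
  rw [mul_zero, vRank_zero] at h
  simp only [pow_zero, zero_add, Nat.cast_one, mul_one, one_mul] at h
  linarith

end Formulas

/-! ### Weight frequencies for q > 2 and for q = 2. -/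

section Frequencies

variable {F : Type*} [Field F] [Fintype F] [DecidableEq F] {m : ℕ}

lemma card_pow_sub_div (hm : 1 ≤ m) :
    (Fintype.card F : ℚ) ^ m / Fintype.card F = (Fintype.card F : ℚ) ^ (m - 1) := by
  rw [pow_sub₀ _ card_ne_zero' hm, pow_one]
  rfl

lemma scale_zero (hm : 1 ≤ m) :
    scale F (Fin m → F) 0 = (Fintype.card F : ℚ) ^ (m - 1) := scale_eq_pow hm

lemma card_pow_eq (hm : 1 ≤ m) :
    (Fintype.card F : ℚ) ^ m = Fintype.card F * (Fintype.card F : ℚ) ^ (m - 1) := by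
  rw [← pow_succ', Nat.sub_add_cancel hm]

lemma weightFreq_of_two_lt (hq : 2 < Fintype.card F) (hm : 1 ≤ m) {w : ℤ} {d : ℚ}
    (hd : (Fintype.card F : ℚ) ^ m - (Fintype.card F : ℚ) ^ (m - 1) - w = d) :
    (weightFreq (RM F 2 m) w : ℚ) = ∑ Q : QuadraticForm F (Fin m → F), (cnt Q d : ℚ) := by
  have h := weightFreq_mul_card_ker (F := F) (m := m) w
  rw [card_ker_quadFun_of_two_lt hq, card_pow_sub_div hm, hd] at h
  simpa using h

lemma weightFreq_of_eq_two (hq : Fintype.card F = 2) (hm : 1 ≤ m) {w : ℤ} {d : ℚ}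
    (hd : (2 : ℚ) ^ (m - 1) - w = d) :
    (weightFreq (RM F 2 m) w : ℚ) * 2 ^ m =
      ∑ Q : QuadraticForm F (Fin m → F), (cnt Q d : ℚ) := by
  have h := weightFreq_mul_card_ker (F := F) (m := m) w
  rw [card_ker_quadFun_of_eq_two hq, card_pow_sub_div hm] at h
  have h2 := card_pow_eq (F := F) hm
  rw [hq] at h h2
  push_cast at h h2
  rw [show (2 : ℚ) ^ m - 2 ^ (m - 1) - w = d by rw [← hd, h2]; ring] at h
  exact h

lemma exists_cnt_ne_zero {w : ℤ} (hm : 1 ≤ m) (h : weightFreq (RM F 2 m) w ≠ 0) :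
    ∃ Q : QuadraticForm F (Fin m → F),
      cnt Q ((Fintype.card F : ℚ) ^ m - (Fintype.card F : ℚ) ^ (m - 1) - w) ≠ 0 := by
  by_contra! h0
  have h1 := weightFreq_mul_card_ker (F := F) (m := m) w
  rw [card_pow_sub_div hm, Finset.sum_eq_zero fun Q _ => by rw [h0 Q, Nat.cast_zero]] at h1
  rcases mul_eq_zero.1 h1 with h2 | h2
  · exact h (by exact_mod_cast h2)
  · have : 0 < Nat.card (quadFun F m).ker := Nat.card_pos
    exact this.ne' (by exact_mod_cast h2)

lemma weightFreq_zero_of_two_lt (hq : 2 < Fintype.card F) (hm : 1 ≤ m) :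
    weightFreq (RM F 2 m) 0 = 1 := by
  have h := weightFreq_of_two_lt hq hm (w := 0)
    (d := (((1 : ℤˣ) : ℤ) : ℚ) * (Fintype.card F - 1) * scale F (Fin m → F) 0)
    (by rw [scale_zero hm, card_pow_eq hm]; push_cast; ring)
  rw [sum_cnt_large hq, mul_zero, vRankType_zero_one] at h
  simpa using h

lemma weightFreq_large (hq : 2 < Fintype.card F) {j : ℕ} (hj : 1 ≤ j) (hjm : j ≤ m / 2)
    (τ : ℤˣ) :
    (weightFreq (RM F 2 m) ((Fintype.card F : ℤ) ^ m - (Fintype.card F : ℤ) ^ (m - 1)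
        - (τ : ℤ) * (Fintype.card F : ℤ) ^ (m - j - 1) * ((Fintype.card F : ℤ) - 1)) : ℚ) =
      (Fintype.card F : ℚ) ^ (2 * j) * vRankType F m (2 * j) τ := by
  rw [← sum_cnt_large hq]
  apply weightFreq_of_two_lt hq (by omega)
  rw [scale_eq_pow (by omega)]
  push_cast
  ring

/-- The range includes j = 0, from which the weights q^m - 2q^(m-1) and q^m are obtained. -/
lemma weightFreq_small (hq : 2 < Fintype.card F) {j : ℕ} (hj : j + 1 ≤ m) (τ : ℤˣ) :
    (weightFreq (RM F 2 m) ((Fintype.card F : ℤ) ^ m - (Fintype.card F : ℤ) ^ (m - 1)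
        + (τ : ℤ) * (Fintype.card F : ℤ) ^ (m - j - 1)) : ℚ) =
      (Fintype.card F - 1) * (Fintype.card F : ℚ) ^ (2 * j) * vRankType F m (2 * j) τ +
        (Fintype.card F - 1) / 2 * (Fintype.card F : ℚ) ^ (2 * j + 1) *
          vRank F m (2 * j + 1) := by
  rw [← sum_cnt_small hq]
  apply weightFreq_of_two_lt hq (by omega)
  rw [scale_eq_pow hj]
  push_cast
  ring

/-- The case j = 0, τ = -1: the zero form has no type -1, so only rank 1 contributes. -/
lemma weightFreq_sub_two_mul (hq : 2 < Fintype.card F) (hm : 1 ≤ m) :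
    (weightFreq (RM F 2 m)
        ((Fintype.card F : ℤ) ^ m - 2 * (Fintype.card F : ℤ) ^ (m - 1)) : ℚ) =
      (Fintype.card F : ℚ) * ((Fintype.card F : ℚ) - 1) *
        ((Fintype.card F : ℚ) ^ m - 1) / 2 := by
  have h := weightFreq_small hq hm (-1)
  rw [mul_zero, vRankType_zero, zero_add, vRank_one] at h
  rw [show (Fintype.card F : ℤ) ^ m - 2 * (Fintype.card F : ℤ) ^ (m - 1) =
    (Fintype.card F : ℤ) ^ m - (Fintype.card F : ℤ) ^ (m - 1) +
      ((-1 : ℤˣ) : ℤ) * (Fintype.card F : ℤ) ^ (m - 0 - 1) by push_cast; rw [Nat.sub_zero]; ring, h]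
  push_cast
  ring

/-- The case j = 0, τ = 1: besides rank 1, the zero form contributes the q - 1 nonzero constants. -/
lemma weightFreq_length (hq : 2 < Fintype.card F) (hm : 1 ≤ m) :
    (weightFreq (RM F 2 m) ((Fintype.card F : ℤ) ^ m) : ℚ) =
      (Fintype.card F : ℚ) * ((Fintype.card F : ℚ) - 1) *
        ((Fintype.card F : ℚ) ^ m - 1) / 2 + (Fintype.card F : ℚ) - 1 := by
  have h := weightFreq_small hq hm 1
  rw [mul_zero, vRankType_zero, zero_add, vRank_one] at h
  rw [show (Fintype.card F : ℤ) ^ m =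
    (Fintype.card F : ℤ) ^ m - (Fintype.card F : ℤ) ^ (m - 1) +
      ((1 : ℤˣ) : ℤ) * (Fintype.card F : ℤ) ^ (m - 0 - 1) by push_cast; rw [Nat.sub_zero]; ring, h]
  push_cast
  ring

/-- The total number q^(m+1) · q^(m(m+1)/2) of triples (Q, L, c), minus those of nonzero deviation.
-/
lemma weightFreq_middle (hq : 2 < Fintype.card F) (hm : 1 ≤ m) :
    (weightFreq (RM F 2 m) ((Fintype.card F : ℤ) ^ m - (Fintype.card F : ℤ) ^ (m - 1)) : ℚ) =
      (Fintype.card F : ℚ) ^ ((m ^ 2 + 3 * m + 2) / 2)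
        - (∑ j ∈ Finset.Icc 1 (m / 2), (Fintype.card F : ℚ) ^ (2 * j + 1) *
            ((vRankType F m (2 * j) 1 : ℚ) + (vRankType F m (2 * j) (-1) : ℚ)))
        - (∑ j ∈ Finset.Icc 0 (m / 2), ((Fintype.card F : ℚ) - 1) *
            (Fintype.card F : ℚ) ^ (2 * j + 1) * (vRank F m (2 * j + 1) : ℚ))
        - (Fintype.card F : ℚ) := by
  have h := weightFreq_of_two_lt hq hm
    (w := (Fintype.card F : ℤ) ^ m - (Fintype.card F : ℤ) ^ (m - 1)) (d := 0)
    (by push_cast; ring)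
  have e : (Fintype.card F : ℚ) ^ ((m ^ 2 + 3 * m + 2) / 2) =
      (Fintype.card F : ℚ) ^ (m + 1) * (Fintype.card F : ℚ) ^ (m * (m + 1) / 2) := by
    rw [← pow_add]
    congr 1
    rw [show m ^ 2 + 3 * m + 2 = m * (m + 1) + (m + 1) * 2 by ring,
      Nat.add_mul_div_right _ _ (by norm_num), add_comm]
  have hI : Finset.range (m / 2 + 1) = Finset.Icc 0 (m / 2) := by
    ext i
    simp
  -- The zero form, the term j = 0, accounts for the isolated -q.
  have hs : ∑ j ∈ Finset.range (m / 2 + 1), (Fintype.card F : ℚ) ^ (2 * j + 1) *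
      (vRank F m (2 * j) : ℚ) =
      ∑ j ∈ Finset.Icc 1 (m / 2), (Fintype.card F : ℚ) ^ (2 * j + 1) *
        (vRank F m (2 * j) : ℚ) + Fintype.card F := by
    rw [hI, ← Finset.add_sum_Ioc_eq_sum_Icc (Nat.zero_le _), mul_zero, vRank_zero,
      ← Finset.Icc_add_one_left_eq_Ioc]
    push_cast
    ring
  simp_rw [← vRank_even]
  rw [h, sum_cnt_zero, e, ← sum_vRank, ← hI, Finset.mul_sum]
  rw [sub_right_comm _ _ (Fintype.card F : ℚ), sub_sub _ _ (Fintype.card F : ℚ), ← hs,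
    ← Finset.sum_sub_distrib, ← Finset.sum_sub_distrib]
  refine Finset.sum_congr rfl fun i _ => ?_
  ring

lemma weightFreq_eq_zero (hm : 1 ≤ m) {w : ℤ} (h0 : w ≠ 0)
    (h1 : w ≠ (Fintype.card F : ℤ) ^ m - 2 * (Fintype.card F : ℤ) ^ (m - 1))
    (h2 : w ≠ (Fintype.card F : ℤ) ^ m - (Fintype.card F : ℤ) ^ (m - 1))
    (h3 : w ≠ (Fintype.card F : ℤ) ^ m)
    (h4 : ∀ j : ℕ, 1 ≤ j → j ≤ m / 2 → ∀ τ : ℤˣ,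
      w ≠ (Fintype.card F : ℤ) ^ m - (Fintype.card F : ℤ) ^ (m - 1)
        - (τ : ℤ) * (Fintype.card F : ℤ) ^ (m - j - 1) * ((Fintype.card F : ℤ) - 1) ∧
      w ≠ (Fintype.card F : ℤ) ^ m - (Fintype.card F : ℤ) ^ (m - 1) +
        (τ : ℤ) * (Fintype.card F : ℤ) ^ (m - j - 1)) :
    weightFreq (RM F 2 m) w = 0 := by
  by_contra h
  obtain ⟨Q, hQ⟩ := exists_cnt_ne_zero hm h
  have hc : ∀ v : ℤ, (w : ℚ) = v → w = v := fun v hv => by exact_mod_cast hv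
  have e := card_pow_eq (F := F) hm
  rcases exists_of_cnt_ne_zero hQ with hd | hd | ⟨τ, hd⟩ | ⟨k, hk, hkm, τ, hd | hd⟩
  · exact h2 (hc _ (by push_cast; linear_combination -hd))
  · rw [scale_zero hm] at hd
    exact h0 (hc _ (by push_cast; linear_combination e - hd))
  · rw [scale_zero hm] at hd
    rcases Int.units_eq_one_or τ with rfl | rfl <;> push_cast at hd
    · exact h1 (hc _ (by push_cast; linear_combination -hd))
    · exact h3 (hc _ (by push_cast; linear_combination -hd))
  · rw [scale_eq_pow (by omega)] at hd
    exact (h4 k hk hkm τ).1 (hc _ (by push_cast; linear_combination -hd))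
  · rw [scale_eq_pow (by omega)] at hd
    exact (h4 k hk hkm (-τ)).2 (hc _ (by push_cast; linear_combination -hd))

/-- Ranks 2j and 2j + 1 together contribute 2^m v_(2j), and the factor 2^m cancels against the
kernel. -/
lemma weightFreq_of_eq_two_scale (hq : Fintype.card F = 2) {j : ℕ} (hj : j + 1 ≤ m) (τ : ℤˣ) :
    (weightFreq (RM F 2 m) (2 ^ (m - 1) + (τ : ℤ) * 2 ^ (m - j - 1)) : ℚ) =
      vRank F m (2 * j) := by
  have hq' : (Fintype.card F : ℚ) = 2 := by rw [hq]; norm_num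
  -- More weight means fewer zeros, hence the sign -τ in the deviation.
  have h := weightFreq_of_eq_two (m := m) hq (by omega)
    (w := 2 ^ (m - 1) + (τ : ℤ) * 2 ^ (m - j - 1))
    (d := (((-τ : ℤˣ) : ℤ) : ℚ) * scale F (Fin m → F) j)
    (by rw [scale_eq_pow hj, hq']; push_cast; ring)
  have h2 := pow_mul_vRank_add (F := F) (m := m) j
  rw [hq'] at h2
  rw [sum_cnt_binary hq, h2] at h
  have : (2 : ℚ) ^ m ≠ 0 := by positivity
  apply mul_right_cancel₀ this
  rw [h, mul_comm]

lemma weightFreq_zero_of_eq_two (hq : Fintype.card F = 2) (hm : 1 ≤ m) :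
    weightFreq (RM F 2 m) 0 = 1 := by
  have h := weightFreq_of_eq_two_scale hq hm (-1)
  rw [mul_zero, vRank_zero, Nat.sub_zero] at h
  simpa using h

lemma weightFreq_length_of_eq_two (hq : Fintype.card F = 2) (hm : 1 ≤ m) :
    weightFreq (RM F 2 m) (2 ^ m) = 1 := by
  have h := weightFreq_of_eq_two_scale hq hm 1
  rw [mul_zero, vRank_zero, Nat.sub_zero, Units.val_one, one_mul, ← two_mul, ← pow_succ',
    Nat.sub_add_cancel hm] at h
  exact_mod_cast h

lemma weightFreq_of_eq_two_eq_prod (hq : Fintype.card F = 2) {j : ℕ} (hj : 1 ≤ j)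
    (hjm : j ≤ m / 2) (τ : ℤˣ) :
    (weightFreq (RM F 2 m) (2 ^ (m - 1) + (τ : ℤ) * 2 ^ (m - j - 1)) : ℚ) =
      (2 : ℚ) ^ (j ^ 2 + j) * (∏ i ∈ Finset.Icc (m - 2 * j + 1) m, ((2 : ℚ) ^ i - 1)) /
        (∏ i ∈ Finset.Icc 1 j, ((2 : ℚ) ^ (2 * i) - 1)) := by
  rw [weightFreq_of_eq_two_scale hq (by omega), vRank_even_eq,
    qFall_eq_prod card_ne_zero' (by omega), evenProd, hq, Nat.cast_ofNat]

lemma weightFreq_middle_of_eq_two (hq : Fintype.card F = 2) (hm : 1 ≤ m) :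
    (weightFreq (RM F 2 m) (2 ^ (m - 1)) : ℚ) =
      2 * ((2 : ℚ) ^ m - 1 + ∑ j ∈ Finset.Icc 1 ((m - 1) / 2),
        (2 : ℚ) ^ (j ^ 2 + j) * (∏ i ∈ Finset.Icc (m - 2 * j) m, ((2 : ℚ) ^ i - 1)) /
          (∏ i ∈ Finset.Icc 1 j, ((2 : ℚ) ^ (2 * i) - 1))) := by
  have hq' : (Fintype.card F : ℚ) = 2 := by rw [hq]; norm_num
  have h := weightFreq_of_eq_two hq hm (w := 2 ^ (m - 1)) (d := 0) (by push_cast; ring)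
  have hs : ∀ i ∈ Finset.range (m / 2 + 1),
      (((Fintype.card F : ℚ) ^ (m + 1) - (Fintype.card F : ℚ) ^ (2 * i + 1)) *
          vRank F m (2 * i) +
        ((Fintype.card F : ℚ) ^ (m + 1) -
          (Fintype.card F - 1) * (Fintype.card F : ℚ) ^ (2 * i + 1)) * vRank F m (2 * i + 1)) =
        2 ^ m * (2 * vRank F m (2 * i + 1)) := by
    intro i _
    have h2 := pow_mul_vRank_add (F := F) (m := m) i
    rw [hq'] at h2 ⊢
    linear_combination -2 * h2
  rw [sum_cnt_zero, Finset.sum_congr rfl hs, ← Finset.mul_sum, ← Finset.mul_sum, mul_comm] at h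
  rw [mul_left_cancel₀ (by positivity) h]
  congr 1
  rw [Finset.sum_range_eq_add_Ico _ (Nat.succ_pos _), mul_zero, zero_add, vRank_one, hq']
  congr 1
  symm
  -- For even m the index m/2 is surplus; it belongs to rank m + 1 and contributes 0.
  refine Finset.sum_subset_zero_on_sdiff (fun i hi => ?_) (fun i hi => ?_) fun i hi => ?_
  · rw [Finset.mem_Icc] at hi
    rw [Finset.mem_Ico]
    omega
  · rw [Finset.mem_sdiff, Finset.mem_Ico, Finset.mem_Icc] at hi
    rw [vRank_eq_zero (by omega), Nat.cast_zero]
  · rw [Finset.mem_Icc] at hi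
    rw [vRank_odd_eq_prod (by omega), hq']

/-- The general list of weights at q = 2: q^m - 2q^(m-1) becomes 0, and since q - 1 = 1 the two
families for j ≥ 1 agree up to the sign of τ. -/
lemma weightFreq_eq_zero_of_eq_two (hq : Fintype.card F = 2) (hm : 1 ≤ m) {w : ℤ} (h0 : w ≠ 0)
    (h1 : w ≠ 2 ^ (m - 1)) (h2 : w ≠ 2 ^ m)
    (h3 : ∀ j : ℕ, 1 ≤ j → j ≤ m / 2 → ∀ τ : ℤˣ,
      w ≠ 2 ^ (m - 1) + (τ : ℤ) * 2 ^ (m - j - 1)) :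
    weightFreq (RM F 2 m) w = 0 := by
  have e : (2 : ℤ) ^ m = 2 * 2 ^ (m - 1) := by rw [← pow_succ', Nat.sub_add_cancel hm]
  apply weightFreq_eq_zero hm h0 <;> rw [hq] <;> push_cast
  · rw [e, sub_self]
    exact h0
  · rw [e, two_mul, add_sub_cancel_right]
    exact h1
  · exact h2
  · intro j hj hjm τ
    rw [e]
    constructor
    · have := h3 j hj hjm (-τ)
      push_cast at this
      intro h
      exact this (by linear_combination h)
    · intro h
      exact h3 j hj hjm τ (by linear_combination h)

end Frequencies

end ReedMuller

theorem theorem1 (F : Type*) [Field F] [Fintype F] [DecidableEq F] (q m : ℕ)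
    (hq : Fintype.card F = q) :
    -- the numbers of quadratic forms of given rank and type
    ((∀ j : ℕ, 2 * j + 1 ≤ m →
        (ReedMuller.vRank F m (2 * j + 1) : ℚ) =
          (q : ℚ) ^ (j ^ 2 + j) * (∏ i ∈ Finset.Icc (m - 2 * j) m, ((q : ℚ) ^ i - 1)) /
            (∏ i ∈ Finset.Icc 1 j, ((q : ℚ) ^ (2 * i) - 1))) ∧
      (∀ j : ℕ, m < 2 * j + 1 → ReedMuller.vRank F m (2 * j + 1) = 0) ∧
      ReedMuller.vRankType F m 0 1 = 1 ∧
      (∀ j : ℕ, 1 ≤ j → 2 * j ≤ m → ∀ τ : ℤˣ,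
        (ReedMuller.vRankType F m (2 * j) τ : ℚ) =
          (q : ℚ) ^ (j ^ 2) * ((q : ℚ) ^ j + ((τ : ℤ) : ℚ)) / 2 *
            (∏ i ∈ Finset.Icc (m - 2 * j + 1) m, ((q : ℚ) ^ i - 1)) /
            (∏ i ∈ Finset.Icc 1 j, ((q : ℚ) ^ (2 * i) - 1)))) ∧
    -- the binary case
    (q = 2 → 2 ≤ m →
      ReedMuller.weightFreq (ReedMuller.RM F 2 m) 0 = 1 ∧
      (ReedMuller.weightFreq (ReedMuller.RM F 2 m) (2 ^ (m - 1)) : ℚ) =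
        2 * ((2 : ℚ) ^ m - 1 + ∑ j ∈ Finset.Icc 1 ((m - 1) / 2),
          (2 : ℚ) ^ (j ^ 2 + j) * (∏ i ∈ Finset.Icc (m - 2 * j) m, ((2 : ℚ) ^ i - 1)) /
            (∏ i ∈ Finset.Icc 1 j, ((2 : ℚ) ^ (2 * i) - 1))) ∧
      (∀ j : ℕ, 1 ≤ j → j ≤ m / 2 → ∀ τ : ℤˣ,
        (ReedMuller.weightFreq (ReedMuller.RM F 2 m)
            (2 ^ (m - 1) + (τ : ℤ) * 2 ^ (m - j - 1)) : ℚ) =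
          (2 : ℚ) ^ (j ^ 2 + j) * (∏ i ∈ Finset.Icc (m - 2 * j + 1) m, ((2 : ℚ) ^ i - 1)) /
            (∏ i ∈ Finset.Icc 1 j, ((2 : ℚ) ^ (2 * i) - 1))) ∧
      ReedMuller.weightFreq (ReedMuller.RM F 2 m) (2 ^ m) = 1 ∧
      (∀ w : ℤ, w ≠ 0 → w ≠ 2 ^ (m - 1) → w ≠ 2 ^ m →
        (∀ j : ℕ, 1 ≤ j → j ≤ m / 2 → ∀ τ : ℤˣ,
          w ≠ 2 ^ (m - 1) + (τ : ℤ) * 2 ^ (m - j - 1)) →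
        ReedMuller.weightFreq (ReedMuller.RM F 2 m) w = 0)) ∧
    -- the case of more than two elements
    (2 < q → 1 ≤ m →
      ReedMuller.weightFreq (ReedMuller.RM F 2 m) 0 = 1 ∧
      (∀ j : ℕ, 1 ≤ j → j ≤ m / 2 → ∀ τ : ℤˣ,
        (ReedMuller.weightFreq (ReedMuller.RM F 2 m)
            ((q : ℤ) ^ m - (q : ℤ) ^ (m - 1)
              - (τ : ℤ) * (q : ℤ) ^ (m - j - 1) * ((q : ℤ) - 1)) : ℚ) =
          (q : ℚ) ^ (j ^ 2 + 2 * j) * ((q : ℚ) ^ j + ((τ : ℤ) : ℚ)) / 2 *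
            (∏ i ∈ Finset.Icc (m - 2 * j + 1) m, ((q : ℚ) ^ i - 1)) /
            (∏ i ∈ Finset.Icc 1 j, ((q : ℚ) ^ (2 * i) - 1))) ∧
      (∀ j : ℕ, 1 ≤ j → j ≤ m / 2 → ∀ τ : ℤˣ,
        (ReedMuller.weightFreq (ReedMuller.RM F 2 m)
            ((q : ℤ) ^ m - (q : ℤ) ^ (m - 1) + (τ : ℤ) * (q : ℤ) ^ (m - j - 1)) : ℚ) =
          ((q : ℚ) - 1) * (q : ℚ) ^ (2 * j) * (ReedMuller.vRankType F m (2 * j) τ : ℚ) +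
            ((q : ℚ) - 1) / 2 * (q : ℚ) ^ (2 * j + 1) *
              (ReedMuller.vRank F m (2 * j + 1) : ℚ)) ∧
      (ReedMuller.weightFreq (ReedMuller.RM F 2 m)
          ((q : ℤ) ^ m - 2 * (q : ℤ) ^ (m - 1)) : ℚ) =
        (q : ℚ) * ((q : ℚ) - 1) * ((q : ℚ) ^ m - 1) / 2 ∧
      (ReedMuller.weightFreq (ReedMuller.RM F 2 m)
          ((q : ℤ) ^ m - (q : ℤ) ^ (m - 1)) : ℚ) =
        (q : ℚ) ^ ((m ^ 2 + 3 * m + 2) / 2)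
          - (∑ j ∈ Finset.Icc 1 (m / 2), (q : ℚ) ^ (2 * j + 1) *
              ((ReedMuller.vRankType F m (2 * j) 1 : ℚ) +
                (ReedMuller.vRankType F m (2 * j) (-1) : ℚ)))
          - (∑ j ∈ Finset.Icc 0 (m / 2), ((q : ℚ) - 1) * (q : ℚ) ^ (2 * j + 1) *
              (ReedMuller.vRank F m (2 * j + 1) : ℚ))
          - (q : ℚ) ∧
      (ReedMuller.weightFreq (ReedMuller.RM F 2 m) ((q : ℤ) ^ m) : ℚ) =
        (q : ℚ) * ((q : ℚ) - 1) * ((q : ℚ) ^ m - 1) / 2 + (q : ℚ) - 1 ∧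
      (∀ w : ℤ, w ≠ 0 → w ≠ (q : ℤ) ^ m - 2 * (q : ℤ) ^ (m - 1) →
        w ≠ (q : ℤ) ^ m - (q : ℤ) ^ (m - 1) → w ≠ (q : ℤ) ^ m →
        (∀ j : ℕ, 1 ≤ j → j ≤ m / 2 → ∀ τ : ℤˣ,
          w ≠ (q : ℤ) ^ m - (q : ℤ) ^ (m - 1)
              - (τ : ℤ) * (q : ℤ) ^ (m - j - 1) * ((q : ℤ) - 1) ∧
          w ≠ (q : ℤ) ^ m - (q : ℤ) ^ (m - 1) + (τ : ℤ) * (q : ℤ) ^ (m - j - 1)) →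
        ReedMuller.weightFreq (ReedMuller.RM F 2 m) w = 0)) := by
  subst hq
  refine ⟨⟨fun j hj => ReedMuller.vRank_odd_eq_prod hj, fun j hj => ReedMuller.vRank_eq_zero hj,
    ReedMuller.vRankType_zero_one, fun j _ hj τ => ReedMuller.vRankType_even_eq_prod hj τ⟩,
    fun hq hm => ⟨ReedMuller.weightFreq_zero_of_eq_two hq (by omega),
      ReedMuller.weightFreq_middle_of_eq_two hq (by omega),
      fun j hj hjm τ => ReedMuller.weightFreq_of_eq_two_eq_prod hq hj hjm τ,
      ReedMuller.weightFreq_length_of_eq_two hq (by omega),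
      fun w => ReedMuller.weightFreq_eq_zero_of_eq_two hq (by omega)⟩,
    fun hq hm => ⟨ReedMuller.weightFreq_zero_of_two_lt hq hm, fun j hj hjm τ => ?_,
      fun j hj hjm τ => ReedMuller.weightFreq_small hq (by omega) τ,
      ReedMuller.weightFreq_sub_two_mul hq hm, ReedMuller.weightFreq_middle hq hm,
      ReedMuller.weightFreq_length hq hm, fun w => ReedMuller.weightFreq_eq_zero hm⟩⟩
  -- The exponent j² + 2j combines q^(j²) from the number of forms with the q^(2j) affine functions
  -- for each form.
  rw [ReedMuller.weightFreq_large hq hj hjm, ReedMuller.vRankType_even_eq_prod (by omega),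
    pow_add]
  ring
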